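/- Let $k$ be a field of characteristic zero. A dg operad $P$ is a symmetric operad, with parts $P(l)$ in all arities $l\ge 0$, in cochain complexes of $k$-vector spaces ($\mathbb Z$-graded, differential of degree $+1$). A morphism of dg operads is a quasi-isomorphism if it is one in every arity. Let $\mathrm{Ass}_+$ be the unitary associative operad, $\mathrm{Ass}_+(l)=k[\Sigma_l]$ for all $l\ge 0$, and let $I_+$ be the initial unitary operad, $I_+(0)=I_+(1)=k$ and $I_+(l)=0$ for $l\ge 2$. An operad $P$ is unitary if $P(0)=k$ (spanned by a unit $1$, in degree $0$); its restriction operations are $\delta_i:P(n)\to P(n-1)$, $\delta_i(\omega)=\omega\circ_i 1$. Its truncation $\tau P$ is the suboperad with $\tau P(0)=0$ and $\tau P(l)=P(l)$ for $l>0$. For a graded $\Sigma$-module $M$ with $M(0)=M(1)=0$, we write $P=\Gamma_{+1}(M)$ if $P$ is unitary and $\tau P$ is, as a graded operad, the free operad $\Gamma(M)$ on $M$. Let $n\ge 2$ and let $P$ be a unitary dg operad with $P=\Gamma_{+1}(M)$ as a graded operad, where $M(0)=M(1)=0$. A *unitary principal extension of arity $n$* of $P$ is a morphism of dg operads $P\to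 Q$ such that $Q=\Gamma_{+1}(M\oplus E)$ as a graded operad, for a graded $\Sigma$-module $E$ concentrated in arity $n$, the morphism being the identity on the generators $M$ and sending the unit of $P$ to that of $Q$, and such that * the differential of $Q$ restricts on $E$ to a $\Sigma_n$-equivariant map $d:E\to ZP(n)$ of degree $+1$ into the cocycles of $P(n)$; * the restriction operations of $Q$ restrict on $E$ to maps $\delta_i:E\to P(n-1)$, $i=1,\dots,n$, with $\partial\delta_i=\delta_i d$. A *unitary Sullivan minimal operad* is a colimit $P_\infty=\varinjlim_n P_n$, in the category of dg operads, of a sequence $I_+=P_1\to P_2\to P_3\to\cdots$ in which each $P_{n-1}\to P_n$ is a unitary principal extension of arity $n$ ($n\ge 2$). **Theorem.** Let $P$ be a dg operad over $k$ with a unitary multiplication, that is, with a morphism of dg operads $\varphi:\mathrm{Ass}_+\to P$. Suppose that $HP(1)=k$ and $HP(0)=k$, both concentrated in degree $0$. Then $P$ has a Sullivan minimal model: there are a unitary Sullivan minimal operad $P_\infty$ and a quasi-isomorphism of dg operads $\rho:P_\infty\to P$. Moreover $\rho$ sends the unit of $P_\infty$ to the unit $\varphi(1)\in P(0)$ of $P$,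 and $P_\infty(0)=P_\infty(1)=k$, concentrated in degree $0$. -/

import Mathlib

open CategoryTheory Limits

universe u

/-! ## Inputs of a partial composite

If `x` has `l` inputs, `y` has `m` inputs and `l + m = n + 1`, then `x ∘_i y` has `n` inputs: the
inputs of `y`, which occupy the positions `i, …, i + m - 1`, and the inputs `j ≠ i` of `x`.
Inputs are numbered from `0`. -/

/-- The position in `x ∘_i y` of the `t`-th input of `y`. -/
def innerPos {l m n : ℕ} (hn : l + m = n + 1) (i : Fin l) (t : Fin m) : Fin n :=
  ⟨i.1 + t.1, by have := i.2; have := t.2; omega⟩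

/-- The position in `x ∘_i y` of the `j`-th input of `x`, for `j ≠ i`. -/
def outerPos {l m n : ℕ} (hn : l + m = n + 1) (i : Fin l) (j : {j : Fin l // j ≠ i}) : Fin n :=
  ⟨if j.1.1 < i.1 then j.1.1 else j.1.1 + m - 1, by
    have h1 := i.2
    have h2 := j.1.2
    have h3 : j.1.1 ≠ i.1 := fun h => j.2 (Fin.ext h)
    split <;> omega⟩

/-- The inputs of `x ∘_i y` are the inputs `j ≠ i` of `x` together with the inputs of `y`. -/
noncomputable def inputsEquiv {l m n : ℕ} (hn : l + m = n + 1) (i : Fin l) :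
    {j : Fin l // j ≠ i} ⊕ Fin m ≃ Fin n :=
  Equiv.ofBijective (Sum.elim (outerPos hn i) (innerPos hn i)) (by
    constructor
    · rintro (⟨j, hj⟩ | t) (⟨j', hj'⟩ | t') h
      · have h1 : j.1 ≠ i.1 := fun h => hj (Fin.ext h)
        have h2 : j'.1 ≠ i.1 := fun h => hj' (Fin.ext h)
        simp only [Sum.elim_inl, outerPos, Fin.ext_iff] at h
        have h3 : j = j' := Fin.ext (by split_ifs at h <;> omega)
        subst h3
        rfl
      · have h1 : j.1 ≠ i.1 := fun h => hj (Fin.ext h)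
        have := t'.2
        simp only [Sum.elim_inl, Sum.elim_inr, outerPos, innerPos, Fin.ext_iff] at h
        exfalso
        split_ifs at h <;> omega
      · have h1 : j'.1 ≠ i.1 := fun h => hj' (Fin.ext h)
        have := t.2
        simp only [Sum.elim_inl, Sum.elim_inr, outerPos, innerPos, Fin.ext_iff] at h
        exfalso
        split_ifs at h <;> omega
      · simp only [Sum.elim_inr, innerPos, Fin.ext_iff] at h
        have h3 : t = t' := Fin.ext (by omega)
        rw [h3]
    · intro a
      have ha := a.2
      have hi := i.2
      by_cases h1 : a.1 < i.1
      · refine ⟨Sum.inl ⟨⟨a.1, by omega⟩, fun h => ?_⟩, ?_⟩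
        · simp only [Fin.ext_iff] at h
          omega
        · simp [outerPos, h1]
      · by_cases h2 : a.1 < i.1 + m
        · refine ⟨Sum.inr ⟨a.1 - i.1, by omega⟩, ?_⟩
          simp only [Sum.elim_inr, innerPos, Fin.ext_iff]
          omega
        · refine ⟨Sum.inl ⟨⟨a.1 + 1 - m, by omega⟩, fun h => ?_⟩, ?_⟩
          · simp only [Fin.ext_iff] at h
            omega
          · simp only [Sum.elim_inl, outerPos, Fin.ext_iff]
            split_ifs <;> omega)

/-- The permutation `σ ∘_i τ` of the inputs of a composite: it sends the inputs of the inner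
operation (inserted at `i`) to those of the inner operation (inserted at `σ i`) by `τ`, and the
other inputs `j ≠ i` of the outer operation to the inputs `σ j ≠ σ i`. -/
noncomputable def blockPerm {l m n : ℕ} (hn : l + m = n + 1) (i : Fin l)
    (σ : Equiv.Perm (Fin l)) (τ : Equiv.Perm (Fin m)) : Equiv.Perm (Fin n) :=
  (inputsEquiv hn i).symm.trans
    ((Equiv.sumCongr
      (σ.subtypeEquiv (fun _ => (σ.injective.ne_iff).symm) : {j // j ≠ i} ≃ {j // j ≠ σ i})
      τ).trans (inputsEquiv hn (σ i)))

theorem blockPerm_innerPos {l m n : ℕ} (hn : l + m = n + 1) (i : Fin l)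
    (σ : Equiv.Perm (Fin l)) (τ : Equiv.Perm (Fin m)) (t : Fin m) :
    blockPerm hn i σ τ (innerPos hn i t) = innerPos hn (σ i) (τ t) := by
  have h : innerPos hn i t = inputsEquiv hn i (Sum.inr t) := rfl
  rw [h, blockPerm, Equiv.trans_apply, Equiv.symm_apply_apply]
  rfl

theorem blockPerm_outerPos {l m n : ℕ} (hn : l + m = n + 1) (i : Fin l)
    (σ : Equiv.Perm (Fin l)) (τ : Equiv.Perm (Fin m)) (j : {j : Fin l // j ≠ i}) :
    blockPerm hn i σ τ (outerPos hn i j)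
      = outerPos hn (σ i) ⟨σ j.1, fun h => j.2 (σ.injective h)⟩ := by
  have h : outerPos hn i j = inputsEquiv hn i (Sum.inl j) := rfl
  rw [h, blockPerm, Equiv.trans_apply, Equiv.symm_apply_apply]
  rfl

theorem eq_outerPos_or_innerPos {l m n : ℕ} (hn : l + m = n + 1) (i : Fin l) (a : Fin n) :
    (∃ j, a = outerPos hn i j) ∨ ∃ t, a = innerPos hn i t := by
  obtain ⟨s, rfl⟩ := (inputsEquiv hn i).surjective a
  rcases s with j | t
  · exact Or.inl ⟨j, rfl⟩
  · exact Or.inr ⟨t, rfl⟩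

/-- The value of `σ ∘_i τ` at a position that comes from the inner operation. -/
theorem blockPerm_val_inner {l m n : ℕ} (hn : l + m = n + 1) (i : Fin l)
    (σ : Equiv.Perm (Fin l)) (τ : Equiv.Perm (Fin m)) (a : Fin n) (t : Fin m)
    (ha : a.1 = i.1 + t.1) : (blockPerm hn i σ τ a).1 = (σ i).1 + (τ t).1 := by
  have h : a = innerPos hn i t := Fin.ext ha
  rw [h, blockPerm_innerPos]
  rfl

/-- The value of `σ ∘_i τ` at a position that comes from the outer operation. -/
theorem blockPerm_val_outer {l m n : ℕ} (hn : l + m = n + 1) (i : Fin l)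
    (σ : Equiv.Perm (Fin l)) (τ : Equiv.Perm (Fin m)) (a : Fin n) (j : Fin l) (hj : j ≠ i)
    (ha : a.1 = if j.1 < i.1 then j.1 else j.1 + m - 1) :
    (blockPerm hn i σ τ a).1
      = if (σ j).1 < (σ i).1 then (σ j).1 else (σ j).1 + m - 1 := by
  have h : a = outerPos hn i ⟨j, hj⟩ := Fin.ext ha
  rw [h, blockPerm_outerPos]
  rfl

/-! ## Graded symmetric sequences and graded operads -/

/-- A graded `Σ`-module: graded vector spaces `M(l) = ⨁ₚ M(l)ᵖ`, `l ≥ 0`, with a right action of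
the symmetric group `Σ_l` on `M(l)`. Here `obj l p` is `M(l)ᵖ`. -/
structure SigmaModule (k : Type u) [Field k] where
  obj : ℕ → ℤ → Type u
  [addCommGroup : ∀ l p, AddCommGroup (obj l p)]
  [module : ∀ l p, Module k (obj l p)]
  act : ∀ {l : ℕ} {p : ℤ}, Equiv.Perm (Fin l) → obj l p →ₗ[k] obj l p
  act_one : ∀ {l : ℕ} {p : ℤ} (x : obj l p), act 1 x = x
  act_mul : ∀ {l : ℕ} {p : ℤ} (σ τ : Equiv.Perm (Fin l)) (x : obj l p),
    act (σ * τ) x = act τ (act σ x)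

attribute [instance] SigmaModule.addCommGroup SigmaModule.module

/-- A morphism of graded `Σ`-modules (of degree zero). -/
@[ext]
structure SigmaModule.Hom {k : Type u} [Field k] (M N : SigmaModule k) where
  map : ∀ (l : ℕ) (p : ℤ), M.obj l p →ₗ[k] N.obj l p
  map_act : ∀ {l : ℕ} {p : ℤ} (σ : Equiv.Perm (Fin l)) (x : M.obj l p),
    map l p (M.act σ x) = N.act σ (map l p x)

/-- The direct sum of two graded `Σ`-modules. -/
def SigmaModule.sum {k : Type u} [Field k] (M N : SigmaModule k) : SigmaModule k where
  obj l p := M.obj l p × N.obj l p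
  act σ := (M.act σ).prodMap (N.act σ)
  act_one x := by simp [M.act_one, N.act_one]
  act_mul σ τ x := by simp [M.act_mul, N.act_mul]

/-- A graded operad, in terms of partial composition products
`∘_i : P(l)ᵖ ⊗ P(m)^q ⟶ P(l + m - 1)^(p + q)`, with the Koszul sign rule. All arities `l ≥ 0` are
allowed. The target arity `n` is written with a proof of `l + m = n + 1`, and the target degree `r`
with a proof of `p + q = r`. -/
structure GradedOperad (k : Type u) [Field k] extends SigmaModule k where
  /-- The identity operation. -/
  ident : obj 1 0
  /-- The partial composite `x ∘_i y`. -/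
  comp : ∀ {l m n : ℕ} {p q r : ℤ}, l + m = n + 1 → p + q = r → Fin l →
    (obj l p →ₗ[k] obj m q →ₗ[k] obj n r)
  ident_comp : ∀ {m : ℕ} {q : ℤ} (hn : 1 + m = m + 1) (hr : 0 + q = q) (i : Fin 1) (y : obj m q),
    comp hn hr i ident y = y
  comp_ident : ∀ {l : ℕ} {p : ℤ} (hn : l + 1 = l + 1) (hr : p + 0 = p) (i : Fin l) (x : obj l p),
    comp hn hr i x ident = x
  /-- `(x ∘_i y) ∘_{i + j} z = x ∘_i (y ∘_j z)`. -/
  comp_assoc : ∀ {l m n a b c : ℕ} {p q r s s' t : ℤ}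
    (h₁ : l + m = a + 1) (g₁ : p + q = s) (h₂ : a + n = c + 1) (g₂ : s + r = t)
    (h₃ : m + n = b + 1) (g₃ : q + r = s') (h₄ : l + b = c + 1) (g₄ : p + s' = t)
    (i : Fin l) (j : Fin m) (e : Fin a), e.1 = i.1 + j.1 →
    ∀ (x : obj l p) (y : obj m q) (z : obj n r),
      comp h₂ g₂ e (comp h₁ g₁ i x y) z = comp h₄ g₄ i x (comp h₃ g₃ j y z)
  /-- `(x ∘_i y) ∘_{j + m - 1} z = (-1)^{|y||z|} (x ∘_j z) ∘_i y` for `i < j`. -/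
  comp_comm : ∀ {l m n a b c : ℕ} {p q r s s' t : ℤ}
    (h₁ : l + m = a + 1) (g₁ : p + q = s) (h₂ : a + n = c + 1) (g₂ : s + r = t)
    (h₃ : l + n = b + 1) (g₃ : p + r = s') (h₄ : b + m = c + 1) (g₄ : s' + q = t)
    (i j : Fin l) (e : Fin a) (e' : Fin b), i < j → e.1 + 1 = j.1 + m → e'.1 = i.1 →
    ∀ (x : obj l p) (y : obj m q) (z : obj n r),
      comp h₂ g₂ e (comp h₁ g₁ i x y) z
        = (q * r).negOnePow • comp h₄ g₄ e' (comp h₃ g₃ j x z) y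
  /-- `(x · σ) ∘_i (y · τ) = (x ∘_{σ i} y) · (σ ∘_i τ)`. -/
  comp_act : ∀ {l m n : ℕ} {p q r : ℤ} (hn : l + m = n + 1) (hr : p + q = r) (i : Fin l)
    (σ : Equiv.Perm (Fin l)) (τ : Equiv.Perm (Fin m)) (x : obj l p) (y : obj m q),
      comp hn hr i (act σ x) (act τ y) = act (blockPerm hn i σ τ) (comp hn hr (σ i) x y)

/-- A morphism of graded operads. -/
@[ext]
structure GradedOperad.Hom {k : Type u} [Field k] (P Q : GradedOperad k) extends
    SigmaModule.Hom P.toSigmaModule Q.toSigmaModule where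
  map_ident : map 1 0 P.ident = Q.ident
  map_comp : ∀ {l m n : ℕ} {p q r : ℤ} (hn : l + m = n + 1) (hr : p + q = r) (i : Fin l)
    (x : P.obj l p) (y : P.obj m q),
      map n r (P.comp hn hr i x y) = Q.comp hn hr i (map l p x) (map m q y)

/-- The restriction of a bilinear map to submodules. -/
def restrictBilin {k A B C : Type*} [CommSemiring k] [AddCommMonoid A] [AddCommMonoid B]
    [AddCommMonoid C] [Module k A] [Module k B] [Module k C] (f : A →ₗ[k] B →ₗ[k] C)
    (S : Submodule k A) (T : Submodule k B) (U : Submodule k C)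
    (h : ∀ x ∈ S, ∀ y ∈ T, f x y ∈ U) : S →ₗ[k] T →ₗ[k] U :=
  LinearMap.mk₂ k (fun x y => ⟨f x.1 y.1, h x.1 x.2 y.1 y.2⟩)
    (fun _ _ _ => Subtype.ext (f.map_add₂ _ _ _))
    (fun _ _ _ => Subtype.ext (f.map_smul₂ _ _ _))
    (fun _ _ _ => Subtype.ext (map_add _ _ _))
    (fun _ _ _ => Subtype.ext (map_smul _ _ _))

/-- The submodule `{x | x = 0}` if the condition `c` holds, and everything otherwise. -/
def zeroWhen (k : Type*) {A : Type*} [Semiring k] [AddCommMonoid A] [Module k A] (c : Prop) :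
    Submodule k A where
  carrier := {x | c → x = 0}
  add_mem' hx hy h := by rw [hx h, hy h, add_zero]
  zero_mem' _ := rfl
  smul_mem' a x hx h := by rw [hx h, smul_zero]

/-- The non-unitary truncation `τP` of a graded operad `P`: the suboperad with `τP(0) = 0` and
`τP(l) = P(l)` for `l > 0`. -/
def GradedOperad.trunc {k : Type u} [Field k] (P : GradedOperad k) : GradedOperad k where
  obj l p := (zeroWhen k (l = 0) : Submodule k (P.obj l p))
  act σ := (P.act σ).restrict (fun x hx h => by rw [hx h, map_zero])
  act_one x := Subtype.ext (P.act_one x.1)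
  act_mul σ τ x := Subtype.ext (P.act_mul σ τ x.1)
  ident := ⟨P.ident, fun h => absurd h one_ne_zero⟩
  comp {l m n p q r} hn hr i := restrictBilin (P.comp hn hr i) _ _ _ (fun x _ y hy h => by
    have := i.2
    rw [hy (by omega), map_zero])
  ident_comp hn hr i y := Subtype.ext (P.ident_comp hn hr i y.1)
  comp_ident hn hr i x := Subtype.ext (P.comp_ident hn hr i x.1)
  comp_assoc h₁ g₁ h₂ g₂ h₃ g₃ h₄ g₄ i j e he x y z :=
    Subtype.ext (P.comp_assoc h₁ g₁ h₂ g₂ h₃ g₃ h₄ g₄ i j e he x.1 y.1 z.1)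
  comp_comm h₁ g₁ h₂ g₂ h₃ g₃ h₄ g₄ i j e e' hij he he' x y z :=
    Subtype.ext (P.comp_comm h₁ g₁ h₂ g₂ h₃ g₃ h₄ g₄ i j e e' hij he he' x.1 y.1 z.1)
  comp_act hn hr i σ τ x y := Subtype.ext (P.comp_act hn hr i σ τ x.1 y.1)

/-- The graded operad `G` is the free graded operad `Γ(M)` on the graded `Σ`-module `M`, with
universal map `i : M ⟶ G`; that is, `Γ` is the left adjoint of the forgetful functor from graded
operads to graded `Σ`-modules. -/
def GradedOperad.IsFree {k : Type u} [Field k] (M : SigmaModule k) (G : GradedOperad k)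
    (i : SigmaModule.Hom M G.toSigmaModule) : Prop :=
  ∀ (R : GradedOperad k) (f : SigmaModule.Hom M R.toSigmaModule),
    ∃! ψ : GradedOperad.Hom G R, ∀ (l : ℕ) (p : ℤ) (x : M.obj l p),
      ψ.map l p (i.map l p x) = f.map l p x

/-! ## Differential graded operads -/

/-- A dg operad: a graded operad with a differential of degree `+1` which commutes with the
symmetric group actions and satisfies the Leibniz rule. -/
structure DGOperad (k : Type u) [Field k] extends GradedOperad k where
  d : ∀ (l : ℕ) (p : ℤ), obj l p →ₗ[k] obj l (p + 1)
  d_d : ∀ {l : ℕ} {p : ℤ} (x : obj l p), d l (p + 1) (d l p x) = 0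
  d_act : ∀ {l : ℕ} {p : ℤ} (σ : Equiv.Perm (Fin l)) (x : obj l p),
    d l p (act σ x) = act σ (d l p x)
  d_comp : ∀ {l m n : ℕ} {p q r : ℤ} (hn : l + m = n + 1) (hr : p + q = r) (i : Fin l)
    (x : obj l p) (y : obj m q),
      d n r (comp hn hr i x y)
        = comp hn (by omega : p + 1 + q = r + 1) i (d l p x) y
          + p.negOnePow • comp hn (by omega : p + (q + 1) = r + 1) i x (d m q y)

namespace DGOperad

variable {k : Type u} [Field k]

/-- A morphism of dg operads. -/
@[ext]
structure Hom (P Q : DGOperad k) extends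
    toGradedHom : GradedOperad.Hom P.toGradedOperad Q.toGradedOperad where
  map_d : ∀ {l : ℕ} {p : ℤ} (x : P.obj l p), map l (p + 1) (P.d l p x) = Q.d l p (map l p x)

/-- The category of dg operads. -/
instance : Category (DGOperad k) where
  Hom := Hom
  id P :=
    { map := fun _ _ => LinearMap.id
      map_act := fun _ _ => rfl
      map_ident := rfl
      map_comp := fun _ _ _ _ _ => rfl
      map_d := fun _ => rfl }
  comp f g :=
    { map := fun l p => (g.map l p).comp (f.map l p)
      map_act := fun σ x => by simp [f.map_act, g.map_act]
      map_ident := by simp [f.map_ident, g.map_ident]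
      map_comp := fun hn hr i x y => by simp [f.map_comp, g.map_comp]
      map_d := fun x => by simp [f.map_d, g.map_d] }

/-- The cochain complex `P(l)`. -/
noncomputable def complex (P : DGOperad k) (l : ℕ) : CochainComplex (ModuleCat.{u} k) ℤ :=
  CochainComplex.of (fun p => ModuleCat.of k (P.obj l p)) (fun p => ModuleCat.ofHom (P.d l p))
    (fun p => by
      ext x
      exact P.d_d x)

/-- The morphism of cochain complexes `P(l) ⟶ Q(l)` underlying a morphism of dg operads. -/
noncomputable def complexMap {P Q : DGOperad k} (f : P ⟶ Q) (l : ℕ) : P.complex l ⟶ Q.complex l :=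
  CochainComplex.ofHom (fun p => ModuleCat.ofHom (f.map l p)) (fun p => by
    simp only [complex, CochainComplex.of_d]
    ext x
    exact (f.map_d x).symm)

/-- A quasi-isomorphism of dg operads: a quasi-isomorphism of complexes in each arity. -/
def IsQuis {P Q : DGOperad k} (f : P ⟶ Q) : Prop :=
  ∀ l : ℕ, QuasiIso (complexMap f l)

/-- `HP(l) = k`: the cohomology of `P(l)` is the ground field, concentrated in degree `0`. -/
def CohomologyIsGround (P : DGOperad k) (l : ℕ) : Prop :=
  Nonempty ((P.complex l).homology 0 ≅ ModuleCat.of k k) ∧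
    ∀ p : ℤ, p ≠ 0 → IsZero ((P.complex l).homology p)

/-- `P(l) = k`: the complex `P(l)` is the ground field, concentrated in degree `0`. -/
def IsGround (P : DGOperad k) (l : ℕ) : Prop :=
  Nonempty (P.obj l 0 ≃ₗ[k] k) ∧ ∀ p : ℤ, p ≠ 0 → Subsingleton (P.obj l p)

end DGOperad

/-! ## The operads `Ass₊` and `I₊` -/

/-- An operad in sets. -/
structure SetOperad where
  obj : ℕ → Type
  act : ∀ {l : ℕ}, Equiv.Perm (Fin l) → obj l → obj l
  act_one : ∀ {l : ℕ} (x : obj l), act 1 x = x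
  act_mul : ∀ {l : ℕ} (σ τ : Equiv.Perm (Fin l)) (x : obj l), act (σ * τ) x = act τ (act σ x)
  ident : obj 1
  comp : ∀ {l m n : ℕ}, l + m = n + 1 → Fin l → obj l → obj m → obj n
  ident_comp : ∀ {m : ℕ} (hn : 1 + m = m + 1) (i : Fin 1) (y : obj m), comp hn i ident y = y
  comp_ident : ∀ {l : ℕ} (hn : l + 1 = l + 1) (i : Fin l) (x : obj l), comp hn i x ident = x
  comp_assoc : ∀ {l m n a b c : ℕ} (h₁ : l + m = a + 1) (h₂ : a + n = c + 1)
    (h₃ : m + n = b + 1) (h₄ : l + b = c + 1) (i : Fin l) (j : Fin m) (e : Fin a),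
    e.1 = i.1 + j.1 → ∀ (x : obj l) (y : obj m) (z : obj n),
      comp h₂ e (comp h₁ i x y) z = comp h₄ i x (comp h₃ j y z)
  comp_comm : ∀ {l m n a b c : ℕ} (h₁ : l + m = a + 1) (h₂ : a + n = c + 1)
    (h₃ : l + n = b + 1) (h₄ : b + m = c + 1) (i j : Fin l) (e : Fin a) (e' : Fin b),
    i < j → e.1 + 1 = j.1 + m → e'.1 = i.1 → ∀ (x : obj l) (y : obj m) (z : obj n),
      comp h₂ e (comp h₁ i x y) z = comp h₄ e' (comp h₃ j x z) y
  comp_act : ∀ {l m n : ℕ} (hn : l + m = n + 1) (i : Fin l)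
    (σ : Equiv.Perm (Fin l)) (τ : Equiv.Perm (Fin m)) (x : obj l) (y : obj m),
      comp hn i (act σ x) (act τ y) = act (blockPerm hn i σ τ) (comp hn (σ i) x y)

/-- The bilinear extension of a map `A × B → C` to free vector spaces. -/
noncomputable def bilinExt (k : Type u) [Field k] {A B C : Type} (c : A → B → C) :
    (A →₀ k) →ₗ[k] (B →₀ k) →ₗ[k] (C →₀ k) :=
  Finsupp.linearCombination k (fun a => Finsupp.lmapDomain k k (c a))

theorem bilinExt_single (k : Type u) [Field k] {A B C : Type} (c : A → B → C) (a : A) (b : B)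
    (x y : k) :
    bilinExt k c (Finsupp.single a x) (Finsupp.single b y) = Finsupp.single (c a b) (x * y) := by
  simp [bilinExt, Finsupp.linearCombination_single, Finsupp.mapDomain_single]

theorem bilinExt_assoc (k : Type u) [Field k] {A B C D E F : Type}
    (c₁ : A → B → D) (c₂ : D → C → E) (c₃ : B → C → F) (c₄ : A → F → E)
    (h : ∀ x y z, c₂ (c₁ x y) z = c₄ x (c₃ y z)) (x : A →₀ k) (y : B →₀ k) (z : C →₀ k) :
    bilinExt k c₂ (bilinExt k c₁ x y) z = bilinExt k c₄ x (bilinExt k c₃ y z) := by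
  induction x using Finsupp.induction_linear with
  | zero => simp
  | add f g hf hg => simp [hf, hg]
  | single a r =>
    induction y using Finsupp.induction_linear with
    | zero => simp
    | add f g hf hg => simp [hf, hg]
    | single b s =>
      induction z using Finsupp.induction_linear with
      | zero => simp
      | add f g hf hg => simp [hf, hg]
      | single e t => simp only [bilinExt_single, h, mul_assoc]

theorem bilinExt_comm (k : Type u) [Field k] {A B C D E F : Type}
    (c₁ : A → B → D) (c₂ : D → C → E) (c₃ : A → C → F) (c₄ : F → B → E)
    (h : ∀ x y z, c₂ (c₁ x y) z = c₄ (c₃ x z) y) (x : A →₀ k) (y : B →₀ k) (z : C →₀ k) :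
    bilinExt k c₂ (bilinExt k c₁ x y) z = bilinExt k c₄ (bilinExt k c₃ x z) y := by
  induction x using Finsupp.induction_linear with
  | zero => simp
  | add f g hf hg => simp [hf, hg]
  | single a r =>
    induction y using Finsupp.induction_linear with
    | zero => simp
    | add f g hf hg => simp [hf, hg]
    | single b s =>
      induction z using Finsupp.induction_linear with
      | zero => simp
      | add f g hf hg => simp [hf, hg]
      | single e t => simp only [bilinExt_single, h, mul_right_comm]

theorem bilinExt_act (k : Type u) [Field k] {A B C C' : Type}
    (c : A → B → C) (c' : A → B → C') (f : A → A) (g : B → B) (e : C' → C)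
    (h : ∀ x y, c (f x) (g y) = e (c' x y)) (x : A →₀ k) (y : B →₀ k) :
    bilinExt k c (Finsupp.mapDomain f x) (Finsupp.mapDomain g y)
      = Finsupp.mapDomain e (bilinExt k c' x y) := by
  induction x using Finsupp.induction_linear with
  | zero => simp
  | add f g hf hg => simp [Finsupp.mapDomain_add, hf, hg]
  | single a r =>
    induction y using Finsupp.induction_linear with
    | zero => simp
    | add f g hf hg =>
      rw [Finsupp.mapDomain_add, map_add, map_add, Finsupp.mapDomain_add, hf, hg]
    | single b s => simp only [bilinExt_single, h, Finsupp.mapDomain_single]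

/-- The dg operad spanned by an operad in sets, in degree `0`. -/
noncomputable def SetOperad.linearize (k : Type u) [Field k] (S : SetOperad) : DGOperad k where
  obj l p := (zeroWhen k (p ≠ 0) : Submodule k (S.obj l →₀ k))
  act {l p} σ := (Finsupp.lmapDomain k k (S.act σ)).restrict
    (p := zeroWhen k (p ≠ 0)) (q := zeroWhen k (p ≠ 0)) (fun x hx h => by rw [hx h, map_zero])
  act_one {l p} x := Subtype.ext (by
    have h : (S.act 1 : S.obj l → S.obj l) = id := funext S.act_one
    change Finsupp.mapDomain (S.act 1) x.1 = x.1
    rw [h, Finsupp.mapDomain_id])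
  act_mul {l p} σ τ x := Subtype.ext (by
    have h : (S.act (σ * τ) : S.obj l → S.obj l) = S.act τ ∘ S.act σ :=
      funext (S.act_mul σ τ)
    change Finsupp.mapDomain (S.act (σ * τ)) x.1
      = Finsupp.mapDomain (S.act τ) (Finsupp.mapDomain (S.act σ) x.1)
    rw [h, Finsupp.mapDomain_comp])
  ident := ⟨Finsupp.single S.ident 1, fun h => absurd rfl h⟩
  comp {l m n p q r} hn hr i :=
    restrictBilin (bilinExt k (S.comp hn i)) (zeroWhen k (p ≠ 0)) (zeroWhen k (q ≠ 0))
      (zeroWhen k (r ≠ 0)) (fun x hx y hy h => by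
        by_cases hp : p = 0
        · rw [hy (by omega), map_zero]
        · rw [hx hp, map_zero, LinearMap.zero_apply])
  ident_comp hn hr i y := Subtype.ext (by
    have h : S.comp hn i S.ident = id := funext (S.ident_comp hn i)
    change bilinExt k (S.comp hn i) (Finsupp.single S.ident 1) y.1 = y.1
    simp [bilinExt, h])
  comp_ident hn hr i x := Subtype.ext (by
    change bilinExt k (S.comp hn i) x.1 (Finsupp.single S.ident 1) = x.1
    generalize x.1 = f
    induction f using Finsupp.induction_linear with
    | zero => simp
    | add f g hf hg => simp [hf, hg]
    | single a r => simp [bilinExt_single, S.comp_ident])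
  comp_assoc h₁ g₁ h₂ g₂ h₃ g₃ h₄ g₄ i j e he x y z :=
    Subtype.ext (bilinExt_assoc k _ _ _ _ (S.comp_assoc h₁ h₂ h₃ h₄ i j e he) x.1 y.1 z.1)
  comp_comm {l m n a b c p q r s s' t} h₁ g₁ h₂ g₂ h₃ g₃ h₄ g₄ i j e e' hij he he' x y z := by
    have h := bilinExt_comm k _ _ _ _ (S.comp_comm h₁ h₂ h₃ h₄ i j e e' hij he he') x.1 y.1 z.1
    by_cases hq : q = 0
    · subst hq
      rw [zero_mul, Int.negOnePow_zero, one_smul]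
      exact Subtype.ext h
    · have hy : y = 0 := Subtype.ext (y.2 hq)
      subst hy
      simp only [map_zero, LinearMap.zero_apply, smul_zero]
  comp_act hn hr i σ τ x y :=
    Subtype.ext (bilinExt_act k _ _ _ _ _ (S.comp_act hn i σ τ) x.1 y.1)
  d _ _ := 0
  d_d _ := rfl
  d_act σ x := by simp
  d_comp hn hr i x y := by simp


/-- The operad in sets of total orders: its arity `l` part is the symmetric group `Σ_l`, for every
`l ≥ 0`. -/
noncomputable def assSet : SetOperad where
  obj l := Equiv.Perm (Fin l)
  act σ x := x * σ
  act_one x := mul_one x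
  act_mul σ τ x := (mul_assoc x σ τ).symm
  ident := 1
  comp hn i σ τ := blockPerm hn i σ τ
  ident_comp hn i y := by
    ext a
    have := blockPerm_val_inner hn i 1 y a a (by omega)
    simp only [Equiv.Perm.one_apply] at this
    omega
  comp_ident hn i x := by
    ext a
    by_cases h : a = i
    · subst h
      have := blockPerm_val_inner hn a x 1 a 0 (by simp)
      simpa using this
    · have := blockPerm_val_outer hn i x 1 a a h (by split_ifs <;> omega)
      rw [this]
      split_ifs <;> omega
  comp_assoc {l m n a b c} h₁ h₂ h₃ h₄ i j e he x y z := by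
    ext w
    have hB := blockPerm_val_inner h₁ i x y e j he
    rcases eq_outerPos_or_innerPos h₂ e w with ⟨⟨v, hv⟩, rfl⟩ | ⟨t, rfl⟩
    · have hve : v.1 ≠ e.1 := fun h => hv (Fin.ext h)
      rw [blockPerm_val_outer h₂ e _ z _ v hv rfl]
      rcases eq_outerPos_or_innerPos h₁ i v with ⟨⟨s, hs⟩, rfl⟩ | ⟨t, rfl⟩
      · have hsi : s.1 ≠ i.1 := fun h => hs (Fin.ext h)
        have hxs : (x s).1 ≠ (x i).1 := fun h => hs (x.injective (Fin.ext h))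
        have := j.2
        have := (y j).2
        rw [blockPerm_val_outer h₁ i x y _ s hs rfl, hB]
        rw [blockPerm_val_outer h₄ i x _ _ s hs
          (by simp only [outerPos]; split_ifs <;> omega)]
        split_ifs <;> omega
      · have htj : t.1 ≠ j.1 := fun h => hve (by simp only [innerPos]; omega)
        have htj' : t ≠ j := fun h => htj (congrArg Fin.val h)
        have hyt : (y t).1 ≠ (y j).1 := fun h => htj' (y.injective (Fin.ext h))
        rw [blockPerm_val_inner h₁ i x y _ t rfl, hB]
        have hw : (outerPos h₂ e ⟨innerPos h₁ i t, hv⟩).1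
            = i.1 + (outerPos h₃ j ⟨t, htj'⟩).1 := by
          simp only [outerPos, innerPos, he, add_lt_add_iff_left]
          by_cases htl : t.1 < j.1
          · rw [if_pos htl, if_pos htl]
          · rw [if_neg htl, if_neg htl]
            omega
        rw [blockPerm_val_inner h₄ i x _ _ (outerPos h₃ j ⟨t, htj'⟩) hw]
        rw [blockPerm_val_outer h₃ j y z _ t htj' rfl]
        split_ifs <;> omega
    · rw [blockPerm_val_inner h₂ e _ z _ t rfl, hB]
      rw [blockPerm_val_inner h₄ i x _ _ (innerPos h₃ j t) (by simp only [innerPos]; omega)]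
      rw [blockPerm_val_inner h₃ j y z _ t rfl]
      omega
  comp_comm {l m n a b c} h₁ h₂ h₃ h₄ i j e e' hij he he' x y z := by
    ext w
    have hij' : i.1 < j.1 := hij
    have hne : j ≠ i := fun h => by rw [h] at hij'; omega
    have hxij : (x j).1 ≠ (x i).1 := fun h => hne (x.injective (Fin.ext h))
    have hB := blockPerm_val_outer h₁ i x y e j hne (by split_ifs <;> omega)
    have hB' := blockPerm_val_outer h₃ j x z e' i hne.symm (by split_ifs; omega)
    rcases eq_outerPos_or_innerPos h₂ e w with ⟨⟨v, hv⟩, rfl⟩ | ⟨t, rfl⟩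
    · have hve : v.1 ≠ e.1 := fun h => hv (Fin.ext h)
      rw [blockPerm_val_outer h₂ e _ z _ v hv rfl]
      rcases eq_outerPos_or_innerPos h₁ i v with ⟨⟨s, hs⟩, rfl⟩ | ⟨t, rfl⟩
      · have hsi : s.1 ≠ i.1 := fun h => hs (Fin.ext h)
        have hxs : (x s).1 ≠ (x i).1 := fun h => hs (x.injective (Fin.ext h))
        have hsj : s.1 ≠ j.1 := fun h => hve (by
          simp only [outerPos]
          split_ifs <;> omega)
        have hsj' : s ≠ j := fun h => hsj (congrArg Fin.val h)
        have hxsj : (x s).1 ≠ (x j).1 := fun h => hsj' (x.injective (Fin.ext h))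
        rw [blockPerm_val_outer h₁ i x y _ s hs rfl, hB]
        rw [blockPerm_val_outer h₄ e' _ y _ (outerPos h₃ j ⟨s, hsj'⟩)
          (fun h => by
            have := congrArg Fin.val h
            simp only [outerPos] at this
            split_ifs at this <;> omega)
          (by simp only [outerPos]; split_ifs <;> omega)]
        rw [blockPerm_val_outer h₃ j x z _ s hsj' rfl, hB']
        split_ifs <;> omega
      · have := t.2
        have := (y t).2
        rw [blockPerm_val_inner h₁ i x y _ t rfl, hB]
        have hw : (outerPos h₂ e ⟨innerPos h₁ i t, hv⟩).1 = e'.1 + t.1 := by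
          have hv1 : (innerPos h₁ i t).1 = i.1 + t.1 := rfl
          exact (if_pos (show (innerPos h₁ i t).1 < e.1 by omega)).trans (by simp only [hv1, he'])
        rw [blockPerm_val_inner h₄ e' _ y _ t hw, hB']
        split_ifs <;> omega
    · have := t.2
      have := (z t).2
      rw [blockPerm_val_inner h₂ e _ z _ t rfl, hB]
      rw [blockPerm_val_outer h₄ e' _ y _ (innerPos h₃ j t)
        (fun h => by
            have := congrArg Fin.val h
            simp only [innerPos] at this
            omega)
        (by
          have hv1 : (innerPos h₃ j t).1 = j.1 + t.1 := rfl
          have hv2 : (innerPos h₂ e t).1 = e.1 + t.1 := rfl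
          rw [if_neg (by omega), hv1, hv2]
          omega)]
      rw [blockPerm_val_inner h₃ j x z _ t rfl, hB']
      split_ifs <;> omega
  comp_act hn i σ τ x y := by
    refine Equiv.ext fun a => ?_
    rw [Equiv.Perm.mul_apply]
    rcases eq_outerPos_or_innerPos hn i a with ⟨j, rfl⟩ | ⟨t, rfl⟩
    · simp only [blockPerm_outerPos]
      rfl
    · simp only [blockPerm_innerPos]
      rfl

/-- The unitary associative operad `Ass₊`, with `Ass₊(l) = k[Σ_l]` for all `l ≥ 0`. -/
noncomputable def AssPlus (k : Type u) [Field k] : DGOperad k :=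
  assSet.linearize k

/-- The operad in sets with one point in the arities `0` and `1` and no points in the others. -/
def initSet : SetOperad where
  obj l := PLift (l ≤ 1)
  act _ x := x
  act_one _ := rfl
  act_mul _ _ _ := rfl
  ident := ⟨le_refl 1⟩
  comp hn _ x y := ⟨by have := x.down; have := y.down; omega⟩
  ident_comp _ _ _ := rfl
  comp_ident _ _ _ := rfl
  comp_assoc _ _ _ _ _ _ _ _ _ _ _ := rfl
  comp_comm _ _ _ _ _ _ _ _ _ _ _ _ _ _ := rfl
  comp_act _ _ _ _ _ _ := rfl

/-- The initial unitary operad `I₊`, with `I₊(0) = I₊(1) = k` and `I₊(l) = 0` for `l ≥ 2`. -/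
noncomputable def InitPlus (k : Type u) [Field k] : DGOperad k :=
  initSet.linearize k

/-- The unit `1 ∈ Ass₊(0)`. -/
noncomputable def AssPlus.unit (k : Type u) [Field k] : (AssPlus k).obj 0 0 :=
  ⟨Finsupp.single (1 : Equiv.Perm (Fin 0)) 1, fun h => absurd rfl h⟩

/-- The unit `1 ∈ I₊(0)`. -/
noncomputable def InitPlus.unit (k : Type u) [Field k] : (InitPlus k).obj 0 0 :=
  ⟨Finsupp.single (⟨zero_le_one⟩ : PLift (0 ≤ 1)) 1, fun h => absurd rfl h⟩

/-! ## Unitary principal extensions and Sullivan minimal operads -/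

namespace DGOperad

variable {k : Type u} [Field k]

/-- `P` is unitary with unit `u`: `P(0) = k · u ≅ k`, concentrated in degree `0`. -/
def IsUnitary (P : DGOperad k) (u : P.obj 0 0) : Prop :=
  Function.Bijective (fun c : k => c • u) ∧ ∀ p : ℤ, p ≠ 0 → Subsingleton (P.obj 0 p)

/-- The truncation of `P` as a graded operad, forgetting the differential. -/
def gradedTrunc (P : DGOperad k) : GradedOperad k :=
  P.toGradedOperad.trunc

/-- The restriction operation `δ_i : P(n) ⟶ P(n - 1)`, `δ_i(x) = x ∘_i 1`, of an operad `P` with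
a unit `u = 1 ∈ P(0)`. -/
def restriction (P : DGOperad k) (u : P.obj 0 0) {n m : ℕ} (h : n = m + 1) (i : Fin n) (p : ℤ) :
    P.obj n p →ₗ[k] P.obj m p :=
  (P.comp (by omega : n + 0 = m + 1) (add_zero p) i).flip u

/-- The structure of a unitary principal extension of arity `n = m + 1 ≥ 2` on a morphism
`ι : P ⟶ Q` of dg operads, where `P` is unitary with unit `u`. It exhibits `Q` as
`P ⊔ Γ(E) = Γ₊₁(M ⊕ E)` for `P = Γ₊₁(M)`. Here a unitary operad is of the form `Γ₊₁(M)`, as a graded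
operad, if it is the unitary extension `Γ(M)₊` of the free operad `Γ(M)`, that is, if its truncation
is `Γ(M)`. The restriction operations of `Q` on the generators `E` are the maps `δ`; that these are
compatible with the restriction operations of `P` and with the symmetric group actions is part of
the fact that `Q` is an operad which contains `P`. -/
structure UnitaryPrincipalExtension {P Q : DGOperad k} (ι : P ⟶ Q) (u : P.obj 0 0) (m : ℕ) where
  one_le : 1 ≤ m
  isUnitary_source : P.IsUnitary u
  isUnitary_target : Q.IsUnitary (ι.map 0 0 u)
  /-- The generators of `P`. -/
  M : SigmaModule k
  M_trivial : ∀ l : ℕ, l ≤ 1 → ∀ p : ℤ, Subsingleton (M.obj l p)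
  inclM : SigmaModule.Hom M P.gradedTrunc.toSigmaModule
  free_source : GradedOperad.IsFree M P.gradedTrunc inclM
  /-- The new generators, which are homogeneous of arity `m + 1`. -/
  E : SigmaModule k
  E_homogeneous : ∀ l : ℕ, l ≠ m + 1 → ∀ p : ℤ, Subsingleton (E.obj l p)
  /-- The inclusion of the generators `M ⊕ E` in `Q`. -/
  incl : SigmaModule.Hom (M.sum E) Q.gradedTrunc.toSigmaModule
  free_target : GradedOperad.IsFree (M.sum E) Q.gradedTrunc incl
  incl_M : ∀ (l : ℕ) (p : ℤ) (x : M.obj l p),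
    (incl.map l p (x, 0)).1 = ι.map l p (inclM.map l p x).1
  /-- The differential on the new generators, `d : E ⟶ ZP(m + 1)⁺¹`. -/
  dE : ∀ p : ℤ, E.obj (m + 1) p →ₗ[k] P.obj (m + 1) (p + 1)
  dE_act : ∀ (p : ℤ) (σ : Equiv.Perm (Fin (m + 1))) (e : E.obj (m + 1) p),
    dE p (E.act σ e) = P.act σ (dE p e)
  dE_cocycle : ∀ (p : ℤ) (e : E.obj (m + 1) p), P.d (m + 1) (p + 1) (dE p e) = 0
  d_incl : ∀ (p : ℤ) (e : E.obj (m + 1) p),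
    Q.d (m + 1) p (incl.map (m + 1) p (0, e)).1 = ι.map (m + 1) (p + 1) (dE p e)
  /-- The restriction operations on the new generators, `δ_i : E ⟶ P(m)`. -/
  δ : Fin (m + 1) → ∀ p : ℤ, E.obj (m + 1) p →ₗ[k] P.obj m p
  δ_dE : ∀ (i : Fin (m + 1)) (p : ℤ) (e : E.obj (m + 1) p),
    P.d m p (δ i p e) = P.restriction u rfl i (p + 1) (dE p e)
  restriction_incl : ∀ (i : Fin (m + 1)) (p : ℤ) (e : E.obj (m + 1) p),
    Q.restriction (ι.map 0 0 u) rfl i p (incl.map (m + 1) p (0, e)).1 = ι.map m p (δ i p e)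

/-- The structure of a unitary Sullivan minimal operad on a dg operad `S`: it is the colimit of a
sequence `I₊ = P₁ ⟶ P₂ ⟶ P₃ ⟶ ⋯` in which `Pₙ₋₁ ⟶ Pₙ` is a unitary principal extension of
arity `n`. The operad `Pₙ` is `stage (n - 1)`. -/
structure UnitarySullivanMinimal (S : DGOperad k) where
  stage : ℕ → DGOperad k
  step : ∀ j : ℕ, stage j ⟶ stage (j + 1)
  initial : InitPlus k ≅ stage 0
  /-- The units of the stages, images of the unit of `I₊`. -/
  unit : ∀ j : ℕ, (stage j).obj 0 0
  unit_zero : unit 0 = initial.hom.map 0 0 (InitPlus.unit k)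
  unit_succ : ∀ j : ℕ, unit (j + 1) = (step j).map 0 0 (unit j)
  extension : ∀ j : ℕ, UnitaryPrincipalExtension (step j) (unit j) (j + 1)
  toColimit : Functor.ofSequence step ⟶ (Functor.const ℕ).obj S
  isColimit : IsColimit (Cocone.mk S toColimit)

/-- The canonical morphism from a stage to the colimit. -/
def UnitarySullivanMinimal.ofStage {S : DGOperad k} (T : UnitarySullivanMinimal S) (j : ℕ) :
    T.stage j ⟶ S :=
  T.toColimit.app j

/-- The unit `1 ∈ S(0)` of a unitary Sullivan minimal operad, the image of the unit of `I₊`. -/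
def UnitarySullivanMinimal.one {S : DGOperad k} (T : UnitarySullivanMinimal S) : S.obj 0 0 :=
  (T.ofStage 0).map 0 0 (T.unit 0)

end DGOperad

/-!
The minimal model is built one arity at a time, starting with `I₊ ⟶ P`, the unit going to
`v = φ(1)`. The class of `v` in `HP(0)` and that of the identity in `HP(1)` are nonzero: if the
identity were a boundary, then so would be every cocycle of `P(0)`, and if `v` were a boundary,
then so would be `μ ∘ v = id`, where `μ` is the image of the product of `Ass₊`. Hence `I₊ ⟶ P` is a
quasi-isomorphism in the arities `0` and `1`.

*The extension of an approximation.* Let `ρ : Q ⟶ P` be a quasi-isomorphism up to arity `n - 1`,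
with `Q = Γ₊₁(M)`. The new generators have to kill the cohomology of the mapping cone of `ρ` in
arity `n`. A generator with differential `q`, image `z` in `P` and restrictions `y_i` is a triple
`(q, z, y)` with `d q = 0`, `ρ q = d z`, `d y_i = δ_i q`, `ρ y_i = δ_i z` and compatible double
restrictions (`DGOperad.cellCocycles`). The triples whose class in the cone is trivial are a
`Σ_n`-stable subspace, and since `k` has characteristic zero it has an equivariant complement,
which is taken as the space `E` of generators (`DGOperad.cells`). The extension is then a
quasi-isomorphism in arity `n` (`DGOperad.isQuisAt_cellExtension`), provided that each cocycle
`(q, z)` of the cone is, up to a boundary, part of such a triple (`DGOperad.ConeLifting`).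

*The role of the multiplication.* That proviso is where the unitary multiplication is used. If `Q`
has a multiplication `μ` whose two restrictions are the identity, then the insertions `x ↦ x ∘_i μ`
are sections of the restriction operations, like the degeneracies of a simplicial vector space. The
restrictions of a cone cocycle are cone cocycles of arity `n - 1`, hence boundaries, and with the
insertions the cocycle can be corrected by a boundary so that all its restrictions vanish; then
`y = 0` will do (`DGOperad.coneLifting_of_multiplication`). For `n ≥ 3` the multiplication of `P`
lifts to such a `μ` in `Q`, because `Q(1)` is spanned by the identity
(`DGOperad.exists_multiplication`). For `n = 2` one has `Q(2) = 0`, and the restrictions of a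
cocycle of `P(2)` can be made equal multiples `c` of the identity, by the correction applied to
`z - c μ` (`DGOperad.coneLifting_two`).

*The extension as a dg operad.* The unital operad `Γ₊₁(M ⊕ E)` is the free operad `F` on `M ⊕ E`
with a unit adjoined in arity `0`. Its restriction operations come from a morphism from `F` to an
operad of elements of `F` with formal restrictions (`GradedOperad.restrOperad`), which is
determined by its values on the generators; likewise its differential comes from a morphism to
`F ⊗ k[ε]` (`GradedOperad.diffOperad`). The relations between these operations, and their
compatibility with morphisms, are proved by induction on generators
(`GradedOperad.IsFree.induction`).

*The colimit.* A principal extension is injective and does not change the parts of smaller arity,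
so in each arity the sequence of extensions is stationary, and the colimit of the approximations is
quasi-isomorphic to `P` and agrees with `I₊` in the arities `0` and `1`.
-/

/-! ### Free graded operads -/

/-- Formal operadic expressions in the elements of a graded `Σ`-module `M`. -/
inductive OperadTerm {k : Type u} [Field k] (M : SigmaModule k) : ℕ → ℤ → Type u
  | gen {l : ℕ} {p : ℤ} (x : M.obj l p) : OperadTerm M l p
  | ident : OperadTerm M 1 0
  | zero {l : ℕ} {p : ℤ} : OperadTerm M l p
  | add {l : ℕ} {p : ℤ} (s t : OperadTerm M l p) : OperadTerm M l p
  | smul {l : ℕ} {p : ℤ} (c : k) (t : OperadTerm M l p) : OperadTerm M l p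
  | act {l : ℕ} {p : ℤ} (σ : Equiv.Perm (Fin l)) (t : OperadTerm M l p) : OperadTerm M l p
  | comp {l m n : ℕ} {p q r : ℤ} (hn : l + m = n + 1) (hr : p + q = r) (i : Fin l)
      (s : OperadTerm M l p) (t : OperadTerm M m q) : OperadTerm M n r

namespace OperadTerm

variable {k : Type u} [Field k] {M : SigmaModule k}

/-- The value of a formal expression in a graded operad `R`, given a map of `M` to `R`. -/
def eval (R : GradedOperad k) (f : SigmaModule.Hom M R.toSigmaModule) :
    ∀ {l : ℕ} {p : ℤ}, OperadTerm M l p → R.obj l p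
  | _, _, gen x => f.map _ _ x
  | _, _, ident => R.ident
  | _, _, zero => 0
  | _, _, add s t => eval R f s + eval R f t
  | _, _, smul c t => c • eval R f t
  | _, _, act σ t => R.act σ (eval R f t)
  | _, _, comp hn hr i s t => R.comp hn hr i (eval R f s) (eval R f t)

/-- Two formal expressions are identified when they have the same value in every graded operad.
Every identity that holds in all graded operads then holds for the classes of expressions. -/
instance setoid (M : SigmaModule k) (l : ℕ) (p : ℤ) : Setoid (OperadTerm M l p) where
  r s t := ∀ (R : GradedOperad k) (f : SigmaModule.Hom M R.toSigmaModule), eval R f s = eval R f t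
  iseqv := ⟨fun _ _ _ => rfl, fun h R f => (h R f).symm, fun h h' R f => (h R f).trans (h' R f)⟩

/-- The classes of formal expressions. -/
def TermClass (M : SigmaModule k) (l : ℕ) (p : ℤ) : Type u := _root_.Quotient (setoid M l p)

/-- The value of a class of expressions. -/
def TermClass.eval (R : GradedOperad k) (f : SigmaModule.Hom M R.toSigmaModule) {l : ℕ} {p : ℤ} :
    TermClass M l p → R.obj l p :=
  _root_.Quotient.lift (OperadTerm.eval R f) (fun _ _ h => h R f)

theorem TermClass.ext {l : ℕ} {p : ℤ} {x y : TermClass M l p}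
    (h : ∀ (R : GradedOperad k) (f : SigmaModule.Hom M R.toSigmaModule), x.eval R f = y.eval R f) :
    x = y := by
  induction x using _root_.Quotient.inductionOn
  induction y using _root_.Quotient.inductionOn
  exact _root_.Quotient.sound h

instance (l : ℕ) (p : ℤ) : Zero (TermClass M l p) := ⟨_root_.Quotient.mk _ zero⟩

instance (l : ℕ) (p : ℤ) : Add (TermClass M l p) :=
  ⟨_root_.Quotient.map₂ add (fun _ _ h _ _ h' R f => by simp only [OperadTerm.eval, h R f, h' R f])⟩

instance (l : ℕ) (p : ℤ) : SMul k (TermClass M l p) :=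
  ⟨fun c => _root_.Quotient.map (smul c) (fun _ _ h R f => by simp only [OperadTerm.eval, h R f])⟩

instance (l : ℕ) (p : ℤ) : Neg (TermClass M l p) := ⟨fun x => (-1 : k) • x⟩

section eval

variable (R : GradedOperad k) (f : SigmaModule.Hom M R.toSigmaModule) {l : ℕ} {p : ℤ}

theorem TermClass.eval_zero : (0 : TermClass M l p).eval R f = 0 := rfl

theorem TermClass.eval_add (x y : TermClass M l p) :
    (x + y).eval R f = x.eval R f + y.eval R f := by
  induction x using _root_.Quotient.inductionOn
  induction y using _root_.Quotient.inductionOn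
  rfl

theorem TermClass.eval_smul (c : k) (x : TermClass M l p) : (c • x).eval R f = c • x.eval R f := by
  induction x using _root_.Quotient.inductionOn
  rfl

theorem TermClass.eval_neg (x : TermClass M l p) : (-x).eval R f = -x.eval R f := by
  change ((-1 : k) • x).eval R f = _
  rw [TermClass.eval_smul, neg_smul, one_smul]

end eval

instance (l : ℕ) (p : ℤ) : AddCommGroup (TermClass M l p) where
  add_assoc x y z := TermClass.ext fun R f => by simp only [TermClass.eval_add, add_assoc]
  zero_add x := TermClass.ext fun R f => by
    simp only [TermClass.eval_add, TermClass.eval_zero, zero_add]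
  add_zero x := TermClass.ext fun R f => by
    simp only [TermClass.eval_add, TermClass.eval_zero, add_zero]
  add_comm x y := TermClass.ext fun R f => by simp only [TermClass.eval_add, add_comm]
  neg_add_cancel x := TermClass.ext fun R f => by
    simp only [TermClass.eval_add, TermClass.eval_zero, TermClass.eval_neg, neg_add_cancel]
  nsmul := nsmulRec
  zsmul := zsmulRec

instance (l : ℕ) (p : ℤ) : Module k (TermClass M l p) where
  one_smul x := TermClass.ext fun R f => by simp only [TermClass.eval_smul, one_smul]
  mul_smul a b x := TermClass.ext fun R f => by simp only [TermClass.eval_smul, mul_smul]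
  smul_zero a := TermClass.ext fun R f => by
    simp only [TermClass.eval_smul, TermClass.eval_zero, smul_zero]
  zero_smul x := TermClass.ext fun R f => by
    simp only [TermClass.eval_smul, TermClass.eval_zero, zero_smul]
  smul_add a x y := TermClass.ext fun R f => by
    simp only [TermClass.eval_smul, TermClass.eval_add, smul_add]
  add_smul a b x := TermClass.ext fun R f => by
    simp only [TermClass.eval_smul, TermClass.eval_add, add_smul]

/-- The value of a class of expressions, as a linear map. -/
def evalₗ (R : GradedOperad k) (f : SigmaModule.Hom M R.toSigmaModule) (l : ℕ) (p : ℤ) :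
    TermClass M l p →ₗ[k] R.obj l p where
  toFun := TermClass.eval R f
  map_add' := TermClass.eval_add R f
  map_smul' := TermClass.eval_smul R f

/-- The symmetric group action on classes of expressions. -/
def TermClass.act {l : ℕ} {p : ℤ} (σ : Equiv.Perm (Fin l)) : TermClass M l p → TermClass M l p :=
  _root_.Quotient.map (OperadTerm.act σ) (fun _ _ h R f => by simp only [OperadTerm.eval, h R f])

/-- The partial composite of classes of expressions. -/
def TermClass.comp {l m n : ℕ} {p q r : ℤ} (hn : l + m = n + 1) (hr : p + q = r) (i : Fin l) :
    TermClass M l p → TermClass M m q → TermClass M n r :=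
  _root_.Quotient.map₂ (OperadTerm.comp hn hr i)
    (fun _ _ h _ _ h' R f => by simp only [OperadTerm.eval, h R f, h' R f])

theorem TermClass.eval_act (R : GradedOperad k) (f : SigmaModule.Hom M R.toSigmaModule)
    {l : ℕ} {p : ℤ} (σ : Equiv.Perm (Fin l)) (x : TermClass M l p) :
    (x.act σ).eval R f = R.act σ (x.eval R f) := by
  induction x using _root_.Quotient.inductionOn
  rfl

theorem TermClass.eval_comp (R : GradedOperad k) (f : SigmaModule.Hom M R.toSigmaModule)
    {l m n : ℕ} {p q r : ℤ} (hn : l + m = n + 1) (hr : p + q = r) (i : Fin l)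
    (x : TermClass M l p) (y : TermClass M m q) :
    (x.comp hn hr i y).eval R f = R.comp hn hr i (x.eval R f) (y.eval R f) := by
  induction x using _root_.Quotient.inductionOn
  induction y using _root_.Quotient.inductionOn
  rfl

end OperadTerm

namespace GradedOperad

variable {k : Type u} [Field k]

open OperadTerm

/-- The free graded operad on a graded `Σ`-module. -/
def free (M : SigmaModule k) : GradedOperad k where
  obj := TermClass M
  act σ :=
    { toFun := TermClass.act σ
      map_add' := fun x y => TermClass.ext fun R f => by
        simp only [TermClass.eval_add, TermClass.eval_act, map_add]
      map_smul' := fun c x => TermClass.ext fun R f => by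
        simp only [TermClass.eval_smul, TermClass.eval_act, map_smul, RingHom.id_apply] }
  act_one x := TermClass.ext fun R f => by
    exact (TermClass.eval_act R f 1 x).trans (R.act_one _)
  act_mul σ τ x := TermClass.ext fun R f => by
    refine (TermClass.eval_act R f _ x).trans ((R.act_mul σ τ _).trans ?_)
    rw [← TermClass.eval_act, ← TermClass.eval_act]
    rfl
  ident := _root_.Quotient.mk _ OperadTerm.ident
  comp hn hr i := LinearMap.mk₂ k (TermClass.comp hn hr i)
    (fun _ _ _ => TermClass.ext fun R f => by
      simp only [TermClass.eval_add, TermClass.eval_comp, map_add, LinearMap.add_apply])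
    (fun _ _ _ => TermClass.ext fun R f => by
      simp only [TermClass.eval_smul, TermClass.eval_comp, map_smul, LinearMap.smul_apply])
    (fun _ _ _ => TermClass.ext fun R f => by
      simp only [TermClass.eval_add, TermClass.eval_comp, map_add])
    (fun _ _ _ => TermClass.ext fun R f => by
      simp only [TermClass.eval_smul, TermClass.eval_comp, map_smul])
  ident_comp hn hr i y := TermClass.ext fun R f => by
    exact (TermClass.eval_comp R f hn hr i (_root_.Quotient.mk _ OperadTerm.ident) y).trans
      (R.ident_comp hn hr i _)
  comp_ident hn hr i x := TermClass.ext fun R f => by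
    exact (TermClass.eval_comp R f hn hr i x _).trans (R.comp_ident hn hr i _)
  comp_assoc h₁ g₁ h₂ g₂ h₃ g₃ h₄ g₄ i j e he x y z := TermClass.ext fun R f => by
    simp only [LinearMap.mk₂_apply, TermClass.eval_comp]
    exact R.comp_assoc h₁ g₁ h₂ g₂ h₃ g₃ h₄ g₄ i j e he _ _ _
  comp_comm h₁ g₁ h₂ g₂ h₃ g₃ h₄ g₄ i j e e' hij he he' x y z := TermClass.ext fun R f => by
    have hs (t : ℤˣ) {l : ℕ} {p : ℤ} (w : TermClass M l p) : (t • w).eval R f = t • w.eval R f :=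
      map_zsmul_unit (evalₗ R f l p) t w
    simp only [LinearMap.mk₂_apply, TermClass.eval_comp, hs]
    exact R.comp_comm h₁ g₁ h₂ g₂ h₃ g₃ h₄ g₄ i j e e' hij he he' _ _ _
  comp_act hn hr i σ τ x y := TermClass.ext fun R f => by
    simp only [LinearMap.mk₂_apply, LinearMap.coe_mk, AddHom.coe_mk, TermClass.eval_comp,
      TermClass.eval_act]
    exact R.comp_act hn hr i σ τ _ _

/-- The inclusion of the generators in the free operad. -/
def freeGen (M : SigmaModule k) : SigmaModule.Hom M (free M).toSigmaModule where
  map l p :=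
    { toFun := fun x => _root_.Quotient.mk _ (OperadTerm.gen x)
      map_add' := fun x y => _root_.Quotient.sound fun _ f => map_add (f.map l p) x y
      map_smul' := fun c x => _root_.Quotient.sound fun _ f => map_smul (f.map l p) c x }
  map_act σ x := _root_.Quotient.sound fun _ f => f.map_act σ x

theorem isFree_free (M : SigmaModule k) : IsFree M (free M) (freeGen M) := by
  intro R f
  refine ⟨{ map := evalₗ R f
            map_act := fun σ x => TermClass.eval_act R f σ x
            map_ident := rfl
            map_comp := fun hn hr i x y => TermClass.eval_comp R f hn hr i x y },
    fun l p x => rfl, fun ψ hψ => ?_⟩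
  ext l p x
  induction x using _root_.Quotient.inductionOn with
  | h t =>
    change ψ.map l p (_root_.Quotient.mk _ t) = t.eval R f
    induction t with
    | gen x => exact hψ _ _ x
    | ident => exact ψ.map_ident
    | zero => exact map_zero (ψ.map _ _)
    | add s t hs ht => exact (map_add (ψ.map _ _) _ _).trans (congrArg₂ _ hs ht)
    | smul c t ht => exact (map_smul (ψ.map _ _) _ _).trans (congrArg _ ht)
    | act σ t ht => exact (ψ.map_act _ _).trans (congrArg _ ht)
    | comp hn hr i s t hs ht =>
      exact (ψ.map_comp hn hr i _ _).trans (congrArg₂ (fun a b => R.comp hn hr i a b) hs ht)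

/-! ### Morphisms of graded operads and induction on generators -/

/-- The identity morphism of a graded operad. -/
def Hom.id (P : GradedOperad k) : Hom P P where
  map _ _ := LinearMap.id
  map_act _ _ := rfl
  map_ident := rfl
  map_comp _ _ _ _ _ := rfl

/-- The composite of morphisms of graded operads. -/
def Hom.comp {P Q R : GradedOperad k} (g : Hom Q R) (f : Hom P Q) : Hom P R where
  map l p := (g.map l p).comp (f.map l p)
  map_act σ x := by simp [f.map_act, g.map_act]
  map_ident := by simp [f.map_ident, g.map_ident]
  map_comp hn hr i x y := by simp [f.map_comp, g.map_comp]

theorem IsFree.hom_ext {M : SigmaModule k} {G : GradedOperad k}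
    {i : SigmaModule.Hom M G.toSigmaModule} (h : IsFree M G i) {R : GradedOperad k} {f g : Hom G R}
    (hfg : ∀ (l : ℕ) (p : ℤ) (x : M.obj l p), f.map l p (i.map l p x) = g.map l p (i.map l p x)) :
    f = g := by
  obtain ⟨ψ, -, h2⟩ := h R
    { map := fun l p => (g.map l p).comp (i.map l p)
      map_act := fun σ x => by simp [i.map_act, g.map_act] }
  rw [h2 f hfg, h2 g (fun _ _ _ => rfl)]

/-- The morphism out of a free operad determined by its values on the generators. -/
noncomputable def IsFree.lift {M : SigmaModule k} {G : GradedOperad k}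
    {i : SigmaModule.Hom M G.toSigmaModule} (h : IsFree M G i) {R : GradedOperad k}
    (f : SigmaModule.Hom M R.toSigmaModule) : Hom G R :=
  (h R f).choose

theorem IsFree.lift_gen {M : SigmaModule k} {G : GradedOperad k}
    {i : SigmaModule.Hom M G.toSigmaModule} (h : IsFree M G i) {R : GradedOperad k}
    (f : SigmaModule.Hom M R.toSigmaModule) {l : ℕ} {p : ℤ} (x : M.obj l p) :
    (h.lift f).map l p (i.map l p x) = f.map l p x :=
  (h R f).choose_spec.1 l p x

/-- The suboperad of `G` with the given parts. -/
def sub (G : GradedOperad k) (S : ∀ l p, Submodule k (G.obj l p)) (h1 : G.ident ∈ S 1 0)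
    (hact : ∀ {l p} (σ : Equiv.Perm (Fin l)) (x : G.obj l p), x ∈ S l p → G.act σ x ∈ S l p)
    (hcomp : ∀ {l m n : ℕ} {p q r : ℤ} (hn : l + m = n + 1) (hr : p + q = r) (i : Fin l)
      (x : G.obj l p) (y : G.obj m q), x ∈ S l p → y ∈ S m q → G.comp hn hr i x y ∈ S n r) :
    GradedOperad k where
  obj l p := S l p
  act σ := (G.act σ).restrict (fun x hx => hact σ x hx)
  act_one x := Subtype.ext (G.act_one x.1)
  act_mul σ τ x := Subtype.ext (G.act_mul σ τ x.1)
  ident := ⟨G.ident, h1⟩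
  comp hn hr i := restrictBilin (G.comp hn hr i) _ _ _
    (fun x hx y hy => hcomp hn hr i x y hx hy)
  ident_comp hn hr i y := Subtype.ext (G.ident_comp hn hr i y.1)
  comp_ident hn hr i x := Subtype.ext (G.comp_ident hn hr i x.1)
  comp_assoc h₁ g₁ h₂ g₂ h₃ g₃ h₄ g₄ i j e he x y z :=
    Subtype.ext (G.comp_assoc h₁ g₁ h₂ g₂ h₃ g₃ h₄ g₄ i j e he x.1 y.1 z.1)
  comp_comm h₁ g₁ h₂ g₂ h₃ g₃ h₄ g₄ i j e e' hij he he' x y z :=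
    Subtype.ext (G.comp_comm h₁ g₁ h₂ g₂ h₃ g₃ h₄ g₄ i j e e' hij he he' x.1 y.1 z.1)
  comp_act hn hr i σ τ x y := Subtype.ext (G.comp_act hn hr i σ τ x.1 y.1)

/-- A free operad is the only suboperad of itself that contains the generators. -/
theorem IsFree.induction {M : SigmaModule k} {G : GradedOperad k}
    {i : SigmaModule.Hom M G.toSigmaModule} (h : IsFree M G i)
    (S : ∀ l p, Submodule k (G.obj l p))
    (hgen : ∀ l p (x : M.obj l p), i.map l p x ∈ S l p) (h1 : G.ident ∈ S 1 0)
    (hact : ∀ {l p} (σ : Equiv.Perm (Fin l)) (x : G.obj l p), x ∈ S l p → G.act σ x ∈ S l p)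
    (hcomp : ∀ {l m n : ℕ} {p q r : ℤ} (hn : l + m = n + 1) (hr : p + q = r) (i : Fin l)
      (x : G.obj l p) (y : G.obj m q), x ∈ S l p → y ∈ S m q → G.comp hn hr i x y ∈ S n r)
    {l : ℕ} {p : ℤ} (x : G.obj l p) : x ∈ S l p := by
  let j : SigmaModule.Hom M (G.sub S h1 hact hcomp).toSigmaModule :=
    { map := fun l p => (i.map l p).codRestrict (S l p) (hgen l p)
      map_act := fun σ x => Subtype.ext (i.map_act σ x) }
  let ψ : Hom G (G.sub S h1 hact hcomp) := h.lift j
  let ι : Hom (G.sub S h1 hact hcomp) G :=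
    { map := fun l p => (S l p).subtype
      map_act := fun _ _ => rfl
      map_ident := rfl
      map_comp := fun _ _ _ _ _ => rfl }
  have e : ι.comp ψ = Hom.id G := h.hom_ext fun l p x =>
    congrArg (ι.map l p) (h.lift_gen j x)
  have e' : (ψ.map l p x).1 = x := congrArg (fun f : Hom G G => f.map l p x) e
  rw [← e']
  exact (ψ.map l p x).2

end GradedOperad

/-! ### Adjoining a unit in arity zero -/

namespace SigmaModule

variable {k : Type u} [Field k]

/-- The identification of `M(l)ᵖ` with `M(l')^p'` if `l = l'` and `p = p'`, and the zero map
otherwise. -/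
def tr (M : SigmaModule k) {l l' : ℕ} {p p' : ℤ} : M.obj l p →ₗ[k] M.obj l' p' :=
  if h : l = l' ∧ p = p' then
    (by obtain ⟨rfl, rfl⟩ := h; exact LinearMap.id)
  else 0

@[simp]
theorem tr_self (M : SigmaModule k) {l : ℕ} {p : ℤ} (x : M.obj l p) : M.tr x = x := by
  rw [tr, dif_pos ⟨rfl, rfl⟩]
  rfl

/-- The graded `Σ`-module `M ⊕ k` with one more copy of the ground field in arity `0` and
degree `0`. -/
def plus (M : SigmaModule k) : SigmaModule k where
  obj l p := M.obj l p × (zeroWhen k (l ≠ 0 ∨ p ≠ 0) : Submodule k k)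
  act σ := (M.act σ).prodMap LinearMap.id
  act_one x := Prod.ext (M.act_one x.1) rfl
  act_mul σ τ x := Prod.ext (M.act_mul σ τ x.1) rfl

/-- The inclusion of `M` in `M ⊕ k`. -/
def inPlus (M : SigmaModule k) {l : ℕ} {p : ℤ} : M.obj l p →ₗ[k] M.plus.obj l p :=
  LinearMap.inl k _ _

/-- The projection of `M ⊕ k` onto `M`. -/
def fromPlus (M : SigmaModule k) {l : ℕ} {p : ℤ} : M.plus.obj l p →ₗ[k] M.obj l p :=
  LinearMap.fst k _ _

/-- The projection of `M ⊕ k` onto `k`. -/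
def coef (M : SigmaModule k) {l : ℕ} {p : ℤ} : M.plus.obj l p →ₗ[k] k :=
  (Submodule.subtype _).comp (LinearMap.snd k _ _)

@[simp] theorem fromPlus_inPlus (M : SigmaModule k) {l : ℕ} {p : ℤ} (x : M.obj l p) :
    M.fromPlus (M.inPlus x) = x := rfl

@[simp] theorem coef_inPlus (M : SigmaModule k) {l : ℕ} {p : ℤ} (x : M.obj l p) :
    M.coef (M.inPlus x) = 0 := rfl

theorem plus_ext (M : SigmaModule k) {l : ℕ} {p : ℤ} {x y : M.plus.obj l p}
    (h : M.fromPlus x = M.fromPlus y) (h' : M.coef x = M.coef y) : x = y :=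
  Prod.ext h (Subtype.ext h')

theorem coef_eq_zero (M : SigmaModule k) {l : ℕ} {p : ℤ} (h : l ≠ 0 ∨ p ≠ 0)
    (x : M.plus.obj l p) : M.coef x = 0 := x.2.2 h

theorem inPlus_fromPlus (M : SigmaModule k) {l : ℕ} {p : ℤ} (h : l ≠ 0 ∨ p ≠ 0)
    (x : M.plus.obj l p) : M.inPlus (M.fromPlus x) = x :=
  M.plus_ext rfl (M.coef_eq_zero h x).symm

@[simp] theorem fromPlus_act (M : SigmaModule k) {l : ℕ} {p : ℤ} (σ : Equiv.Perm (Fin l))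
    (x : M.plus.obj l p) : M.fromPlus (M.plus.act σ x) = M.act σ (M.fromPlus x) := rfl

@[simp] theorem coef_act (M : SigmaModule k) {l : ℕ} {p : ℤ} (σ : Equiv.Perm (Fin l))
    (x : M.plus.obj l p) : M.coef (M.plus.act σ x) = M.coef x := rfl

theorem inPlus_act (M : SigmaModule k) {l : ℕ} {p : ℤ} (σ : Equiv.Perm (Fin l))
    (x : M.obj l p) : M.inPlus (M.act σ x) = M.plus.act σ (M.inPlus x) := rfl

/-- The new element of arity `0`. -/
def plusUnit (M : SigmaModule k) : M.plus.obj 0 0 := (0, ⟨1, fun h => by simp at h⟩)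

@[simp] theorem fromPlus_plusUnit (M : SigmaModule k) : M.fromPlus M.plusUnit = 0 := rfl

@[simp] theorem coef_plusUnit (M : SigmaModule k) : M.coef M.plusUnit = 1 := rfl

theorem eq_smul_plusUnit (M : SigmaModule k) (h : ∀ p, Subsingleton (M.obj 0 p))
    (x : M.plus.obj 0 0) : x = M.coef x • M.plusUnit :=
  M.plus_ext ((h 0).elim _ _) (by simp)

theorem subsingleton_plus_zero (M : SigmaModule k) (h : ∀ p, Subsingleton (M.obj 0 p)) {p : ℤ}
    (hp : p ≠ 0) : Subsingleton (M.plus.obj 0 p) :=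
  ⟨fun x y => M.plus_ext ((h p).elim _ _)
    ((M.coef_eq_zero (Or.inr hp) x).trans (M.coef_eq_zero (Or.inr hp) y).symm)⟩

end SigmaModule

/-- The permutation of the remaining inputs obtained from `σ` by deleting the input `i`
(and its image `σ i`). -/
noncomputable def delPerm {l n : ℕ} (h : l = n + 1) (σ : Equiv.Perm (Fin l)) (i : Fin l) :
    Equiv.Perm (Fin n) :=
  blockPerm (m := 0) h i σ 1

theorem blockPerm_one {l m n : ℕ} (hn : l + m = n + 1) (i : Fin l) :
    blockPerm hn i 1 1 = 1 := by
  ext a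
  rcases eq_outerPos_or_innerPos hn i a with ⟨j, rfl⟩ | ⟨t, rfl⟩
  · rw [blockPerm_outerPos]; rfl
  · rw [blockPerm_innerPos]; rfl

theorem blockPerm_mul {l m n : ℕ} (hn : l + m = n + 1) (i : Fin l)
    (σ σ' : Equiv.Perm (Fin l)) (τ τ' : Equiv.Perm (Fin m)) :
    blockPerm hn i (σ * σ') (τ * τ') = blockPerm hn (σ' i) σ τ * blockPerm hn i σ' τ' :=
  assSet.comp_act hn i σ' τ' σ τ

theorem delPerm_one {l n : ℕ} (h : l = n + 1) (i : Fin l) : delPerm h 1 i = 1 :=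
  blockPerm_one _ i

theorem delPerm_mul {l n : ℕ} (h : l = n + 1) (σ τ : Equiv.Perm (Fin l)) (i : Fin l) :
    delPerm h (σ * τ) i = delPerm h σ (τ i) * delPerm h τ i :=
  blockPerm_mul (m := 0) h i σ τ 1 1

/-- The image of a remaining input under `delPerm`. -/
theorem delPerm_val {l n : ℕ} (h : l = n + 1) (σ : Equiv.Perm (Fin l)) (i j : Fin l) (hj : j ≠ i)
    (a : Fin n) (ha : a.1 = if j.1 < i.1 then j.1 else j.1 - 1) :
    (delPerm h σ i a).1 = if (σ j).1 < (σ i).1 then (σ j).1 else (σ j).1 - 1 :=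
  blockPerm_val_outer (m := 0) h i σ 1 a j hj ha

/-- Deletion of an input of the inner operation of `σ ∘_i τ`. -/
theorem delPerm_blockPerm_inner {l m n m' n' : ℕ} (hn : l + m = n + 1) (hm' : m = m' + 1)
    (hn' : n = n' + 1) (h : l + m' = n' + 1) (i : Fin l) (t : Fin m) (s : Fin n)
    (hs : s.1 = i.1 + t.1) (σ : Equiv.Perm (Fin l)) (τ : Equiv.Perm (Fin m)) :
    delPerm hn' (blockPerm hn i σ τ) s = blockPerm h i σ (delPerm hm' τ t) :=
  assSet.comp_assoc (n := 0) hn hn' hm' h i t s hs σ τ (1 : Equiv.Perm (Fin 0))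

/-- Deletion of an input of the outer operation of `σ ∘_i τ`. -/
theorem delPerm_blockPerm_outer {l m n l' n' : ℕ} (hn : l + m = n + 1) (hl' : l = l' + 1)
    (hn' : n = n' + 1) (h : l' + m = n' + 1) (i j : Fin l) (hj : j ≠ i) (i' : Fin l') (s : Fin n)
    (hs : s.1 = if j.1 < i.1 then j.1 else j.1 + m - 1)
    (hi' : i'.1 = if i.1 < j.1 then i.1 else i.1 - 1)
    (σ : Equiv.Perm (Fin l)) (τ : Equiv.Perm (Fin m)) :
    delPerm hn' (blockPerm hn i σ τ) s = blockPerm h i' (delPerm hl' σ j) τ := by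
  have hne : j.1 ≠ i.1 := fun h => hj (Fin.ext h)
  by_cases hij : i.1 < j.1
  · rw [if_neg (by omega)] at hs
    rw [if_pos hij] at hi'
    exact assSet.comp_comm (n := 0) hn hn' hl' h i j s i' hij (by omega) hi' σ τ
      (1 : Equiv.Perm (Fin 0))
  · rw [if_pos (by omega)] at hs
    rw [if_neg hij] at hi'
    exact (assSet.comp_comm (m := 0) hl' h hn hn' j i i' s (by change j.1 < i.1; omega) (by omega)
      hs σ (1 : Equiv.Perm (Fin 0)) τ).symm

namespace GradedOperad

variable {k : Type u} [Field k] (F : GradedOperad k)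

/-- The partial composite `x ∘_i y` in `F ⊕ k`, where `x` comes with the element `ξ` which is to be
its restriction `x ∘_i 1` along the unit `1 ∈ k`. -/
def pc {l m n : ℕ} {p q r : ℤ} (hn : l + m = n + 1) (hr : p + q = r) (i : Fin l) :
    (F.obj l p × F.plus.obj (l - 1) p) →ₗ[k] F.plus.obj m q →ₗ[k] F.plus.obj n r :=
  LinearMap.mk₂ k
    (fun X y => F.inPlus (F.comp hn hr i X.1 (F.fromPlus y)) + F.coef y • F.plus.tr X.2)
    (fun X X' y => by
      simp only [Prod.fst_add, Prod.snd_add, map_add, LinearMap.add_apply, smul_add]; abel)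
    (fun c X y => by
      simp only [Prod.smul_fst, Prod.smul_snd, map_smul, LinearMap.smul_apply, smul_add,
        smul_comm c])
    (fun X y y' => by simp only [map_add, add_smul]; abel)
    (fun c X y => by simp only [map_smul, smul_add, smul_smul, smul_eq_mul])

variable {F}

theorem pc_apply {l m n : ℕ} {p q r : ℤ} (hn : l + m = n + 1) (hr : p + q = r) (i : Fin l)
    (x : F.obj l p) (ξ : F.plus.obj (l - 1) p) (y : F.plus.obj m q) :
    F.pc hn hr i (x, ξ) y = F.inPlus (F.comp hn hr i x (F.fromPlus y)) + F.coef y • F.plus.tr ξ :=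
  rfl

@[simp]
theorem pc_inPlus {l m n : ℕ} {p q r : ℤ} (hn : l + m = n + 1) (hr : p + q = r) (i : Fin l)
    (x : F.obj l p) (ξ : F.plus.obj (l - 1) p) (y : F.obj m q) :
    F.pc hn hr i (x, ξ) (F.inPlus y) = F.inPlus (F.comp hn hr i x y) := by
  simp [pc_apply]

/-- An element of `F ⊕ k` of arity `0` is a multiple of the unit. -/
theorem pc_unit {l n : ℕ} {p q r : ℤ} (hn : l + 0 = n + 1) (hr : p + q = r) (i : Fin l)
    (hF : ∀ p, Subsingleton (F.obj 0 p))
    (x : F.obj l p) (ξ : F.plus.obj (l - 1) p) (y : F.plus.obj 0 q) :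
    F.pc hn hr i (x, ξ) y = F.coef y • F.plus.tr ξ := by
  rw [pc_apply, (hF q).elim (F.fromPlus y) 0, map_zero, map_zero, zero_add]

theorem pc_of_pos {l m n : ℕ} {p q r : ℤ} (hn : l + m = n + 1) (hr : p + q = r) (i : Fin l)
    (hm : m ≠ 0) (X : F.obj l p × F.plus.obj (l - 1) p) (y : F.plus.obj m q) :
    F.pc hn hr i X y = F.inPlus (F.comp hn hr i X.1 (F.fromPlus y)) := by
  rw [pc_apply, F.coef_eq_zero (Or.inl hm), zero_smul, add_zero]

theorem fromPlus_pc_of_pos {l m n : ℕ} {p q r : ℤ} (hn : l + m = n + 1) (hr : p + q = r)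
    (i : Fin l) (hm : m ≠ 0) (X : F.obj l p × F.plus.obj (l - 1) p) (y : F.plus.obj m q) :
    F.fromPlus (F.pc hn hr i X y) = F.comp hn hr i X.1 (F.fromPlus y) := by
  rw [pc_of_pos _ _ _ hm, SigmaModule.fromPlus_inPlus]

theorem pc_assoc {l m n a b c : ℕ} {p q r s s' t : ℤ}
    (h₁ : l + m = a + 1) (g₁ : p + q = s) (h₂ : a + n = c + 1) (g₂ : s + r = t)
    (h₃ : m + n = b + 1) (g₃ : q + r = s') (h₄ : l + b = c + 1) (g₄ : p + s' = t)
    (h₅ : l + (m - 1) = a - 1 + 1)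
    (i : Fin l) (j : Fin m) (e : Fin a) (he : e.1 = i.1 + j.1)
    (X : F.obj l p × F.plus.obj (l - 1) p) (y : F.obj m q) (η : F.plus.obj (m - 1) q)
    (z : F.plus.obj n r) :
    F.pc h₂ g₂ e (F.comp h₁ g₁ i X.1 y, F.pc h₅ g₁ i X η) z
      = F.pc h₄ g₄ i X (F.pc h₃ g₃ j (y, η) z) := by
  rw [pc_apply, F.comp_assoc h₁ g₁ h₂ g₂ h₃ g₃ h₄ g₄ i j e he, pc_apply h₃ g₃, map_add, map_smul,
    pc_inPlus]
  congr 1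
  by_cases h : n ≠ 0 ∨ r ≠ 0
  · rw [F.coef_eq_zero h, zero_smul, zero_smul]
  · obtain ⟨rfl, rfl⟩ : n = 0 ∧ r = 0 := by tauto
    obtain rfl : s' = q := by omega
    obtain rfl : t = s := by omega
    obtain rfl : b = m - 1 := by omega
    obtain rfl : c = a - 1 := by omega
    simp only [SigmaModule.tr_self]

theorem pc_act {l m n : ℕ} {p q r : ℤ} (hn : l + m = n + 1) (hr : p + q = r) (i : Fin l)
    (hl : l = l - 1 + 1) (σ : Equiv.Perm (Fin l)) (τ : Equiv.Perm (Fin m))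
    (x : F.obj l p) (ξ : F.plus.obj (l - 1) p) (y : F.plus.obj m q) :
    F.pc hn hr i (F.act σ x, F.plus.act (delPerm hl σ i) ξ) (F.plus.act τ y)
      = F.plus.act (blockPerm hn i σ τ) (F.pc hn hr (σ i) (x, ξ) y) := by
  rw [pc_apply, pc_apply, SigmaModule.fromPlus_act, F.comp_act, map_add, map_smul,
    SigmaModule.coef_act, SigmaModule.inPlus_act]
  congr 1
  by_cases h : m ≠ 0 ∨ q ≠ 0
  · rw [F.coef_eq_zero h, zero_smul, zero_smul]
  · obtain ⟨rfl, rfl⟩ : m = 0 ∧ q = 0 := by tauto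
    obtain rfl : r = p := by omega
    obtain rfl : n = l - 1 := by omega
    rw [SigmaModule.tr_self, SigmaModule.tr_self, Subsingleton.elim τ 1]
    rfl

/-! ### The operad of elements with formal restrictions -/

/-- The formal restriction of a composite `x ∘_i y` along its input `s`: if `s` is an input of `x`,
then it is the composite of the restriction of `x` with `y`, and if `s` is an input of `y`, then it
is the composite of `x` with the restriction of `y`. -/
def compRestr {l m n : ℕ} {p q r : ℤ} (hn : l + m = n + 1) (hr : p + q = r) (i : Fin l)
    (x : F.obj l p) (X : Fin l → F.plus.obj (l - 1) p) (y : F.obj m q)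
    (Y : Fin m → F.plus.obj (m - 1) q) (s : Fin n) : F.plus.obj (n - 1) r :=
  if h : s.1 < i.1 then
    F.inPlus (F.comp (by omega : l - 1 + m = n - 1 + 1) hr ⟨i.1 - 1, by omega⟩
      (F.fromPlus (X ⟨s.1, by omega⟩)) y)
  else if h' : s.1 < i.1 + m then
    F.pc (by omega : l + (m - 1) = n - 1 + 1) hr i (x, X i) (Y ⟨s.1 - i.1, by omega⟩)
  else
    F.inPlus (F.comp (by omega : l - 1 + m = n - 1 + 1) hr ⟨i.1, by omega⟩
      (F.fromPlus (X ⟨s.1 + 1 - m, by omega⟩)) y)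

section compRestr

variable {l m n : ℕ} {p q r : ℤ} (hn : l + m = n + 1) (hr : p + q = r) (i : Fin l)
    (x : F.obj l p) (X : Fin l → F.plus.obj (l - 1) p) (y : F.obj m q)
    (Y : Fin m → F.plus.obj (m - 1) q)

theorem compRestr_inner (s : Fin n) (t : Fin m) (h : s.1 = i.1 + t.1)
    (h' : l + (m - 1) = n - 1 + 1) :
    compRestr hn hr i x X y Y s = F.pc h' hr i (x, X i) (Y t) := by
  rw [compRestr, dif_neg (by omega), dif_pos (by omega)]
  congr 2
  exact Fin.ext (by simp only; omega)

theorem compRestr_outer (s : Fin n) (j : Fin l) (hj : j ≠ i) (i' : Fin (l - 1))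
    (hs : s.1 = if j.1 < i.1 then j.1 else j.1 + m - 1)
    (hi' : i'.1 = if i.1 < j.1 then i.1 else i.1 - 1)
    (h' : l - 1 + m = n - 1 + 1) :
    compRestr hn hr i x X y Y s = F.inPlus (F.comp h' hr i' (F.fromPlus (X j)) y) := by
  have hne : j.1 ≠ i.1 := fun h => hj (Fin.ext h)
  rw [compRestr]
  by_cases hij : i.1 < j.1
  · rw [if_neg (by omega)] at hs
    rw [if_pos hij] at hi'
    rw [dif_neg (by omega), dif_neg (by omega)]
    have e1 : (⟨i.1, by omega⟩ : Fin (l - 1)) = i' := Fin.ext hi'.symm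
    have e2 : (⟨s.1 + 1 - m, by omega⟩ : Fin l) = j := Fin.ext (by simp only; omega)
    rw [e1, e2]
  · rw [if_pos (by omega)] at hs
    rw [if_neg hij] at hi'
    rw [dif_pos (by omega)]
    have e1 : (⟨i.1 - 1, by omega⟩ : Fin (l - 1)) = i' := Fin.ext hi'.symm
    have e2 : (⟨s.1, by omega⟩ : Fin l) = j := Fin.ext hs
    rw [e1, e2]

end compRestr

end GradedOperad

namespace GradedOperad

variable {k : Type u} [Field k] {F : GradedOperad k}

theorem pc_comm {l m n a b c : ℕ} {p q r s s' t : ℤ}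
    (h₁ : l + m = a + 1) (g₁ : p + q = s) (h₂ : a + n = c + 1) (g₂ : s + r = t)
    (h₃ : l + n = b + 1) (g₃ : p + r = s') (h₄ : b + m = c + 1) (g₄ : s' + q = t)
    (h₅ : l - 1 + m = a - 1 + 1)
    (i j : Fin l) (e : Fin a) (e' : Fin b) (i' : Fin (l - 1)) (hij : i < j)
    (he : e.1 + 1 = j.1 + m) (he' : e'.1 = i.1) (hi' : i'.1 = i.1)
    (x : F.obj l p) (ξ : F.plus.obj (l - 1) p) (y : F.obj m q) (z : F.plus.obj n r) :
    F.pc h₂ g₂ e (F.comp h₁ g₁ i x y, F.inPlus (F.comp h₅ g₁ i' (F.fromPlus ξ) y)) z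
      = (q * r).negOnePow •
        F.inPlus (F.comp h₄ g₄ e' (F.fromPlus (F.pc h₃ g₃ j (x, ξ) z)) y) := by
  rw [pc_apply, pc_apply, F.comp_comm h₁ g₁ h₂ g₂ h₃ g₃ h₄ g₄ i j e e' hij he he']
  simp only [map_add, map_smul, LinearMap.add_apply, LinearMap.smul_apply, smul_add,
    SigmaModule.fromPlus_inPlus]
  congr 1
  · rw [Units.smul_def, Units.smul_def, map_zsmul]
  · by_cases h : n ≠ 0 ∨ r ≠ 0
    · simp only [F.coef_eq_zero h, zero_smul, smul_zero]
    · obtain ⟨rfl, rfl⟩ : n = 0 ∧ r = 0 := by tauto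
      obtain rfl : s' = p := by omega
      obtain rfl : t = s := by omega
      obtain rfl : b = l - 1 := by omega
      obtain rfl : c = a - 1 := by omega
      obtain rfl : i' = e' := Fin.ext (by omega)
      simp only [SigmaModule.tr_self, mul_zero, Int.negOnePow_zero, one_smul]

theorem pc_comm' {l m n a b c : ℕ} {p q r s s' t : ℤ}
    (h₁ : l + m = a + 1) (g₁ : p + q = s) (h₂ : a + n = c + 1) (g₂ : s + r = t)
    (h₃ : l + n = b + 1) (g₃ : p + r = s') (h₄ : b + m = c + 1) (g₄ : s' + q = t)
    (h₅ : l - 1 + n = b - 1 + 1)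
    (i j : Fin l) (e : Fin a) (e' : Fin b) (j' : Fin (l - 1)) (hij : i < j)
    (he : e.1 + 1 = j.1 + m) (he' : e'.1 = i.1) (hj' : j'.1 + 1 = j.1)
    (x : F.obj l p) (ξ : F.plus.obj (l - 1) p) (y : F.plus.obj m q) (z : F.obj n r) :
    F.inPlus (F.comp h₂ g₂ e (F.fromPlus (F.pc h₁ g₁ i (x, ξ) y)) z)
      = (q * r).negOnePow •
        F.pc h₄ g₄ e' (F.comp h₃ g₃ j x z, F.inPlus (F.comp h₅ g₃ j' (F.fromPlus ξ) z)) y := by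
  rw [pc_apply, pc_apply]
  simp only [map_add, map_smul, LinearMap.add_apply, LinearMap.smul_apply, smul_add,
    SigmaModule.fromPlus_inPlus]
  rw [F.comp_comm h₁ g₁ h₂ g₂ h₃ g₃ h₄ g₄ i j e e' hij he he']
  congr 1
  · rw [Units.smul_def, Units.smul_def, map_zsmul]
  · by_cases h : m ≠ 0 ∨ q ≠ 0
    · simp only [F.coef_eq_zero h, zero_smul, smul_zero]
    · obtain ⟨rfl, rfl⟩ : m = 0 ∧ q = 0 := by tauto
      obtain rfl : s = p := by omega
      obtain rfl : t = s' := by omega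
      obtain rfl : a = l - 1 := by omega
      obtain rfl : c = b - 1 := by omega
      obtain rfl : j' = e := Fin.ext (by omega)
      simp only [SigmaModule.tr_self, zero_mul, Int.negOnePow_zero, one_smul]

theorem pc_ident {m : ℕ} {q : ℤ} (hn : 1 + m = m + 1) (hr : 0 + q = q) (i : Fin 1)
    (y : F.plus.obj m q) : F.pc hn hr i (F.ident, F.plusUnit) y = y := by
  rw [pc_apply, F.ident_comp]
  by_cases h : m ≠ 0 ∨ q ≠ 0
  · rw [F.coef_eq_zero h, zero_smul, add_zero, F.inPlus_fromPlus h]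
  · obtain ⟨rfl, rfl⟩ : m = 0 ∧ q = 0 := by tauto
    refine F.plus_ext ?_ ?_
    · rw [map_add, map_smul]
      erw [SigmaModule.tr_self]
      simp
    · rw [map_add, map_smul]
      erw [SigmaModule.tr_self]
      simp

theorem pc_plusUnit {l n : ℕ} {p : ℤ} (hn : l + 0 = n + 1) (hr : p + 0 = p) (i : Fin l)
    (X : F.obj l p × F.plus.obj (l - 1) p) :
    F.pc hn hr i X F.plusUnit = F.plus.tr X.2 := by
  obtain ⟨x, ξ⟩ := X
  simp [pc_apply]

theorem compRestr_assoc {l m n a b c : ℕ} {p q r s s' t : ℤ}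
    (h₁ : l + m = a + 1) (g₁ : p + q = s) (h₂ : a + n = c + 1) (g₂ : s + r = t)
    (h₃ : m + n = b + 1) (g₃ : q + r = s') (h₄ : l + b = c + 1) (g₄ : p + s' = t)
    (i : Fin l) (j : Fin m) (e : Fin a) (he : e.1 = i.1 + j.1)
    (x : F.obj l p) (X : Fin l → F.plus.obj (l - 1) p) (y : F.obj m q)
    (Y : Fin m → F.plus.obj (m - 1) q) (z : F.obj n r) (Z : Fin n → F.plus.obj (n - 1) r)
    (w : Fin c) :
    compRestr h₂ g₂ e (F.comp h₁ g₁ i x y) (compRestr h₁ g₁ i x X y Y) z Z w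
      = compRestr h₄ g₄ i x X (F.comp h₃ g₃ j y z) (compRestr h₃ g₃ j y Y z Z) w := by
  have hi := i.2
  have hj := j.2
  have hw := w.2
  rcases eq_outerPos_or_innerPos h₂ e w with ⟨⟨v, hv⟩, hwv⟩ | ⟨t, hwt⟩
  · have hve : v.1 ≠ e.1 := fun h => hv (Fin.ext h)
    have hv2 := v.2
    have hwv : w.1 = if v.1 < e.1 then v.1 else v.1 + n - 1 := congrArg Fin.val hwv
    rw [compRestr_outer h₂ g₂ e _ _ _ _ w v hv
      ⟨if e.1 < v.1 then e.1 else e.1 - 1, by split_ifs <;> omega⟩ hwv rfl (by omega)]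
    rcases eq_outerPos_or_innerPos h₁ i v with ⟨⟨o, ho⟩, hvo⟩ | ⟨t, hvt⟩
    · have hoi : o.1 ≠ i.1 := fun h => ho (Fin.ext h)
      have ho2 := o.2
      have hvo : v.1 = if o.1 < i.1 then o.1 else o.1 + m - 1 := congrArg Fin.val hvo
      have hi'2 : (if i.1 < o.1 then i.1 else i.1 - 1) < l - 1 := by split_ifs <;> omega
      rw [compRestr_outer h₁ g₁ i _ _ _ _ v o ho ⟨_, hi'2⟩ hvo rfl (by omega),
        compRestr_outer h₄ g₄ i _ _ _ _ w o ho ⟨_, hi'2⟩ (by split_ifs at * <;> omega) rfl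
          (by omega), SigmaModule.fromPlus_inPlus]
      congr 1
      refine F.comp_assoc _ _ _ _ _ _ _ _ _ _ _ ?_ _ _ _
      simp only
      split_ifs at * <;> omega
    · have hvt : v.1 = i.1 + t.1 := congrArg Fin.val hvt
      have ht2 := t.2
      have htj : t ≠ j := fun h => hve (by rw [hvt, h, he])
      have htj' : t.1 ≠ j.1 := fun h => htj (Fin.ext h)
      have hu2 : (if t.1 < j.1 then t.1 else t.1 + n - 1) < b := by split_ifs at * <;> omega
      have hj'2 : (if j.1 < t.1 then j.1 else j.1 - 1) < m - 1 := by split_ifs <;> omega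
      rw [compRestr_inner h₁ g₁ i _ _ _ _ v t hvt (by omega),
        fromPlus_pc_of_pos _ _ _ (by omega : m - 1 ≠ 0),
        compRestr_inner h₄ g₄ i _ _ _ _ w ⟨_, hu2⟩ (by simp only; split_ifs at * <;> omega)
          (by omega),
        compRestr_outer h₃ g₃ j _ _ _ _ ⟨_, hu2⟩ t htj ⟨_, hj'2⟩ rfl rfl (by omega), pc_inPlus]
      congr 1
      refine F.comp_assoc _ _ _ _ _ _ _ _ _ _ _ ?_ _ _ _
      simp only
      split_ifs at * <;> omega
  · have hwt : w.1 = e.1 + t.1 := congrArg Fin.val hwt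
    have ht2 := t.2
    rw [compRestr_inner h₂ g₂ e _ _ _ _ w t hwt (by omega),
      compRestr_inner h₁ g₁ i _ _ _ _ e j he (by omega),
      compRestr_inner h₄ g₄ i _ _ _ _ w ⟨j.1 + t.1, by omega⟩ (by simp only; omega) (by omega),
      compRestr_inner h₃ g₃ j _ _ _ _ ⟨j.1 + t.1, by omega⟩ t rfl (by omega)]
    exact pc_assoc h₁ g₁ _ g₂ _ g₃ _ g₄ _ i j e he (x, X i) y (Y j) (Z t)

theorem compRestr_comm_outer {l m n a b c : ℕ} {p q r s s' t : ℤ}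
    (h₁ : l + m = a + 1) (g₁ : p + q = s) (h₂ : a + n = c + 1) (g₂ : s + r = t)
    (h₃ : l + n = b + 1) (g₃ : p + r = s') (h₄ : b + m = c + 1) (g₄ : s' + q = t)
    (i j : Fin l) (e : Fin a) (e' : Fin b) (hij : i < j) (he : e.1 + 1 = j.1 + m)
    (he' : e'.1 = i.1)
    (x : F.obj l p) (X : Fin l → F.plus.obj (l - 1) p) (y : F.obj m q)
    (Y : Fin m → F.plus.obj (m - 1) q) (z : F.obj n r) (Z : Fin n → F.plus.obj (n - 1) r)
    (w : Fin c) (o : Fin l) (hoi : o ≠ i) (hoj : o ≠ j) (v : Fin a) (v' : Fin b)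
    (e₁ : Fin (a - 1)) (e₁' : Fin (b - 1)) (i₁ j₁ : Fin (l - 1))
    (hv : v.1 = if o.1 < i.1 then o.1 else o.1 + m - 1)
    (hv' : v'.1 = if o.1 < j.1 then o.1 else o.1 + n - 1)
    (hw : w.1 = if v.1 < e.1 then v.1 else v.1 + n - 1)
    (hw' : w.1 = if v'.1 < e'.1 then v'.1 else v'.1 + m - 1)
    (he₁ : e₁.1 = if e.1 < v.1 then e.1 else e.1 - 1)
    (he₁' : e₁'.1 = if e'.1 < v'.1 then e'.1 else e'.1 - 1)
    (hi₁ : i₁.1 = if i.1 < o.1 then i.1 else i.1 - 1)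
    (hj₁ : j₁.1 = if j.1 < o.1 then j.1 else j.1 - 1) :
    compRestr h₂ g₂ e (F.comp h₁ g₁ i x y) (compRestr h₁ g₁ i x X y Y) z Z w
      = (q * r).negOnePow •
        compRestr h₄ g₄ e' (F.comp h₃ g₃ j x z) (compRestr h₃ g₃ j x X z Z) y Y w := by
  have hij' : i.1 < j.1 := hij
  have hoi' : o.1 ≠ i.1 := fun h => hoi (Fin.ext h)
  have hoj' : o.1 ≠ j.1 := fun h => hoj (Fin.ext h)
  have hi := i.2
  have hj := j.2
  have ho := o.2
  have hw2 := w.2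
  have hve : v ≠ e := fun h => by
    rw [h] at hv
    split_ifs at hv <;> omega
  have hve' : v' ≠ e' := fun h => by
    rw [h] at hv'
    split_ifs at hv' <;> omega
  have h5 : l - 1 + m = a - 1 + 1 := by omega
  have h6 : l - 1 + n = b - 1 + 1 := by omega
  have h7 : a - 1 + n = c - 1 + 1 := by have := v.2; have := e.2; have := e₁.2; omega
  have h8 : b - 1 + m = c - 1 + 1 := by have := v'.2; have := e'.2; have := e₁'.2; omega
  have hij₁ : i₁.1 < j₁.1 := by
    clear hw hw' he₁ he₁' hv hv'
    split_ifs at hi₁ hj₁ <;> omega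
  have hee : e₁.1 + 1 = j₁.1 + m := by
    clear hw hw' he₁' hv' hi₁
    split_ifs at hv <;> split_ifs at he₁ <;> split_ifs at hj₁ <;> omega
  have hee' : e₁'.1 = i₁.1 := by
    clear hw hw' he₁ hv hj₁
    split_ifs at hv' <;> split_ifs at he₁' <;> split_ifs at hi₁ <;> omega
  rw [compRestr_outer h₂ g₂ e _ _ _ _ w v hve e₁ hw he₁ h7,
    compRestr_outer h₁ g₁ i _ _ _ _ v o hoi i₁ hv hi₁ h5,
    compRestr_outer h₄ g₄ e' _ _ _ _ w v' hve' e₁' hw' he₁' h8,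
    compRestr_outer h₃ g₃ j _ _ _ _ v' o hoj j₁ hv' hj₁ h6,
    SigmaModule.fromPlus_inPlus, SigmaModule.fromPlus_inPlus,
    F.comp_comm h5 g₁ h7 g₂ h6 g₃ h8 g₄ i₁ j₁ e₁ e₁' hij₁ hee hee']
  rw [Units.smul_def, Units.smul_def, map_zsmul]

theorem compRestr_comm {l m n a b c : ℕ} {p q r s s' t : ℤ}
    (h₁ : l + m = a + 1) (g₁ : p + q = s) (h₂ : a + n = c + 1) (g₂ : s + r = t)
    (h₃ : l + n = b + 1) (g₃ : p + r = s') (h₄ : b + m = c + 1) (g₄ : s' + q = t)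
    (i j : Fin l) (e : Fin a) (e' : Fin b) (hij : i < j) (he : e.1 + 1 = j.1 + m)
    (he' : e'.1 = i.1)
    (x : F.obj l p) (X : Fin l → F.plus.obj (l - 1) p) (y : F.obj m q)
    (Y : Fin m → F.plus.obj (m - 1) q) (z : F.obj n r) (Z : Fin n → F.plus.obj (n - 1) r)
    (w : Fin c) :
    compRestr h₂ g₂ e (F.comp h₁ g₁ i x y) (compRestr h₁ g₁ i x X y Y) z Z w
      = (q * r).negOnePow •
        compRestr h₄ g₄ e' (F.comp h₃ g₃ j x z) (compRestr h₃ g₃ j x X z Z) y Y w := by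
  have hij' : i.1 < j.1 := hij
  have hne : j ≠ i := fun h => by rw [h] at hij'; omega
  have hi := i.2
  have hj := j.2
  have hw := w.2
  rcases eq_outerPos_or_innerPos h₂ e w with ⟨⟨v, hv⟩, hwv⟩ | ⟨t, hwt⟩
  · have hve : v.1 ≠ e.1 := fun h => hv (Fin.ext h)
    have hv2 := v.2
    have hwv : w.1 = if v.1 < e.1 then v.1 else v.1 + n - 1 := congrArg Fin.val hwv
    rw [compRestr_outer h₂ g₂ e _ _ _ _ w v hv
      ⟨if e.1 < v.1 then e.1 else e.1 - 1, by split_ifs <;> omega⟩ hwv rfl (by omega)]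
    rcases eq_outerPos_or_innerPos h₁ i v with ⟨⟨o, ho⟩, hvo⟩ | ⟨t, hvt⟩
    · have hoi : o.1 ≠ i.1 := fun h => ho (Fin.ext h)
      have ho2 := o.2
      have hvo : v.1 = if o.1 < i.1 then o.1 else o.1 + m - 1 := congrArg Fin.val hvo
      rw [← compRestr_outer h₂ g₂ e _ _ _ _ w v hv
        ⟨if e.1 < v.1 then e.1 else e.1 - 1, by split_ifs <;> omega⟩ hwv rfl (by omega)]
      by_cases hoi1 : o.1 < i.1
      · rw [if_pos hoi1] at hvo
        rw [if_pos (by omega)] at hwv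
        refine compRestr_comm_outer h₁ g₁ h₂ g₂ h₃ g₃ h₄ g₄ i j e e' hij he he' x X y Y z Z w o
          ho (fun h => by rw [h] at hoi1; omega) v ⟨o.1, by omega⟩ ⟨e.1 - 1, by omega⟩
          ⟨e'.1 - 1, by omega⟩ ⟨i.1 - 1, by omega⟩ ⟨j.1 - 1, by omega⟩ ?_ ?_ ?_ ?_ ?_ ?_ ?_ ?_
        all_goals try simp only
        all_goals split_ifs <;> omega
      · rw [if_neg hoi1] at hvo
        have hoj : o.1 ≠ j.1 := fun h => by omega
        have hoj' : o ≠ j := fun h => hoj (congrArg Fin.val h)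
        by_cases hoj1 : o.1 < j.1
        · rw [if_pos (by omega)] at hwv
          refine compRestr_comm_outer h₁ g₁ h₂ g₂ h₃ g₃ h₄ g₄ i j e e' hij he he' x X y Y z Z w o
            ho hoj' v ⟨o.1, by omega⟩ ⟨e.1 - 1, by omega⟩
            ⟨e'.1, by omega⟩ ⟨i.1, by omega⟩ ⟨j.1 - 1, by omega⟩ ?_ ?_ ?_ ?_ ?_ ?_ ?_ ?_
          all_goals try simp only
          all_goals split_ifs <;> omega
        · rw [if_neg (by omega)] at hwv
          refine compRestr_comm_outer h₁ g₁ h₂ g₂ h₃ g₃ h₄ g₄ i j e e' hij he he' x X y Y z Z w o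
            ho hoj' v ⟨o.1 + n - 1, by omega⟩ ⟨e.1, by omega⟩
            ⟨e'.1, by omega⟩ ⟨i.1, by omega⟩ ⟨j.1, by omega⟩ ?_ ?_ ?_ ?_ ?_ ?_ ?_ ?_
          all_goals try simp only
          all_goals split_ifs <;> omega
    · have hvt : v.1 = i.1 + t.1 := congrArg Fin.val hvt
      have ht2 := t.2
      have he'2 : e'.1 ≠ j.1 := by omega
      rw [compRestr_inner h₁ g₁ i _ _ _ _ v t hvt (by omega),
        compRestr_inner h₄ g₄ e' _ _ _ _ w t (by split_ifs at * <;> omega) (by omega),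
        compRestr_outer h₃ g₃ j _ _ _ _ e' i hne.symm ⟨j.1 - 1, by omega⟩
          (by rw [if_pos hij']; exact he') (by simp only; rw [if_neg (by omega)]) (by omega)]
      refine pc_comm' _ g₁ _ g₂ h₃ g₃ _ g₄ _ i j _ e' _ hij ?_ he' ?_ _ _ _ _
      · simp only
        split_ifs at * <;> omega
      · simp only
        omega
  · have hwt : w.1 = e.1 + t.1 := congrArg Fin.val hwt
    have ht2 := t.2
    have he'2 := e'.2
    rw [compRestr_inner h₂ g₂ e _ _ _ _ w t hwt (by omega),
      compRestr_outer h₁ g₁ i _ _ _ _ e j hne ⟨i.1, by omega⟩ (by split_ifs <;> omega)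
        (by simp only; split_ifs; rfl) (by omega),
      compRestr_outer h₄ g₄ e' _ _ _ _ w ⟨j.1 + t.1, by omega⟩
        (fun h => by have := congrArg Fin.val h; simp only at this; omega)
        ⟨e'.1, by omega⟩ (by simp only; split_ifs <;> omega)
        (by simp only; split_ifs <;> omega) (by omega),
      compRestr_inner h₃ g₃ j _ _ _ _ ⟨j.1 + t.1, by omega⟩ t rfl (by omega)]
    exact pc_comm (b := b - 1) (c := c - 1) (n := n - 1) h₁ g₁ _ g₂ _ g₃ _ g₄ _ i j e
      ⟨e'.1, by omega⟩ ⟨i.1, by omega⟩ hij he he' rfl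
      x (X j) y (Z t)

theorem compRestr_act {l m n : ℕ} {p q r : ℤ} (hn : l + m = n + 1) (hr : p + q = r) (i : Fin l)
    (hl : ∀ _ : Fin l, l = l - 1 + 1) (hm : ∀ _ : Fin m, m = m - 1 + 1) (hn1 : n = n - 1 + 1)
    (σ : Equiv.Perm (Fin l)) (τ : Equiv.Perm (Fin m))
    (x : F.obj l p) (X : Fin l → F.plus.obj (l - 1) p) (y : F.obj m q)
    (Y : Fin m → F.plus.obj (m - 1) q) (w : Fin n) :
    compRestr hn hr i (F.act σ x) (fun s => F.plus.act (delPerm (hl s) σ s) (X (σ s)))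
        (F.act τ y) (fun s => F.plus.act (delPerm (hm s) τ s) (Y (τ s))) w
      = F.plus.act (delPerm hn1 (blockPerm hn i σ τ) w)
          (compRestr hn hr (σ i) x X y Y (blockPerm hn i σ τ w)) := by
  have hi := i.2
  have hw := w.2
  rcases eq_outerPos_or_innerPos hn i w with ⟨⟨o, ho⟩, hwo⟩ | ⟨t, hwt⟩
  · have hoi : o.1 ≠ i.1 := fun h => ho (Fin.ext h)
    have ho2 := o.2
    have hwo : w.1 = if o.1 < i.1 then o.1 else o.1 + m - 1 := congrArg Fin.val hwo
    have hi'2 : (if i.1 < o.1 then i.1 else i.1 - 1) < l - 1 := by split_ifs <;> omega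
    have hσ : σ o ≠ σ i := fun h => ho (σ.injective h)
    have hσ' : (σ i).1 ≠ (σ o).1 := fun h => hσ (Fin.ext h.symm)
    have hd := delPerm_val (hl o) σ o i (Ne.symm ho) ⟨_, hi'2⟩ rfl
    rw [compRestr_outer hn hr i _ _ _ _ w o ho ⟨_, hi'2⟩ hwo rfl (by omega),
      compRestr_outer hn hr (σ i) _ _ _ _ _ (σ o) hσ (delPerm (hl o) σ o ⟨_, hi'2⟩)
        (blockPerm_val_outer hn i σ τ w o ho hwo) hd (by omega),
      SigmaModule.fromPlus_act, F.comp_act, SigmaModule.inPlus_act,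
      delPerm_blockPerm_outer hn (hl o) hn1 (by omega) i o ho ⟨_, hi'2⟩ w hwo rfl]
  · have hwt : w.1 = i.1 + t.1 := congrArg Fin.val hwt
    have ht2 := t.2
    rw [compRestr_inner hn hr i _ _ _ _ w t hwt (by omega),
      compRestr_inner hn hr (σ i) _ _ _ _ _ (τ t) (blockPerm_val_inner hn i σ τ w t hwt)
        (by omega), pc_act _ _ _ (hl i),
      delPerm_blockPerm_inner hn (hm t) hn1 (by omega) i t w hwt]

variable (F)

/-- The graded operad of elements of `F` together with formal restrictions along their inputs. A
unital structure on `F` gives a section of the projection to `F`. -/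
noncomputable def restrOperad : GradedOperad k where
  obj l p := F.obj l p × (Fin l → F.plus.obj (l - 1) p)
  act {l p} σ := (F.act σ).prodMap
    (LinearMap.pi fun s => (F.plus.act (delPerm (by have := s.2; omega) σ s)).comp
      (LinearMap.proj (σ s)))
  act_one x := Prod.ext (F.act_one x.1) (funext fun s => by
    change F.plus.act (delPerm _ 1 s) (x.2 s) = x.2 s
    rw [delPerm_one, F.plus.act_one])
  act_mul σ τ x := Prod.ext (F.act_mul σ τ x.1) (funext fun s => by
    change F.plus.act (delPerm _ (σ * τ) s) (x.2 (σ (τ s)))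
      = F.plus.act (delPerm _ τ s) (F.plus.act (delPerm _ σ (τ s)) (x.2 (σ (τ s))))
    rw [delPerm_mul, F.plus.act_mul])
  ident := (F.ident, fun _ => F.plusUnit)
  comp hn hr i := LinearMap.mk₂ k
    (fun x y => (F.comp hn hr i x.1 y.1, compRestr hn hr i x.1 x.2 y.1 y.2))
    (fun x x' y => Prod.ext (by simp) (funext fun s => by
      simp only [compRestr, Prod.fst_add, Prod.snd_add, Pi.add_apply]
      split_ifs
      · simp
      · rw [← Prod.mk_add_mk, map_add, LinearMap.add_apply]
      · simp))
    (fun c x y => Prod.ext (by simp) (funext fun s => by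
      simp only [compRestr, Prod.smul_fst, Prod.smul_snd, Pi.smul_apply]
      split_ifs
      · simp
      · rw [← Prod.smul_mk, map_smul, LinearMap.smul_apply]
      · simp))
    (fun x y y' => Prod.ext (by simp) (funext fun s => by
      simp only [compRestr, Prod.fst_add, Prod.snd_add, Pi.add_apply]
      split_ifs <;> simp))
    (fun c x y => Prod.ext (by simp) (funext fun s => by
      simp only [compRestr, Prod.smul_fst, Prod.smul_snd, Pi.smul_apply]
      split_ifs <;> simp))
  ident_comp {m q} hn hr i y := Prod.ext (F.ident_comp hn hr i y.1) (funext fun s => by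
    have hs := s.2
    refine (compRestr_inner hn hr i _ _ _ _ s s (by omega) (by omega)).trans ?_
    exact pc_ident _ _ _ _)
  comp_ident {l p} hn hr i x := Prod.ext (F.comp_ident hn hr i x.1) (funext fun s => by
    have hs := s.2
    have hi := i.2
    by_cases h : s = i
    · subst h
      refine (compRestr_inner hn hr s _ _ _ _ s 0 (by simp) (by omega)).trans ?_
      refine (pc_plusUnit _ _ _ _).trans ?_
      exact F.plus.tr_self _
    · have h' : s.1 ≠ i.1 := fun h' => h (Fin.ext h')
      refine (compRestr_outer hn hr i _ _ _ _ s s h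
        ⟨if i.1 < s.1 then i.1 else i.1 - 1, by split_ifs <;> omega⟩
        (by split_ifs <;> omega) rfl (by omega)).trans ?_
      rw [F.comp_ident, F.inPlus_fromPlus (Or.inl (by omega))])
  comp_assoc h₁ g₁ h₂ g₂ h₃ g₃ h₄ g₄ i j e he x y z :=
    Prod.ext (F.comp_assoc h₁ g₁ h₂ g₂ h₃ g₃ h₄ g₄ i j e he x.1 y.1 z.1) (funext fun w =>
      compRestr_assoc h₁ g₁ h₂ g₂ h₃ g₃ h₄ g₄ i j e he x.1 x.2 y.1 y.2 z.1 z.2 w)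
  comp_comm h₁ g₁ h₂ g₂ h₃ g₃ h₄ g₄ i j e e' hij he he' x y z :=
    Prod.ext (F.comp_comm h₁ g₁ h₂ g₂ h₃ g₃ h₄ g₄ i j e e' hij he he' x.1 y.1 z.1)
      (funext fun w =>
        compRestr_comm h₁ g₁ h₂ g₂ h₃ g₃ h₄ g₄ i j e e' hij he he' x.1 x.2 y.1 y.2 z.1 z.2 w)
  comp_act {l m n p q r} hn hr i σ τ x y :=
    Prod.ext (F.comp_act hn hr i σ τ x.1 y.1) (funext fun w =>
      compRestr_act hn hr i (fun s => by have := s.2; omega) (fun s => by have := s.2; omega)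
        (by have := w.2; omega) σ τ x.1 x.2 y.1 y.2 w)

end GradedOperad

namespace GradedOperad

variable {k : Type u} [Field k]

/-! ### The operad of elements with formal differentials -/

/-- The graded operad `F ⊗ k[ε]`, with `ε` of degree `-1` and `ε² = 0`. A derivation of degree `1`
of `F` gives a section of the projection to `F`. -/
def diffOperad (F : GradedOperad k) : GradedOperad k where
  obj l p := F.obj l p × F.obj l (p + 1)
  act σ := (F.act σ).prodMap (F.act σ)
  act_one x := Prod.ext (F.act_one x.1) (F.act_one x.2)
  act_mul σ τ x := Prod.ext (F.act_mul σ τ x.1) (F.act_mul σ τ x.2)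
  ident := (F.ident, 0)
  comp {l m n p q r} hn hr i := LinearMap.mk₂ k
    (fun x y => (F.comp hn hr i x.1 y.1,
      F.comp hn (by omega : p + 1 + q = r + 1) i x.2 y.1
        + p.negOnePow • F.comp hn (by omega : p + (q + 1) = r + 1) i x.1 y.2))
    (fun x x' y => Prod.ext (by simp) (by
      simp only [Prod.fst_add, Prod.snd_add, map_add, LinearMap.add_apply, smul_add]; abel))
    (fun c x y => Prod.ext (by simp) (by
      simp only [Prod.smul_fst, Prod.smul_snd, map_smul, LinearMap.smul_apply, smul_add,
        smul_comm c]))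
    (fun x y y' => Prod.ext (by simp) (by
      simp only [Prod.fst_add, Prod.snd_add, map_add, smul_add]; abel))
    (fun c x y => Prod.ext (by simp) (by
      simp only [Prod.smul_fst, Prod.smul_snd, map_smul, smul_add, smul_comm c]))
  ident_comp hn hr i y := Prod.ext (F.ident_comp hn hr i y.1) (by
    simp only [LinearMap.mk₂_apply, map_zero, LinearMap.zero_apply, Int.negOnePow_zero, one_smul,
      zero_add]
    exact F.ident_comp _ _ _ _)
  comp_ident hn hr i x := Prod.ext (F.comp_ident hn hr i x.1) (by
    simp only [LinearMap.mk₂_apply, map_zero, smul_zero, add_zero]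
    exact F.comp_ident _ _ _ _)
  comp_assoc {l m n a b c p q r s s' t} h₁ g₁ h₂ g₂ h₃ g₃ h₄ g₄ i j e he x y z := by
    refine Prod.ext (F.comp_assoc h₁ g₁ h₂ g₂ h₃ g₃ h₄ g₄ i j e he x.1 y.1 z.1) ?_
    simp only [LinearMap.mk₂_apply, map_add, LinearMap.add_apply, Units.smul_def, map_zsmul,
      LinearMap.smul_apply]
    rw [F.comp_assoc h₁ (by omega : p + 1 + q = s + 1) h₂ _ h₃ g₃ h₄ (by omega) i j e he,
      F.comp_assoc h₁ _ h₂ _ h₃ (by omega : q + 1 + r = s' + 1) h₄ (by omega) i j e he,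
      F.comp_assoc h₁ g₁ h₂ _ h₃ (by omega : q + (r + 1) = s' + 1) h₄ (by omega) i j e he]
    have hs : s.negOnePow = p.negOnePow * q.negOnePow := by rw [← g₁, Int.negOnePow_add]
    rw [hs]
    simp only [smul_add, Units.val_mul, mul_smul, add_assoc]
  comp_comm {l m n a b c p q r s s' t} h₁ g₁ h₂ g₂ h₃ g₃ h₄ g₄ i j e e' hij he he' x y z := by
    refine Prod.ext (F.comp_comm h₁ g₁ h₂ g₂ h₃ g₃ h₄ g₄ i j e e' hij he he' x.1 y.1 z.1) ?_
    simp only [LinearMap.mk₂_apply, map_add, LinearMap.add_apply, Units.smul_def, map_zsmul,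
      LinearMap.smul_apply, Prod.smul_snd]
    rw [F.comp_comm h₁ (by omega : p + 1 + q = s + 1) h₂ _ h₃ (by omega : p + 1 + r = s' + 1) h₄
        (by omega) i j e e' hij he he',
      F.comp_comm h₁ _ h₂ _ h₃ g₃ h₄ (by omega : s' + (q + 1) = t + 1) i j e e' hij he he',
      F.comp_comm h₁ g₁ h₂ _ h₃ (by omega : p + (r + 1) = s' + 1) h₄ (by omega) i j e e' hij he he']
    have hs : s.negOnePow = (p + q).negOnePow := by rw [← g₁]
    have hs' : s'.negOnePow = (p + r).negOnePow := by rw [← g₃]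
    rw [hs, hs', add_mul, mul_add]
    simp only [smul_add, Units.smul_def, smul_smul, ← Units.val_mul, ← Int.negOnePow_add, one_mul,
      mul_one]
    have h1 : (p + q + (q * r + q)).negOnePow = (q * r + p).negOnePow := by
      rw [show p + q + (q * r + q) = q * r + p + 2 * q by ring, Int.negOnePow_add _ (2 * q),
        Int.negOnePow_two_mul, mul_one]
    rw [h1, show p + (q * r + r) = q * r + (p + r) by ring]
    abel
  comp_act hn hr i σ τ x y := by
    refine Prod.ext (F.comp_act hn hr i σ τ x.1 y.1) ?_
    change F.comp _ _ i (F.act σ x.2) (F.act τ y.1)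
      + _ • F.comp _ _ i (F.act σ x.1) (F.act τ y.2) = F.act _ (_ + _)
    rw [F.comp_act, F.comp_act, map_add, map_zsmul_unit]

/-! ### Unital operads from restrictions and differentials -/

/-- Restriction operations `δ_s : F(l) ⟶ (F ⊕ k)(l - 1)` on a graded operad `F`, with the properties
of the partial composition with a unit in arity `0`. -/
structure Restrictions (F : GradedOperad k) where
  δ : ∀ {l : ℕ} {p : ℤ}, Fin l → (F.obj l p →ₗ[k] F.plus.obj (l - 1) p)
  δ_ident : δ 0 F.ident = F.plusUnit
  δ_act : ∀ {l : ℕ} {p : ℤ} (h : l = l - 1 + 1) (σ : Equiv.Perm (Fin l)) (s : Fin l)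
    (x : F.obj l p), δ s (F.act σ x) = F.plus.act (delPerm h σ s) (δ (σ s) x)
  δ_comp : ∀ {l m n : ℕ} {p q r : ℤ} (hn : l + m = n + 1) (hr : p + q = r) (i : Fin l)
    (x : F.obj l p) (y : F.obj m q) (s : Fin n),
      δ s (F.comp hn hr i x y) = compRestr hn hr i x (fun j => δ j x) y (fun j => δ j y) s
  δ_δ : ∀ {l : ℕ} {p : ℤ} (i j : Fin l) (i' j' : Fin (l - 1)), i < j → i'.1 = i.1 →
    j'.1 + 1 = j.1 → ∀ x : F.obj l p, δ i' (F.fromPlus (δ j x)) = δ j' (F.fromPlus (δ i x))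

/-- The unital graded operad `F ⊕ k` given by restriction operations on `F`. -/
noncomputable def Restrictions.unital {F : GradedOperad k} (R : Restrictions F)
    (hF : ∀ p, Subsingleton (F.obj 0 p)) : GradedOperad k where
  toSigmaModule := F.plus
  ident := F.inPlus F.ident
  comp hn hr i := (F.pc hn hr i).comp ((LinearMap.prod LinearMap.id (R.δ i)).comp F.fromPlus)
  ident_comp hn hr i y := by
    obtain rfl := Subsingleton.elim i 0
    change F.pc hn hr 0 (F.ident, R.δ 0 F.ident) y = y
    rw [R.δ_ident]
    exact pc_ident hn hr 0 y
  comp_ident hn hr i x := by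
    have hi := i.2
    change F.pc hn hr i (F.fromPlus x, R.δ i (F.fromPlus x)) (F.inPlus F.ident) = x
    rw [pc_inPlus, F.comp_ident, F.inPlus_fromPlus (Or.inl (by omega))]
  comp_assoc {l m n a b c p q r s s' t} h₁ g₁ h₂ g₂ h₃ g₃ h₄ g₄ i j e he x y z := by
    have hi := i.2
    have hj := j.2
    change F.pc h₂ g₂ e (F.fromPlus (F.pc h₁ g₁ i (F.fromPlus x, R.δ i (F.fromPlus x)) y),
        R.δ e (F.fromPlus (F.pc h₁ g₁ i (F.fromPlus x, R.δ i (F.fromPlus x)) y))) z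
      = F.pc h₄ g₄ i (F.fromPlus x, R.δ i (F.fromPlus x))
        (F.pc h₃ g₃ j (F.fromPlus y, R.δ j (F.fromPlus y)) z)
    rw [fromPlus_pc_of_pos _ _ _ (by omega : m ≠ 0), R.δ_comp,
      compRestr_inner h₁ g₁ i _ _ _ _ e j he (by omega)]
    exact pc_assoc h₁ g₁ h₂ g₂ h₃ g₃ h₄ g₄ (by omega) i j e he (_, _) _ _ z
  comp_comm {l m n a b c p q r s s' t} h₁ g₁ h₂ g₂ h₃ g₃ h₄ g₄ i j e e' hij he he' x y z := by
    have hij' : i.1 < j.1 := hij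
    have hi := i.2
    have hj := j.2
    have hne : j ≠ i := fun h => by rw [h] at hij'; omega
    change F.pc h₂ g₂ e (F.fromPlus (F.pc h₁ g₁ i (F.fromPlus x, R.δ i (F.fromPlus x)) y),
        R.δ e (F.fromPlus (F.pc h₁ g₁ i (F.fromPlus x, R.δ i (F.fromPlus x)) y))) z
      = _ • F.pc h₄ g₄ e' (F.fromPlus (F.pc h₃ g₃ j (F.fromPlus x, R.δ j (F.fromPlus x)) z),
        R.δ e' (F.fromPlus (F.pc h₃ g₃ j (F.fromPlus x, R.δ j (F.fromPlus x)) z))) y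
    generalize F.fromPlus x = x
    by_cases hy : m ≠ 0 ∨ q ≠ 0
    · rw [← F.inPlus_fromPlus hy y]
      generalize F.fromPlus y = y
      rw [pc_inPlus, pc_inPlus, SigmaModule.fromPlus_inPlus, R.δ_comp,
        compRestr_outer h₁ g₁ i _ _ _ _ e j hne ⟨i.1, by omega⟩ (by split_ifs <;> omega)
        (by simp only; split_ifs; rfl) (by omega)]
      exact pc_comm h₁ g₁ h₂ g₂ h₃ g₃ h₄ g₄ (by omega) i j e e' ⟨i.1, by omega⟩ hij he he' rfl
        x _ y z
    · by_cases hz : n ≠ 0 ∨ r ≠ 0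
      · rw [← F.inPlus_fromPlus hz z]
        generalize F.fromPlus z = z
        have he'2 := e'.2
        rw [pc_inPlus, pc_inPlus, SigmaModule.fromPlus_inPlus, R.δ_comp,
          compRestr_outer h₃ g₃ j _ _ _ _ e' i hne.symm ⟨j.1 - 1, by omega⟩
          (by split_ifs; omega) (by simp only; rw [if_neg (by omega)]) (by omega)]
        refine pc_comm' h₁ g₁ h₂ g₂ h₃ g₃ h₄ g₄ (by omega) i j e e' ⟨j.1 - 1, by omega⟩ hij he he'
          ?_ x _ y z
        simp only
        omega
      · obtain ⟨rfl, rfl⟩ : m = 0 ∧ q = 0 := by tauto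
        obtain ⟨rfl, rfl⟩ : n = 0 ∧ r = 0 := by tauto
        obtain rfl : s = p := by omega
        obtain rfl : s' = s := by omega
        obtain rfl : t = s' := by omega
        obtain rfl : a = l - 1 := by omega
        obtain rfl : b = l - 1 := by omega
        obtain rfl : c = l - 1 - 1 := by omega
        simp only [pc_unit _ _ _ hF, SigmaModule.tr_self, map_smul, mul_zero, Int.negOnePow_zero,
          one_smul]
        rw [R.δ_δ i j e' e hij he' (by omega), smul_comm]
  comp_act hn hr i σ τ x y := by
    have hi := i.2
    change F.pc hn hr i (F.act σ (F.fromPlus x), R.δ i (F.act σ (F.fromPlus x))) (F.plus.act τ y)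
      = _
    rw [R.δ_act (by omega), pc_act]
    rfl

/-- A differential of degree `1` on a graded operad `F` which is a derivation. -/
structure Differential (F : GradedOperad k) where
  d : ∀ {l : ℕ} {p : ℤ}, F.obj l p →ₗ[k] F.obj l (p + 1)
  d_d : ∀ {l : ℕ} {p : ℤ} (x : F.obj l p), d (d x) = 0
  d_act : ∀ {l : ℕ} {p : ℤ} (σ : Equiv.Perm (Fin l)) (x : F.obj l p),
    d (F.act σ x) = F.act σ (d x)
  d_comp : ∀ {l m n : ℕ} {p q r : ℤ} (hn : l + m = n + 1) (hr : p + q = r) (i : Fin l)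
    (x : F.obj l p) (y : F.obj m q),
      d (F.comp hn hr i x y)
        = F.comp hn (by omega : p + 1 + q = r + 1) i (d x) y
          + p.negOnePow • F.comp hn (by omega : p + (q + 1) = r + 1) i x (d y)

theorem Differential.d_pc {F : GradedOperad k} (D : Differential F) {l m n : ℕ} {p q r : ℤ}
    (hn : l + m = n + 1) (hr : p + q = r) (i : Fin l) (x : F.obj l p) (ξ : F.plus.obj (l - 1) p)
    (y : F.plus.obj m q) :
    F.inPlus (D.d (F.fromPlus (F.pc hn hr i (x, ξ) y)))
      = F.pc hn (by omega : p + 1 + q = r + 1) i (D.d x, F.inPlus (D.d (F.fromPlus ξ))) y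
        + p.negOnePow • F.pc hn (by omega : p + (q + 1) = r + 1) i (x, ξ)
          (F.inPlus (D.d (F.fromPlus y))) := by
  rw [pc_inPlus, pc_apply, pc_apply]
  simp only [map_add, map_smul, SigmaModule.fromPlus_inPlus, D.d_comp]
  rw [map_zsmul_unit, add_right_comm]
  congr 2
  by_cases h : m ≠ 0 ∨ q ≠ 0
  · simp only [F.coef_eq_zero h, zero_smul]
  · obtain ⟨rfl, rfl⟩ : m = 0 ∧ q = 0 := by tauto
    obtain rfl : p = r := by omega
    obtain rfl : n = l - 1 := by omega
    simp only [SigmaModule.tr_self]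

/-- The unital dg operad `F ⊕ k` given by restriction operations and a differential on `F` which
commute. -/
noncomputable def Restrictions.toDGOperad {F : GradedOperad k} (R : Restrictions F)
    (hF : ∀ p, Subsingleton (F.obj 0 p)) (D : Differential F)
    (h : ∀ {l : ℕ} {p : ℤ} (s : Fin l) (x : F.obj l p),
      R.δ s (D.d x) = F.inPlus (D.d (F.fromPlus (R.δ s x)))) : DGOperad k where
  toGradedOperad := R.unital hF
  d _ _ := F.inPlus.comp (D.d.comp F.fromPlus)
  d_d x := congrArg F.inPlus (D.d_d (F.fromPlus x))
  d_act σ x := congrArg F.inPlus (D.d_act σ (F.fromPlus x))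
  d_comp hn hr i x y := by
    have e := D.d_pc hn hr i (F.fromPlus x) (R.δ i (F.fromPlus x)) y
    rw [← h] at e
    exact e

end GradedOperad

namespace GradedOperad

variable {k : Type u} [Field k]

/-! ### Restrictions along an element of arity zero -/

/-- The restriction `x ∘_s u` along an element `u` of arity `0`. -/
def res (G : GradedOperad k) (u : G.obj 0 0) {l : ℕ} {p : ℤ} (s : Fin l) :
    G.obj l p →ₗ[k] G.obj (l - 1) p :=
  (G.comp (by have := s.2; omega : l + 0 = l - 1 + 1) (add_zero p) s).flip u

section res

variable (G : GradedOperad k) (u : G.obj 0 0)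

theorem res_apply {l : ℕ} {p : ℤ} (s : Fin l) (h : l + 0 = l - 1 + 1) (x : G.obj l p) :
    G.res u s x = G.comp h (add_zero p) s x u := rfl

theorem res_act {l : ℕ} {p : ℤ} (h : l = l - 1 + 1) (σ : Equiv.Perm (Fin l)) (s : Fin l)
    (x : G.obj l p) : G.res u s (G.act σ x) = G.act (delPerm h σ s) (G.res u (σ s) x) := by
  have e := G.comp_act (by omega : l + 0 = l - 1 + 1) (add_zero p) s σ 1 x u
  rwa [G.act_one] at e

theorem res_comp_inner {l m n : ℕ} {p q r : ℤ} (hn : l + m = n + 1) (hr : p + q = r) (i : Fin l)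
    (x : G.obj l p) (y : G.obj m q) (s : Fin n) (t : Fin m) (h : s.1 = i.1 + t.1)
    (h' : l + (m - 1) = n - 1 + 1) :
    G.res u s (G.comp hn hr i x y) = G.comp h' hr i x (G.res u t y) :=
  G.comp_assoc hn hr _ (add_zero r) _ (add_zero q) h' hr i t s h x y u

theorem res_comp_outer {l m n : ℕ} {p q r : ℤ} (hn : l + m = n + 1) (hr : p + q = r) (i : Fin l)
    (x : G.obj l p) (y : G.obj m q) (s : Fin n) (j : Fin l) (hj : j ≠ i) (i' : Fin (l - 1))
    (hs : s.1 = if j.1 < i.1 then j.1 else j.1 + m - 1)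
    (hi' : i'.1 = if i.1 < j.1 then i.1 else i.1 - 1)
    (h' : l - 1 + m = n - 1 + 1) :
    G.res u s (G.comp hn hr i x y) = G.comp h' hr i' (G.res u j x) y := by
  have hne : j.1 ≠ i.1 := fun h => hj (Fin.ext h)
  have hs2 := s.2
  have hj2 := j.2
  by_cases hij : i.1 < j.1
  · rw [if_neg (by omega)] at hs
    rw [if_pos hij] at hi'
    have e := G.comp_comm hn hr (by omega : n + 0 = n - 1 + 1) (add_zero r)
      (by omega : l + 0 = l - 1 + 1) (add_zero p) h' hr i j s i' hij (by omega) hi' x y u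
    rwa [mul_zero, Int.negOnePow_zero, one_smul] at e
  · rw [if_pos (by omega)] at hs
    rw [if_neg hij] at hi'
    have e := G.comp_comm (by omega : l + 0 = l - 1 + 1) (add_zero p) h' hr hn hr
      (by omega : n + 0 = n - 1 + 1) (add_zero r) j i i' s (by change j.1 < i.1; omega) (by omega)
      hs x u y
    rw [zero_mul, Int.negOnePow_zero, one_smul] at e
    exact e.symm

theorem res_res {l : ℕ} {p : ℤ} (i j : Fin l) (i' j' : Fin (l - 1)) (hij : i < j)
    (hi' : i'.1 = i.1) (hj' : j'.1 + 1 = j.1) (x : G.obj l p) :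
    G.res u i' (G.res u j x) = G.res u j' (G.res u i x) := by
  have hij' : i.1 < j.1 := hij
  have hj := j.2
  have e := G.comp_comm (by omega : l + 0 = l - 1 + 1) (add_zero p)
    (by omega : l - 1 + 0 = l - 1 - 1 + 1) (add_zero p) (by omega : l + 0 = l - 1 + 1) (add_zero p)
    (by omega : l - 1 + 0 = l - 1 - 1 + 1) (add_zero p) i j j' i' hij (by omega) hi' x u u
  rw [mul_zero, Int.negOnePow_zero, one_smul] at e
  exact e.symm

end res

/-! ### Restriction operations on free operads -/

section sections

variable {F : GradedOperad k}

theorem compRestr_inner_inner_swap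
    (R : ∀ {l : ℕ} {p : ℤ}, Fin l → (F.obj l p →ₗ[k] F.plus.obj (l - 1) p))
    (hc : ∀ {l m n : ℕ} {p q r : ℤ} (hn : l + m = n + 1) (hr : p + q = r) (i : Fin l)
      (x : F.obj l p) (y : F.obj m q) (s : Fin n),
      R s (F.comp hn hr i x y) = compRestr hn hr i x (fun j => R j x) y (fun j => R j y) s)
    {l m n : ℕ} {p q r : ℤ} (hn : l + m = n + 1) (hr : p + q = r) (i : Fin l)
    (x : F.obj l p) (y : F.obj m q) (s : Fin n) (t : Fin m) (s' : Fin (n - 1)) (t' : Fin (m - 1))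
    (hs : s.1 = i.1 + t.1) (hs' : s'.1 = i.1 + t'.1) :
    R s' (F.fromPlus (R s (F.comp hn hr i x y)))
      = F.pc (by have := t'.2; omega : l + (m - 1 - 1) = n - 1 - 1 + 1) hr i (x, R i x)
          (R t' (F.fromPlus (R t y))) := by
  have ht' := t'.2
  rw [hc, compRestr_inner hn hr i _ _ _ _ s t hs (by omega),
    fromPlus_pc_of_pos _ _ _ (by omega : m - 1 ≠ 0), hc,
    compRestr_inner _ hr i _ _ _ _ s' t' hs' (by omega)]

/-- The operations `R` commute on composites `x ∘_i y` if they commute on `x` and on `y`. -/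
theorem restr_comm_comp (R : ∀ {l : ℕ} {p : ℤ}, Fin l → (F.obj l p →ₗ[k] F.plus.obj (l - 1) p))
    (hF : ∀ p, Subsingleton (F.obj 0 p))
    (hc : ∀ {l m n : ℕ} {p q r : ℤ} (hn : l + m = n + 1) (hr : p + q = r) (i : Fin l)
      (x : F.obj l p) (y : F.obj m q) (s : Fin n),
      R s (F.comp hn hr i x y) = compRestr hn hr i x (fun j => R j x) y (fun j => R j y) s)
    {l m n : ℕ} {p q r : ℤ} (hn : l + m = n + 1) (hr : p + q = r) (i : Fin l)
    (x : F.obj l p) (y : F.obj m q)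
    (hx : ∀ (i j : Fin l) (i' j' : Fin (l - 1)), i < j → i'.1 = i.1 →
      j'.1 + 1 = j.1 → R i' (F.fromPlus (R j x)) = R j' (F.fromPlus (R i x)))
    (hy : ∀ (i j : Fin m) (i' j' : Fin (m - 1)), i < j → i'.1 = i.1 →
      j'.1 + 1 = j.1 → R i' (F.fromPlus (R j y)) = R j' (F.fromPlus (R i y)))
    (v w : Fin n) (v' w' : Fin (n - 1)) (hvw : v < w) (hv' : v'.1 = v.1) (hw' : w'.1 + 1 = w.1) :
    R v' (F.fromPlus (R w (F.comp hn hr i x y))) =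
      R w' (F.fromPlus (R v (F.comp hn hr i x y))) := by
  have hvw' : v.1 < w.1 := hvw
  have hi := i.2
  have hw2 := w.2
  have hv2 := v'.2
  -- One of the deleted inputs belongs to `x` and the other one to `y`.
  have mixed : ∀ (a b : Fin n) (a' b' : Fin (n - 1)) (o : Fin l) (t : Fin m), o ≠ i →
      a.1 = (if o.1 < i.1 then o.1 else o.1 + m - 1) → b.1 = i.1 + t.1 →
      a'.1 = (if o.1 < i.1 then o.1 else o.1 + (m - 1) - 1) →
      b'.1 = (if o.1 < i.1 then i.1 - 1 else i.1) + t.1 →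
      R a' (F.fromPlus (R b (F.comp hn hr i x y)))
        = R b' (F.fromPlus (R a (F.comp hn hr i x y))) := by
    intro a b a' b' o t ho ha hb ha' hb'
    have hoi : o.1 ≠ i.1 := fun h => ho (Fin.ext h)
    have ho2 := o.2
    have ht2 := t.2
    have ha2 := a'.2
    have hi'2 : (if i.1 < o.1 then i.1 else i.1 - 1) < l - 1 := by split_ifs <;> omega
    rw [hc, compRestr_inner hn hr i _ _ _ _ b t hb (by omega), hc,
      compRestr_outer hn hr i _ _ _ _ a o ho ⟨_, hi'2⟩ ha rfl (by omega),
      SigmaModule.fromPlus_inPlus, hc, compRestr_inner _ hr ⟨_, hi'2⟩ _ _ _ _ b' t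
        (by rw [hb']; simp only; split_ifs <;> omega) (by omega)]
    by_cases hm : m - 1 = 0
    · obtain rfl : m = 1 := by omega
      have h1 : F.fromPlus (R t y) = 0 := (hF q).elim _ _
      have h2 : F.coef (R t y) ≠ 0 → q = 0 := fun h => by
        by_contra hq
        exact h (F.coef_eq_zero (Or.inr hq) _)
      rw [pc_apply, pc_apply, h1, map_zero, map_zero, map_zero, map_zero, zero_add, zero_add,
        map_smul, map_smul]
      by_cases h3 : F.coef (R t y) = 0
      · rw [h3, zero_smul, zero_smul]
      · obtain rfl := h2 h3
        obtain rfl : r = p := by omega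
        obtain rfl : n = l := by omega
        congr 1
        rw [SigmaModule.tr_self, SigmaModule.tr_self]
        have ho'2 : (if o.1 < i.1 then o.1 else o.1 - 1) < n - 1 := by split_ifs <;> omega
        rcases Nat.lt_or_gt_of_ne hoi with h | h
        · rw [if_pos h] at ha'
          exact hx o i _ _ h ha' (by simp only; rw [if_neg (by omega)]; omega)
        · rw [if_neg (by omega)] at ha'
          exact (hx i o _ _ h (by simp only; rw [if_pos h]) (by omega)).symm
    · rw [fromPlus_pc_of_pos _ _ _ hm, hc, pc_of_pos _ _ _ hm]
      exact compRestr_outer _ hr i _ _ _ _ a' o ho ⟨_, hi'2⟩ ha' rfl (by omega)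
  rcases eq_outerPos_or_innerPos hn i v with ⟨⟨o, ho⟩, hvo⟩ | ⟨t, hvt⟩
  · have hoi : o.1 ≠ i.1 := fun h => ho (Fin.ext h)
    have ho2 := o.2
    have hvo : v.1 = if o.1 < i.1 then o.1 else o.1 + m - 1 := congrArg Fin.val hvo
    rcases eq_outerPos_or_innerPos hn i w with ⟨⟨o', ho'⟩, hwo⟩ | ⟨t', hwt⟩
    · have hoi' : o'.1 ≠ i.1 := fun h => ho' (Fin.ext h)
      have ho2' := o'.2
      have hwo : w.1 = if o'.1 < i.1 then o'.1 else o'.1 + m - 1 := congrArg Fin.val hwo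
      have hoo : o.1 < o'.1 := by
        split_ifs at hvo hwo <;> omega
      have h1 : (if i.1 < o.1 then i.1 else i.1 - 1) < l - 1 := by split_ifs <;> omega
      have h2 : (if i.1 < o'.1 then i.1 else i.1 - 1) < l - 1 := by split_ifs <;> omega
      have h3 : (if i.1 < o.1 then i.1 else if i.1 < o'.1 then i.1 - 1 else i.1 - 2)
          < l - 1 - 1 := by
        split_ifs <;> omega
      rw [hc, compRestr_outer hn hr i _ _ _ _ w o' ho' ⟨_, h2⟩ hwo rfl (by omega), hc,
        compRestr_outer hn hr i _ _ _ _ v o ho ⟨_, h1⟩ hvo rfl (by omega),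
        SigmaModule.fromPlus_inPlus, SigmaModule.fromPlus_inPlus, hc, hc,
        compRestr_outer (l := l - 1) (n := n - 1) _ hr ⟨_, h2⟩ _ _ _ _ v' ⟨o.1, by omega⟩
          (fun h => by
            have := congrArg Fin.val h
            simp only at this
            split_ifs at this <;> omega)
          ⟨_, h3⟩ (by rw [hv', hvo]; simp only; split_ifs <;> omega)
          (by simp only; split_ifs <;> omega) (by omega),
        compRestr_outer (l := l - 1) (n := n - 1) _ hr ⟨_, h1⟩ _ _ _ _ w' ⟨o'.1 - 1, by omega⟩
          (fun h => by
            have := congrArg Fin.val h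
            simp only at this
            split_ifs at this <;> omega)
          ⟨_, h3⟩ (by simp only; split_ifs at hwo ⊢ <;> omega)
          (by simp only; split_ifs <;> omega) (by omega),
        hx o o' ⟨o.1, by omega⟩ ⟨o'.1 - 1, by omega⟩ hoo rfl (by simp only; omega)]
    · have hwt : w.1 = i.1 + t'.1 := congrArg Fin.val hwt
      have ht2 := t'.2
      have hoi2 : o.1 < i.1 := by
        split_ifs at hvo <;> omega
      rw [if_pos hoi2] at hvo
      refine mixed v w v' w' o t' ho ?_ hwt ?_ ?_
      all_goals rw [if_pos hoi2]; omega
  · have hvt : v.1 = i.1 + t.1 := congrArg Fin.val hvt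
    have ht2 := t.2
    rcases eq_outerPos_or_innerPos hn i w with ⟨⟨o', ho'⟩, hwo⟩ | ⟨t', hwt⟩
    · have hoi' : o'.1 ≠ i.1 := fun h => ho' (Fin.ext h)
      have ho2' := o'.2
      have hwo : w.1 = if o'.1 < i.1 then o'.1 else o'.1 + m - 1 := congrArg Fin.val hwo
      have hoi2 : ¬ o'.1 < i.1 := by
        intro h
        rw [if_pos h] at hwo
        omega
      rw [if_neg hoi2] at hwo
      refine (mixed w v w' v' o' t ho' ?_ hvt ?_ ?_).symm
      all_goals rw [if_neg hoi2]; omega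
    · have hwt : w.1 = i.1 + t'.1 := congrArg Fin.val hwt
      have ht2' := t'.2
      rw [compRestr_inner_inner_swap R hc hn hr i x y w t' v' ⟨t.1, by omega⟩ hwt
          (by simp only; omega),
        compRestr_inner_inner_swap R hc hn hr i x y v t w' ⟨t'.1 - 1, by omega⟩ hvt
          (by simp only; omega),
        hy t t' ⟨t.1, by omega⟩ ⟨t'.1 - 1, by omega⟩ (by change t.1 < t'.1; omega) rfl
          (by simp only; omega)]

/-- The operations `R` commute on `x · σ` if they commute on `x`. -/
theorem restr_comm_act (R : ∀ {l : ℕ} {p : ℤ}, Fin l → (F.obj l p →ₗ[k] F.plus.obj (l - 1) p))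
    (ha : ∀ {l : ℕ} {p : ℤ} (h : l = l - 1 + 1) (σ : Equiv.Perm (Fin l)) (s : Fin l)
      (x : F.obj l p), R s (F.act σ x) = F.plus.act (delPerm h σ s) (R (σ s) x))
    {l : ℕ} {p : ℤ} (σ : Equiv.Perm (Fin l)) (x : F.obj l p)
    (hx : ∀ (i j : Fin l) (i' j' : Fin (l - 1)), i < j → i'.1 = i.1 →
      j'.1 + 1 = j.1 → R i' (F.fromPlus (R j x)) = R j' (F.fromPlus (R i x)))
    (i j : Fin l) (i' j' : Fin (l - 1)) (hij : i < j) (hi' : i'.1 = i.1) (hj' : j'.1 + 1 = j.1) :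
    R i' (F.fromPlus (R j (F.act σ x))) = R j' (F.fromPlus (R i (F.act σ x))) := by
  have hij' : i.1 < j.1 := hij
  have hj2 := j.2
  have hne : i ≠ j := fun h => by rw [h] at hij'; omega
  have hσ : (σ i).1 ≠ (σ j).1 := fun h => hne (σ.injective (Fin.ext h))
  have h1 : l = l - 1 + 1 := by omega
  have h2 : l - 1 = l - 1 - 1 + 1 := by omega
  have d1 := delPerm_val h1 σ j i hne i' (by split_ifs <;> omega)
  have d2 := delPerm_val h1 σ i j hne.symm j' (by split_ifs <;> omega)
  have hdel : delPerm h2 (delPerm h1 σ j) i' = delPerm h2 (delPerm h1 σ i) j' :=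
    delPerm_blockPerm_outer (m := 0) h1 h1 h2 h2 j i hne j' i' (by split_ifs <;> omega)
      (by split_ifs <;> omega) σ 1
  rw [ha h1, SigmaModule.fromPlus_act, ha h2, ha h1, SigmaModule.fromPlus_act, ha h2, hdel]
  congr 1
  rcases Nat.lt_or_gt_of_ne hσ with h | h
  · rw [if_pos h] at d1
    rw [if_neg (by omega)] at d2
    exact hx (σ i) (σ j) _ _ h d1 (by omega)
  · rw [if_neg (by omega)] at d1
    rw [if_pos h] at d2
    exact (hx (σ j) (σ i) _ _ h d2 (by omega)).symm

end sections

end GradedOperad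

namespace GradedOperad

variable {k : Type u} [Field k]

theorem IsFree.of_iso {M : SigmaModule k} {F G : GradedOperad k}
    {i : SigmaModule.Hom M F.toSigmaModule} (h : IsFree M F i)
    (j : SigmaModule.Hom M G.toSigmaModule) (a : Hom F G) (b : Hom G F)
    (hab : ∀ l p (x : G.obj l p), a.map l p (b.map l p x) = x)
    (hba : ∀ l p (x : F.obj l p), b.map l p (a.map l p x) = x)
    (hj : ∀ l p (x : M.obj l p), a.map l p (i.map l p x) = j.map l p x) : IsFree M G j := by
  intro R f
  refine ⟨(h.lift f).comp b, fun l p x => ?_, fun ψ hψ => ?_⟩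
  · change (h.lift f).map l p (b.map l p (j.map l p x)) = _
    rw [← hj, hba, h.lift_gen]
  · have e : ψ.comp a = h.lift f := h.hom_ext fun l p x => by
      change ψ.map l p (a.map l p (i.map l p x)) = _
      rw [hj, hψ, h.lift_gen]
    ext l p x
    change _ = (h.lift f).map l p (b.map l p x)
    rw [← e]
    change _ = ψ.map l p (a.map l p (b.map l p x))
    rw [hab]

end GradedOperad

namespace DGOperad

variable {k : Type u} [Field k]

/-! ### Attaching generators to a unital dg operad -/

/-- The data that define a unitary principal extension of `Q` by a graded `Σ`-module `E`
concentrated in arity `m + 1`. -/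
structure CellData (Q : DGOperad k) (u : Q.obj 0 0) (m : ℕ) where
  one_le : 1 ≤ m
  isUnitary : Q.IsUnitary u
  M : SigmaModule k
  M_trivial : ∀ l : ℕ, l ≤ 1 → ∀ p : ℤ, Subsingleton (M.obj l p)
  inclM : SigmaModule.Hom M Q.gradedTrunc.toSigmaModule
  free : GradedOperad.IsFree M Q.gradedTrunc inclM
  E : SigmaModule k
  E_homogeneous : ∀ l : ℕ, l ≠ m + 1 → ∀ p : ℤ, Subsingleton (E.obj l p)
  dE : ∀ {l : ℕ} {p : ℤ}, E.obj l p →ₗ[k] Q.obj l (p + 1)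
  dE_act : ∀ {l : ℕ} {p : ℤ} (σ : Equiv.Perm (Fin l)) (e : E.obj l p),
    dE (E.act σ e) = Q.act σ (dE e)
  dE_cocycle : ∀ {l : ℕ} {p : ℤ} (e : E.obj l p), Q.d l (p + 1) (dE e) = 0
  δ : ∀ {l : ℕ} {p : ℤ}, Fin l → (E.obj l p →ₗ[k] Q.obj (l - 1) p)
  δ_act : ∀ {l : ℕ} {p : ℤ} (h : l = l - 1 + 1) (σ : Equiv.Perm (Fin l)) (s : Fin l)
    (e : E.obj l p), δ s (E.act σ e) = Q.act (delPerm h σ s) (δ (σ s) e)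
  δ_δ : ∀ {l : ℕ} {p : ℤ} (i j : Fin l) (i' j' : Fin (l - 1)), i < j → i'.1 = i.1 →
    j'.1 + 1 = j.1 → ∀ e : E.obj l p, Q.res u i' (δ j e) = Q.res u j' (δ i e)
  δ_dE : ∀ {l : ℕ} {p : ℤ} (s : Fin l) (e : E.obj l p),
    Q.d (l - 1) p (δ s e) = Q.res u s (dE e)

section unital

variable (Q : DGOperad k)

/-- The projection of `Q` onto its truncation. -/
noncomputable def toTrunc {l : ℕ} {p : ℤ} : Q.obj l p →ₗ[k] Q.gradedTrunc.obj l p :=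
  if h : l = 0 then 0 else
    { toFun := fun x => ⟨x, fun h' => absurd h' h⟩
      map_add' := fun _ _ => rfl
      map_smul' := fun _ _ => rfl }

theorem toTrunc_val {l : ℕ} {p : ℤ} (h : l ≠ 0) (x : Q.obj l p) : (Q.toTrunc x).1 = x := by
  have e : Q.toTrunc (l := l) (p := p) = _ := dif_neg h
  rw [e]
  rfl

theorem subsingleton_gradedTrunc_zero (p : ℤ) : Subsingleton (Q.gradedTrunc.obj 0 p) :=
  ⟨fun x y => Subtype.ext ((x.2 rfl).trans (y.2 rfl).symm)⟩

theorem toTrunc_mk {l : ℕ} {p : ℤ} (x : Q.gradedTrunc.obj l p) : Q.toTrunc x.1 = x := by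
  by_cases h : l = 0
  · subst h
    exact (Q.subsingleton_gradedTrunc_zero p).elim _ _
  · exact Subtype.ext (Q.toTrunc_val h _)

theorem toTrunc_act {l : ℕ} {p : ℤ} (σ : Equiv.Perm (Fin l)) (x : Q.obj l p) :
    Q.toTrunc (Q.act σ x) = Q.gradedTrunc.act σ (Q.toTrunc x) := by
  by_cases h : l = 0
  · subst h
    exact (Q.subsingleton_gradedTrunc_zero p).elim _ _
  · refine Subtype.ext ?_
    rw [Q.toTrunc_val h]
    exact congrArg (Q.act σ) (Q.toTrunc_val h x).symm

theorem toTrunc_comp {l m n : ℕ} {p q r : ℤ} (hn : l + m = n + 1) (hr : p + q = r) (i : Fin l)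
    (hm : m ≠ 0) (x : Q.obj l p) (y : Q.obj m q) :
    Q.toTrunc (Q.comp hn hr i x y)
      = Q.gradedTrunc.comp hn hr i (Q.toTrunc x) (Q.toTrunc y) := by
  have hi := i.2
  refine Subtype.ext ?_
  rw [Q.toTrunc_val (by omega)]
  refine Eq.trans ?_ (congrArg₂ (fun a b => Q.comp hn hr i a b) (Q.toTrunc_val (by omega) x).symm
    (Q.toTrunc_val hm y).symm)
  rfl

theorem toTrunc_ident : Q.toTrunc Q.ident = Q.gradedTrunc.ident :=
  Subtype.ext (Q.toTrunc_val one_ne_zero _)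

variable {Q} {u : Q.obj 0 0}

/-- The coefficient of an element of arity `0` with respect to the unit. -/
noncomputable def coefUnit (hu : Q.IsUnitary u) : Q.obj 0 0 →ₗ[k] k :=
  ((LinearEquiv.ofBijective (LinearMap.toSpanSingleton k (Q.obj 0 0) u) hu.1).symm :
    Q.obj 0 0 →ₗ[k] k)

theorem coefUnit_smul (hu : Q.IsUnitary u) (c : k) : coefUnit hu (c • u) = c :=
  (LinearEquiv.ofBijective (LinearMap.toSpanSingleton k (Q.obj 0 0) u) hu.1).symm_apply_apply c

theorem coefUnit_self (hu : Q.IsUnitary u) : coefUnit hu u = 1 := by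
  have h := coefUnit_smul hu 1
  rwa [one_smul] at h

theorem smul_coefUnit (hu : Q.IsUnitary u) (x : Q.obj 0 0) : coefUnit hu x • u = x :=
  (LinearEquiv.ofBijective (LinearMap.toSpanSingleton k (Q.obj 0 0) u) hu.1).apply_symm_apply x

theorem IsUnitary.d_eq_zero (hu : Q.IsUnitary u) {p : ℤ} (x : Q.obj 0 p) : Q.d 0 p x = 0 := by
  by_cases hp : p = 0
  · subst hp
    exact (hu.2 _ one_ne_zero).elim _ _
  · rw [(hu.2 p hp).elim x 0, map_zero]

theorem IsUnitary.d_res (hu : Q.IsUnitary u) {l : ℕ} {p : ℤ} (s : Fin l) (x : Q.obj l p) :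
    Q.d (l - 1) p (Q.res u s x) = Q.res u s (Q.d l p x) := by
  have hs := s.2
  rw [Q.res_apply u s (by omega), Q.res_apply u s (by omega), Q.d_comp, hu.d_eq_zero, map_zero,
    smul_zero, add_zero]

end unital

/-! ### The underlying graded operad of the extension and its restrictions -/

namespace CellData

variable {Q : DGOperad k} {u : Q.obj 0 0} {m : ℕ} (C : CellData Q u m)

/-- The free graded operad on the old and the new generators. -/
abbrev freeOperad : GradedOperad k := GradedOperad.free (C.M.sum C.E)

/-- The generators of the free operad. -/
abbrev gen {l : ℕ} {p : ℤ} (x : C.M.obj l p) (e : C.E.obj l p) : C.freeOperad.obj l p :=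
  (GradedOperad.freeGen (C.M.sum C.E)).map l p (x, e)

/-- The inclusion of the truncation of `Q` in the free operad. -/
noncomputable def inclTrunc : GradedOperad.Hom Q.gradedTrunc C.freeOperad :=
  C.free.lift
    { map := fun l p => ((GradedOperad.freeGen (C.M.sum C.E)).map l p).comp (LinearMap.inl k _ _)
      map_act := fun {l p} σ x => by
        refine Eq.trans ?_ ((GradedOperad.freeGen (C.M.sum C.E)).map_act σ (x, 0))
        change C.gen _ _ = C.gen (C.M.act σ x) (C.E.act σ 0)
        rw [map_zero]
        rfl }

theorem inclTrunc_gen {l : ℕ} {p : ℤ} (x : C.M.obj l p) :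
    C.inclTrunc.map l p (C.inclM.map l p x) = C.gen x 0 :=
  C.free.lift_gen _ x

/-- The inclusion of `Q` in the free operad with a unit. -/
noncomputable def inclPlus {l : ℕ} {p : ℤ} : Q.obj l p →ₗ[k] C.freeOperad.plus.obj l p :=
  C.freeOperad.inPlus.comp ((C.inclTrunc.map l p).comp Q.toTrunc)
    + (LinearMap.toSpanSingleton k _ (C.freeOperad.plus.tr C.freeOperad.plusUnit)).comp
      ((coefUnit C.isUnitary).comp Q.tr)

end CellData

end DGOperad

namespace SigmaModule

variable {k : Type u} [Field k]

theorem tr_of_ne (M : SigmaModule k) {l l' : ℕ} {p p' : ℤ} (h : ¬(l = l' ∧ p = p'))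
    (x : M.obj l p) : (M.tr x : M.obj l' p') = 0 := by
  rw [tr, dif_neg h]
  rfl

theorem fromPlus_tr_plusUnit (M : SigmaModule k) {l : ℕ} {p : ℤ} :
    M.fromPlus (M.plus.tr M.plusUnit : M.plus.obj l p) = 0 := by
  by_cases h : 0 = l ∧ 0 = p
  · obtain ⟨rfl, rfl⟩ := h
    rw [tr_self]
    rfl
  · rw [tr_of_ne _ h, map_zero]

end SigmaModule

namespace DGOperad

variable {k : Type u} [Field k]

namespace CellData

variable {Q : DGOperad k} {u : Q.obj 0 0} {m : ℕ} (C : CellData Q u m)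

theorem inclPlus_apply {l : ℕ} {p : ℤ} (x : Q.obj l p) :
    C.inclPlus x = C.freeOperad.inPlus (C.inclTrunc.map l p (Q.toTrunc x))
      + coefUnit C.isUnitary (Q.tr x) • C.freeOperad.plus.tr C.freeOperad.plusUnit := rfl

theorem fromPlus_inclPlus {l : ℕ} {p : ℤ} (x : Q.obj l p) :
    C.freeOperad.fromPlus (C.inclPlus x) = C.inclTrunc.map l p (Q.toTrunc x) := by
  rw [inclPlus_apply, map_add, map_smul, SigmaModule.fromPlus_tr_plusUnit, smul_zero, add_zero]
  rfl

theorem inclPlus_of_pos {l : ℕ} {p : ℤ} (h : l ≠ 0) (x : Q.obj l p) :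
    C.inclPlus x = C.freeOperad.inPlus (C.inclTrunc.map l p (Q.toTrunc x)) := by
  rw [inclPlus_apply, Q.tr_of_ne (fun h' => h h'.1), map_zero, zero_smul, add_zero]

theorem inclPlus_mk {l : ℕ} {p : ℤ} (h : l ≠ 0) (x : Q.gradedTrunc.obj l p) :
    C.inclPlus x.1 = C.freeOperad.inPlus (C.inclTrunc.map l p x) := by
  rw [C.inclPlus_of_pos h, Q.toTrunc_mk]

theorem inclPlus_unit : C.inclPlus u = C.freeOperad.plusUnit := by
  rw [inclPlus_apply, (Q.subsingleton_gradedTrunc_zero 0).elim (Q.toTrunc u) 0, map_zero, map_zero,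
    zero_add, SigmaModule.tr_self, SigmaModule.tr_self, coefUnit_self, one_smul]

theorem inclPlus_act {l : ℕ} {p : ℤ} (σ : Equiv.Perm (Fin l)) (x : Q.obj l p) :
    C.inclPlus (Q.act σ x) = C.freeOperad.plus.act σ (C.inclPlus x) := by
  by_cases h : l = 0
  · subst h
    rw [Subsingleton.elim σ 1, Q.act_one, SigmaModule.act_one]
  · rw [C.inclPlus_of_pos h, C.inclPlus_of_pos h, ← SigmaModule.inPlus_act, toTrunc_act]
    exact congrArg _ (C.inclTrunc.map_act σ _)

theorem inclPlus_comp {l m n : ℕ} {p q r : ℤ} (hn : l + m = n + 1) (hr : p + q = r) (i : Fin l)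
    (x : Q.obj l p) (y : Q.obj m q) :
    C.inclPlus (Q.comp hn hr i x y)
      = C.freeOperad.pc hn hr i
        (C.inclTrunc.map l p (Q.toTrunc x), C.inclPlus (Q.res u i x)) (C.inclPlus y) := by
  have hi := i.2
  by_cases hm : m = 0
  · subst hm
    by_cases hq : q = 0
    · subst hq
      obtain rfl : p = r := by omega
      obtain rfl : n = l - 1 := by omega
      rw [← smul_coefUnit C.isUnitary y, map_smul, map_smul, map_smul, map_smul, inclPlus_unit,
        GradedOperad.pc_plusUnit, SigmaModule.tr_self]
      rfl
    · rw [(C.isUnitary.2 q hq).elim y 0]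
      simp only [map_zero]
  · rw [C.inclPlus_of_pos hm y, GradedOperad.pc_inPlus, C.inclPlus_of_pos (by omega),
      toTrunc_comp _ _ _ _ hm]
    exact congrArg _ (C.inclTrunc.map_comp hn hr i _ _)

theorem subsingleton_sum_zero (p : ℤ) : Subsingleton ((C.M.sum C.E).obj 0 p) := by
  have := C.M_trivial 0 (by omega) p
  have := C.E_homogeneous 0 (by omega) p
  exact inferInstanceAs (Subsingleton (C.M.obj 0 p × C.E.obj 0 p))

/-- The generators with their restrictions. -/
noncomputable def genRestr :
    SigmaModule.Hom (C.M.sum C.E) C.freeOperad.restrOperad.toSigmaModule where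
  map l p := LinearMap.prod ((GradedOperad.freeGen (C.M.sum C.E)).map l p)
    (LinearMap.pi fun s =>
      (C.inclPlus.comp ((Q.res u s).comp ((Submodule.subtype _).comp
        ((C.inclM.map l p).comp (LinearMap.fst k _ _)))))
      + (C.inclPlus.comp ((C.δ s).comp (LinearMap.snd k _ _))))
  map_act {l p} σ x := by
    refine Prod.ext ((GradedOperad.freeGen (C.M.sum C.E)).map_act σ x) (funext fun s => ?_)
    have hs := s.2
    change C.inclPlus (Q.res u s (C.inclM.map l p (C.M.act σ x.1)).1)
        + C.inclPlus (C.δ s (C.E.act σ x.2))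
      = C.freeOperad.plus.act (delPerm (by omega) σ s)
        (C.inclPlus (Q.res u (σ s) (C.inclM.map l p x.1).1) + C.inclPlus (C.δ (σ s) x.2))
    rw [C.inclM.map_act, C.δ_act (by omega), map_add, ← C.inclPlus_act, ← C.inclPlus_act,
      ← Q.res_act u]
    rfl

/-- The free operad with the restrictions of its elements, as a section of `restrOperad`. -/
noncomputable def restrSection : GradedOperad.Hom C.freeOperad C.freeOperad.restrOperad :=
  (GradedOperad.isFree_free _).lift C.genRestr

/-- The projection of `restrOperad`. -/
def _root_.GradedOperad.restrOperadFst (F : GradedOperad k) :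
    GradedOperad.Hom F.restrOperad F where
  map _ _ := LinearMap.fst k _ _
  map_act _ _ := rfl
  map_ident := rfl
  map_comp _ _ _ _ _ := rfl

theorem restrSection_gen {l : ℕ} {p : ℤ} (x : C.M.obj l p) (e : C.E.obj l p) :
    C.restrSection.map l p (C.gen x e) = (C.gen x e, fun s =>
      C.inclPlus (Q.res u s (C.inclM.map l p x).1) + C.inclPlus (C.δ s e)) :=
  (GradedOperad.isFree_free (C.M.sum C.E)).lift_gen C.genRestr
    (show (C.M.sum C.E).obj l p from (x, e))

theorem restrSection_fst {l : ℕ} {p : ℤ} (x : C.freeOperad.obj l p) :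
    (C.restrSection.map l p x).1 = x := by
  have h : C.freeOperad.restrOperadFst.comp C.restrSection = GradedOperad.Hom.id _ :=
    (GradedOperad.isFree_free _).hom_ext fun l p x =>
      congrArg Prod.fst (C.restrSection_gen x.1 x.2)
  exact congrArg (fun f : GradedOperad.Hom C.freeOperad C.freeOperad => f.map l p x) h

/-- The restriction operations of the free operad. -/
noncomputable def rδ {l : ℕ} {p : ℤ} (s : Fin l) :
    C.freeOperad.obj l p →ₗ[k] C.freeOperad.plus.obj (l - 1) p :=
  (LinearMap.proj s).comp ((LinearMap.snd k _ _).comp (C.restrSection.map l p))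

theorem restrSection_eq {l : ℕ} {p : ℤ} (x : C.freeOperad.obj l p) :
    C.restrSection.map l p x = (x, fun s => C.rδ s x) :=
  Prod.ext (C.restrSection_fst x) rfl

theorem rδ_gen {l : ℕ} {p : ℤ} (s : Fin l) (x : C.M.obj l p) (e : C.E.obj l p) :
    C.rδ s (C.gen x e)
      = C.inclPlus (Q.res u s (C.inclM.map l p x).1) + C.inclPlus (C.δ s e) :=
  congrFun (congrArg Prod.snd (C.restrSection_gen x e)) s

theorem rδ_ident : C.rδ 0 C.freeOperad.ident = C.freeOperad.plusUnit :=
  congrFun (congrArg Prod.snd C.restrSection.map_ident) 0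

theorem rδ_act {l : ℕ} {p : ℤ} (h : l = l - 1 + 1) (σ : Equiv.Perm (Fin l)) (s : Fin l)
    (x : C.freeOperad.obj l p) :
    C.rδ s (C.freeOperad.act σ x) = C.freeOperad.plus.act (delPerm h σ s) (C.rδ (σ s) x) :=
  congrFun (congrArg Prod.snd (C.restrSection.map_act σ x)) s

theorem rδ_comp {l m n : ℕ} {p q r : ℤ} (hn : l + m = n + 1) (hr : p + q = r) (i : Fin l)
    (x : C.freeOperad.obj l p) (y : C.freeOperad.obj m q) (s : Fin n) :
    C.rδ s (C.freeOperad.comp hn hr i x y)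
      = GradedOperad.compRestr hn hr i x (fun j => C.rδ j x) y (fun j => C.rδ j y) s := by
  have h := C.restrSection.map_comp hn hr i x y
  rw [C.restrSection_eq, C.restrSection_eq, C.restrSection_eq] at h
  exact congrFun (congrArg Prod.snd h) s

theorem subsingleton_free_zero (p : ℤ) : Subsingleton (C.freeOperad.obj 0 p) := by
  have h : ∀ x : C.freeOperad.obj 0 p, x = 0 := fun x => by
    have := (GradedOperad.isFree_free (C.M.sum C.E)).induction
      (S := fun l p => zeroWhen k (l = 0)) (fun l p x h => by
        subst h
        rw [(C.subsingleton_sum_zero p).elim x 0, map_zero]) (fun h => by omega)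
      (fun {l p} σ x hx h => by rw [hx h, map_zero])
      (fun hn hr i x y hx hy h => by
        have := i.2
        rw [hy (by omega), map_zero]) x
    exact this rfl
  exact ⟨fun x y => (h x).trans (h y).symm⟩

/-- The inclusion of the truncation of `Q`, together with the restrictions of its elements. -/
noncomputable def inclTruncRestr :
    GradedOperad.Hom Q.gradedTrunc C.freeOperad.restrOperad where
  map l p := LinearMap.prod (C.inclTrunc.map l p)
    (LinearMap.pi fun s => C.inclPlus.comp ((Q.res u s).comp (Submodule.subtype _)))
  map_act {l p} σ x := by
    refine Prod.ext (C.inclTrunc.map_act σ x) (funext fun s => ?_)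
    have hs := s.2
    change C.inclPlus (Q.res u s (Q.act σ x.1))
      = C.freeOperad.plus.act (delPerm (by omega) σ s) (C.inclPlus (Q.res u (σ s) x.1))
    rw [← C.inclPlus_act, ← Q.res_act u]
  map_ident := Prod.ext C.inclTrunc.map_ident (funext fun s => by
    change C.inclPlus (Q.res u s Q.ident) = C.freeOperad.plusUnit
    rw [← C.inclPlus_unit]
    exact congrArg C.inclPlus (Q.ident_comp _ _ s u))
  map_comp {l m n p q r} hn hr i x y := by
    refine Prod.ext (C.inclTrunc.map_comp hn hr i x y) (funext fun s => ?_)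
    have hi := i.2
    have hs := s.2
    change C.inclPlus (Q.res u s (Q.comp hn hr i x.1 y.1))
      = GradedOperad.compRestr hn hr i (C.inclTrunc.map l p x)
        (fun s => C.inclPlus (Q.res u s x.1)) (C.inclTrunc.map m q y)
        (fun s => C.inclPlus (Q.res u s y.1)) s
    rcases eq_outerPos_or_innerPos hn i s with ⟨⟨o, ho⟩, hso⟩ | ⟨t, hst⟩
    · have hso : s.1 = if o.1 < i.1 then o.1 else o.1 + m - 1 := congrArg Fin.val hso
      have hoi : o.1 ≠ i.1 := fun h => ho (Fin.ext h)
      have ho2 := o.2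
      have hi'2 : (if i.1 < o.1 then i.1 else i.1 - 1) < l - 1 := by split_ifs <;> omega
      by_cases hm : m = 0
      · subst hm
        rw [(Q.subsingleton_gradedTrunc_zero q).elim y 0,
          GradedOperad.compRestr_outer hn hr i _ _ _ _ s o ho ⟨_, hi'2⟩ hso rfl (by omega)]
        change C.inclPlus (Q.res u s (Q.comp hn hr i x.1 0)) = _
        simp only [map_zero]
      · rw [Q.res_comp_outer u hn hr i _ _ s o ho ⟨_, hi'2⟩ hso rfl (by omega),
          GradedOperad.compRestr_outer hn hr i _ _ _ _ s o ho ⟨_, hi'2⟩ hso rfl (by omega),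
          C.inclPlus_comp, C.inclPlus_mk hm, GradedOperad.pc_inPlus, C.fromPlus_inclPlus]
    · have hst : s.1 = i.1 + t.1 := congrArg Fin.val hst
      rw [Q.res_comp_inner u hn hr i _ _ s t hst (by omega),
        GradedOperad.compRestr_inner hn hr i _ _ _ _ s t hst (by omega), C.inclPlus_comp,
        Q.toTrunc_mk]

/-- The restrictions of the elements of `Q` in the free operad are their restrictions in `Q`. -/
theorem rδ_inclTrunc {l : ℕ} {p : ℤ} (s : Fin l) (x : Q.gradedTrunc.obj l p) :
    C.rδ s (C.inclTrunc.map l p x) = C.inclPlus (Q.res u s x.1) := by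
  have h : C.restrSection.comp C.inclTrunc = C.inclTruncRestr := C.free.hom_ext fun l p x => by
    change C.restrSection.map l p (C.inclTrunc.map l p (C.inclM.map l p x))
      = (C.inclTrunc.map l p (C.inclM.map l p x),
          fun s => C.inclPlus (Q.res u s (C.inclM.map l p x).1))
    rw [C.inclTrunc_gen, C.restrSection_gen]
    simp only [map_zero, add_zero]
    rfl
  have e := congrArg (fun f : GradedOperad.Hom Q.gradedTrunc C.freeOperad.restrOperad =>
    f.map l p x) h
  exact congrFun (congrArg Prod.snd e) s

theorem rδ_rδ {l : ℕ} {p : ℤ} (i j : Fin l) (i' j' : Fin (l - 1)) (hij : i < j)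
    (hi' : i'.1 = i.1) (hj' : j'.1 + 1 = j.1) (x : C.freeOperad.obj l p) :
    C.rδ i' (C.freeOperad.fromPlus (C.rδ j x)) = C.rδ j' (C.freeOperad.fromPlus (C.rδ i x)) := by
  let S : ∀ l p, Submodule k (C.freeOperad.obj l p) := fun l p =>
    { carrier := {x | ∀ (i j : Fin l) (i' j' : Fin (l - 1)), i < j → i'.1 = i.1 → j'.1 + 1 = j.1 →
        C.rδ i' (C.freeOperad.fromPlus (C.rδ j x)) = C.rδ j' (C.freeOperad.fromPlus (C.rδ i x))}
      add_mem' := fun hx hy i j i' j' h h' h'' => by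
        simp only [map_add, hx i j i' j' h h' h'', hy i j i' j' h h' h'']
      zero_mem' := fun i j i' j' h h' h'' => by simp only [map_zero]
      smul_mem' := fun c x hx i j i' j' h h' h'' => by
        simp only [map_smul, hx i j i' j' h h' h''] }
  refine (GradedOperad.isFree_free (C.M.sum C.E)).induction (S := S) ?_ ?_ ?_ ?_ x i j i' j' hij
    hi' hj'
  · intro l p x i j i' j' hij hi' hj'
    have hi := i'.2
    change C.rδ i' (C.freeOperad.fromPlus (C.rδ j (C.gen x.1 x.2)))
      = C.rδ j' (C.freeOperad.fromPlus (C.rδ i (C.gen x.1 x.2)))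
    rw [C.rδ_gen, C.rδ_gen]
    simp only [map_add, C.fromPlus_inclPlus, C.rδ_inclTrunc]
    rw [Q.toTrunc_val (by omega), Q.toTrunc_val (by omega), Q.toTrunc_val (by omega),
      Q.toTrunc_val (by omega), C.δ_δ i j i' j' hij hi' hj', Q.res_res u i j i' j' hij hi' hj']
  · intro i j i' j' hij hi' hj'
    have := i'.2
    omega
  · intro l p σ x hx
    exact GradedOperad.restr_comm_act C.rδ C.rδ_act σ x hx
  · intro l m n p q r hn hr i x y hx hy
    exact GradedOperad.restr_comm_comp C.rδ C.subsingleton_free_zero C.rδ_comp hn hr i x y hx hy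

/-- The restriction operations on the free operad. -/
noncomputable def restrictions : GradedOperad.Restrictions C.freeOperad where
  δ := C.rδ
  δ_ident := C.rδ_ident
  δ_act := C.rδ_act
  δ_comp := C.rδ_comp
  δ_δ := C.rδ_rδ

end CellData

end DGOperad

namespace DGOperad

variable {k : Type u} [Field k]

/-! ### The differential of the extension -/

/-- The differential of `P` as a differential on the underlying graded operad. -/
def differential (P : DGOperad k) : GradedOperad.Differential P.toGradedOperad where
  d {l p} := P.d l p
  d_d := P.d_d
  d_act := P.d_act
  d_comp := P.d_comp

/-- A differential on `G` gives a section of `diffOperad G`. -/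
def _root_.GradedOperad.Differential.section {G : GradedOperad k}
    (D : GradedOperad.Differential G) (h : D.d G.ident = 0) :
    GradedOperad.Hom G G.diffOperad where
  map _ _ := LinearMap.prod LinearMap.id D.d
  map_act σ x := Prod.ext rfl (D.d_act σ x)
  map_ident := Prod.ext rfl h
  map_comp hn hr i x y := Prod.ext rfl (D.d_comp hn hr i x y)

/-- The functoriality of `diffOperad`. -/
def _root_.GradedOperad.Hom.diff {G H : GradedOperad k} (f : GradedOperad.Hom G H) :
    GradedOperad.Hom G.diffOperad H.diffOperad where
  map l p := (f.map l p).prodMap (f.map l (p + 1))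
  map_act σ x := Prod.ext (f.map_act σ x.1) (f.map_act σ x.2)
  map_ident := Prod.ext f.map_ident (map_zero (f.map 1 (0 + 1)))
  map_comp {l m n p q r} hn hr i x y := Prod.ext (f.map_comp hn hr i x.1 y.1) (by
    change f.map n (r + 1) (G.comp hn _ i x.2 y.1 + p.negOnePow • G.comp hn _ i x.1 y.2)
      = H.comp hn _ i (f.map _ _ x.2) (f.map _ _ y.1)
        + p.negOnePow • H.comp hn _ i (f.map _ _ x.1) (f.map _ _ y.2)
    rw [map_add, map_zsmul_unit, f.map_comp, f.map_comp])

/-- The derivation property forces the differential to vanish on the identity. -/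
theorem _root_.GradedOperad.Differential.d_ident {G : GradedOperad k}
    (D : GradedOperad.Differential G) : D.d G.ident = 0 := by
  have h := D.d_comp (rfl : 1 + 1 = 1 + 1) (add_zero 0) 0 G.ident G.ident
  rw [G.ident_comp, Int.negOnePow_zero, one_smul] at h
  erw [G.comp_ident, G.ident_comp] at h
  exact left_eq_add.mp h

/-- The differential of the truncation of `Q`. -/
def truncDifferential (Q : DGOperad k) : GradedOperad.Differential Q.gradedTrunc where
  d {l p} := (Q.d l p).restrict (fun x hx h => by rw [hx h, map_zero])
  d_d x := Subtype.ext (Q.d_d x.1)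
  d_act σ x := Subtype.ext (Q.d_act σ x.1)
  d_comp {l m n p q r} hn hr i x y := Subtype.ext ((Q.d_comp hn hr i x.1 y.1).trans (by
    rw [Units.smul_def, Units.smul_def]
    rfl))

theorem toTrunc_d (Q : DGOperad k) {l : ℕ} {p : ℤ} (x : Q.obj l p) :
    Q.toTrunc (Q.d l p x) = Q.truncDifferential.d (Q.toTrunc x) := by
  by_cases h : l = 0
  · subst h
    exact (Q.subsingleton_gradedTrunc_zero _).elim _ _
  · refine Subtype.ext ?_
    rw [Q.toTrunc_val h]
    exact congrArg (Q.d l p) (Q.toTrunc_val h x).symm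

namespace CellData

variable {Q : DGOperad k} {u : Q.obj 0 0} {m : ℕ} (C : CellData Q u m)

/-- The generators with their differentials. -/
noncomputable def genDiff :
    SigmaModule.Hom (C.M.sum C.E) C.freeOperad.diffOperad.toSigmaModule where
  map l p := LinearMap.prod ((GradedOperad.freeGen (C.M.sum C.E)).map l p)
    ((C.inclTrunc.map l (p + 1)).comp
      ((Q.truncDifferential.d.comp ((C.inclM.map l p).comp (LinearMap.fst k _ _)))
        + (Q.toTrunc.comp (C.dE.comp (LinearMap.snd k _ _)))))
  map_act {l p} σ x := by
    refine Prod.ext ((GradedOperad.freeGen (C.M.sum C.E)).map_act σ x) ?_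
    change C.inclTrunc.map l (p + 1) (Q.truncDifferential.d (C.inclM.map l p (C.M.act σ x.1))
        + Q.toTrunc (C.dE (C.E.act σ x.2)))
      = C.freeOperad.act σ (C.inclTrunc.map l (p + 1) (Q.truncDifferential.d (C.inclM.map l p x.1)
        + Q.toTrunc (C.dE x.2)))
    rw [C.inclM.map_act, C.dE_act, toTrunc_act, Q.truncDifferential.d_act, ← map_add,
      C.inclTrunc.map_act]

/-- The free operad with the differentials of its elements, as a section of `diffOperad`. -/
noncomputable def diffSection : GradedOperad.Hom C.freeOperad C.freeOperad.diffOperad :=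
  (GradedOperad.isFree_free _).lift C.genDiff

/-- The projection of `diffOperad`. -/
def _root_.GradedOperad.diffOperadFst (F : GradedOperad k) :
    GradedOperad.Hom F.diffOperad F where
  map _ _ := LinearMap.fst k _ _
  map_act _ _ := rfl
  map_ident := rfl
  map_comp _ _ _ _ _ := rfl

theorem diffSection_gen {l : ℕ} {p : ℤ} (x : C.M.obj l p) (e : C.E.obj l p) :
    C.diffSection.map l p (C.gen x e) = (C.gen x e, C.inclTrunc.map l (p + 1)
      (Q.truncDifferential.d (C.inclM.map l p x) + Q.toTrunc (C.dE e))) :=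
  (GradedOperad.isFree_free (C.M.sum C.E)).lift_gen C.genDiff
    (show (C.M.sum C.E).obj l p from (x, e))

theorem diffSection_fst {l : ℕ} {p : ℤ} (x : C.freeOperad.obj l p) :
    (C.diffSection.map l p x).1 = x := by
  have h : C.freeOperad.diffOperadFst.comp C.diffSection = GradedOperad.Hom.id _ :=
    (GradedOperad.isFree_free _).hom_ext fun l p x =>
      congrArg Prod.fst (C.diffSection_gen x.1 x.2)
  exact congrArg (fun f : GradedOperad.Hom C.freeOperad C.freeOperad => f.map l p x) h

/-- The differential of the free operad. -/
noncomputable def fd {l : ℕ} {p : ℤ} :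
    C.freeOperad.obj l p →ₗ[k] C.freeOperad.obj l (p + 1) :=
  (LinearMap.snd k _ _).comp (C.diffSection.map l p)

theorem diffSection_eq {l : ℕ} {p : ℤ} (x : C.freeOperad.obj l p) :
    C.diffSection.map l p x = (x, C.fd x) :=
  Prod.ext (C.diffSection_fst x) rfl

theorem fd_gen {l : ℕ} {p : ℤ} (x : C.M.obj l p) (e : C.E.obj l p) :
    C.fd (C.gen x e) = C.inclTrunc.map l (p + 1)
      (Q.truncDifferential.d (C.inclM.map l p x) + Q.toTrunc (C.dE e)) :=
  congrArg Prod.snd (C.diffSection_gen x e)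

theorem fd_ident : C.fd C.freeOperad.ident = 0 :=
  congrArg Prod.snd C.diffSection.map_ident

theorem fd_act {l : ℕ} {p : ℤ} (σ : Equiv.Perm (Fin l)) (x : C.freeOperad.obj l p) :
    C.fd (C.freeOperad.act σ x) = C.freeOperad.act σ (C.fd x) :=
  congrArg Prod.snd (C.diffSection.map_act σ x)

theorem fd_comp {l m n : ℕ} {p q r : ℤ} (hn : l + m = n + 1) (hr : p + q = r) (i : Fin l)
    (x : C.freeOperad.obj l p) (y : C.freeOperad.obj m q) :
    C.fd (C.freeOperad.comp hn hr i x y)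
      = C.freeOperad.comp hn (by omega : p + 1 + q = r + 1) i (C.fd x) y
        + p.negOnePow • C.freeOperad.comp hn (by omega : p + (q + 1) = r + 1) i x (C.fd y) := by
  have h := C.diffSection.map_comp hn hr i x y
  rw [C.diffSection_eq, C.diffSection_eq, C.diffSection_eq] at h
  exact congrArg Prod.snd h

/-- The differentials of the elements of `Q` in the free operad are their differentials in `Q`. -/
theorem fd_inclTrunc {l : ℕ} {p : ℤ} (x : Q.gradedTrunc.obj l p) :
    C.fd (C.inclTrunc.map l p x) = C.inclTrunc.map l (p + 1) (Q.truncDifferential.d x) := by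
  have h : C.diffSection.comp C.inclTrunc
      = C.inclTrunc.diff.comp (Q.truncDifferential.section Q.truncDifferential.d_ident) :=
    C.free.hom_ext fun l p x => by
      change C.diffSection.map l p (C.inclTrunc.map l p (C.inclM.map l p x))
        = (C.inclTrunc.map l p (C.inclM.map l p x),
            C.inclTrunc.map l (p + 1) (Q.truncDifferential.d (C.inclM.map l p x)))
      rw [C.inclTrunc_gen, C.diffSection_gen]
      simp only [map_zero, add_zero]
      rfl
  have e := congrArg (fun f : GradedOperad.Hom Q.gradedTrunc C.freeOperad.diffOperad =>
    f.map l p x) h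
  exact congrArg Prod.snd e

theorem fd_fd {l : ℕ} {p : ℤ} (x : C.freeOperad.obj l p) : C.fd (C.fd x) = 0 := by
  refine (GradedOperad.isFree_free (C.M.sum C.E)).induction
    (S := fun l p => LinearMap.ker ((C.fd (l := l) (p := p + 1)).comp C.fd)) ?_ ?_ ?_ ?_ x
  · intro l p x
    change C.fd (C.fd (C.gen x.1 x.2)) = 0
    have h : Q.truncDifferential.d (Q.toTrunc (C.dE x.2)) = 0 := by
      rw [← toTrunc_d, C.dE_cocycle, map_zero]
    rw [C.fd_gen, C.fd_inclTrunc, map_add, h, Q.truncDifferential.d_d, add_zero, map_zero]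
  · change C.fd (C.fd C.freeOperad.ident) = 0
    rw [C.fd_ident, map_zero]
  · intro l p σ x hx
    change C.fd (C.fd x) = 0 at hx
    change C.fd (C.fd (C.freeOperad.act σ x)) = 0
    rw [C.fd_act, C.fd_act, hx, map_zero]
  · intro l m n p q r hn hr i x y hx hy
    change C.fd (C.fd x) = 0 at hx
    change C.fd (C.fd y) = 0 at hy
    change C.fd (C.fd (C.freeOperad.comp hn hr i x y)) = 0
    rw [C.fd_comp, map_add, map_zsmul_unit, C.fd_comp, C.fd_comp, hx, hy]
    simp only [map_zero, LinearMap.zero_apply, smul_zero, zero_add, add_zero, Int.negOnePow_succ,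
      Units.neg_smul, neg_add_cancel]

/-- The differential on the free operad. -/
noncomputable def freeDifferential : GradedOperad.Differential C.freeOperad where
  d := C.fd
  d_d := C.fd_fd
  d_act := C.fd_act
  d_comp := C.fd_comp

theorem inclPlus_d {l : ℕ} {p : ℤ} (x : Q.obj l p) :
    C.inclPlus (Q.d l p x)
      = C.freeOperad.inPlus (C.fd (C.freeOperad.fromPlus (C.inclPlus x))) := by
  rw [C.fromPlus_inclPlus, C.fd_inclTrunc, ← toTrunc_d]
  by_cases h : l = 0
  · subst h
    rw [C.isUnitary.d_eq_zero, map_zero, map_zero, map_zero, map_zero]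
  · rw [C.inclPlus_of_pos h]

theorem rδ_fd {l : ℕ} {p : ℤ} (s : Fin l) (x : C.freeOperad.obj l p) :
    C.rδ s (C.fd x) = C.freeOperad.inPlus (C.fd (C.freeOperad.fromPlus (C.rδ s x))) := by
  let S : ∀ l p, Submodule k (C.freeOperad.obj l p) := fun l p =>
    { carrier := {x | ∀ s : Fin l,
        C.rδ s (C.fd x) = C.freeOperad.inPlus (C.fd (C.freeOperad.fromPlus (C.rδ s x)))}
      add_mem' := fun hx hy s => by simp only [map_add, hx s, hy s]
      zero_mem' := fun s => by simp only [map_zero]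
      smul_mem' := fun c x hx s => by simp only [map_smul, hx s] }
  refine (GradedOperad.isFree_free (C.M.sum C.E)).induction (S := S) ?_ ?_ ?_ ?_ x s
  · intro l p x s
    have hs := s.2
    change C.rδ s (C.fd (C.gen x.1 x.2))
      = C.freeOperad.inPlus (C.fd (C.freeOperad.fromPlus (C.rδ s (C.gen x.1 x.2))))
    rw [C.rδ_gen, C.fd_gen, C.rδ_inclTrunc, ← map_add, ← C.inclPlus_d, map_add, C.δ_dE,
      C.isUnitary.d_res, ← map_add]
    congr 2
    exact congrArg (Q.d l p _ + ·) (Q.toTrunc_val (by omega) _)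
  · intro s
    obtain rfl := Subsingleton.elim s 0
    rw [C.fd_ident, C.rδ_ident, SigmaModule.fromPlus_plusUnit, map_zero, map_zero, map_zero]
  · intro l p σ x hx s
    have hs := s.2
    rw [C.fd_act, C.rδ_act (by omega), hx, C.rδ_act (by omega), SigmaModule.fromPlus_act, C.fd_act,
      SigmaModule.inPlus_act]
  · intro l m n p q r hn hr i x y hx hy s
    have hi := i.2
    have hs := s.2
    rw [C.fd_comp, map_add, map_zsmul_unit, C.rδ_comp, C.rδ_comp, C.rδ_comp]
    rcases eq_outerPos_or_innerPos hn i s with ⟨⟨o, ho⟩, hso⟩ | ⟨t, hst⟩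
    · have hso : s.1 = if o.1 < i.1 then o.1 else o.1 + m - 1 := congrArg Fin.val hso
      have hoi : o.1 ≠ i.1 := fun h => ho (Fin.ext h)
      have ho2 := o.2
      have hi'2 : (if i.1 < o.1 then i.1 else i.1 - 1) < l - 1 := by split_ifs <;> omega
      rw [GradedOperad.compRestr_outer hn _ i _ _ _ _ s o ho ⟨_, hi'2⟩ hso rfl (by omega),
        GradedOperad.compRestr_outer hn _ i _ _ _ _ s o ho ⟨_, hi'2⟩ hso rfl (by omega),
        GradedOperad.compRestr_outer hn _ i _ _ _ _ s o ho ⟨_, hi'2⟩ hso rfl (by omega),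
        SigmaModule.fromPlus_inPlus, C.fd_comp, map_add, map_zsmul_unit, hx]
      rfl
    · have hst : s.1 = i.1 + t.1 := congrArg Fin.val hst
      rw [GradedOperad.compRestr_inner hn _ i _ _ _ _ s t hst (by omega),
        GradedOperad.compRestr_inner hn _ i _ _ _ _ s t hst (by omega),
        GradedOperad.compRestr_inner hn _ i _ _ _ _ s t hst (by omega), hx, hy]
      exact (C.freeDifferential.d_pc _ hr i x (C.rδ i x) (C.rδ t y)).symm

/-- The unital dg operad obtained by attaching the new generators. -/
noncomputable def target : DGOperad k :=
  C.restrictions.toDGOperad C.subsingleton_free_zero C.freeDifferential C.rδ_fd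

/-- The morphism from `Q` to the operad obtained by attaching the new generators. -/
noncomputable def ι : Q ⟶ C.target :=
  show Hom Q C.target from
  { map := fun l p => C.inclPlus
    map_act := fun σ x => C.inclPlus_act σ x
    map_ident := by
      refine (C.inclPlus_of_pos one_ne_zero _).trans ?_
      rw [toTrunc_ident]
      exact congrArg _ C.inclTrunc.map_ident
    map_comp := fun hn hr i x y => by
      have hi := i.2
      refine (C.inclPlus_comp hn hr i x y).trans ?_
      change _ = C.freeOperad.pc hn hr i (C.freeOperad.fromPlus (C.inclPlus x),
        C.rδ i (C.freeOperad.fromPlus (C.inclPlus x))) (C.inclPlus y)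
      rw [C.fromPlus_inclPlus, C.rδ_inclTrunc, Q.toTrunc_val (by omega)]
    map_d := fun x => C.inclPlus_d x }

theorem ι_unit : C.ι.map 0 0 u = C.freeOperad.plusUnit := C.inclPlus_unit

theorem isUnitary_target : C.target.IsUnitary (C.ι.map 0 0 u) := by
  rw [C.ι_unit]
  refine ⟨⟨fun a b h => ?_, fun x => ⟨C.freeOperad.coef x, ?_⟩⟩, fun p hp => ?_⟩
  · have h' := congrArg C.freeOperad.coef
      (show (a • C.freeOperad.plusUnit : C.freeOperad.plus.obj 0 0) = b • C.freeOperad.plusUnit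
        from h)
    simpa using h'
  · exact (C.freeOperad.eq_smul_plusUnit C.subsingleton_free_zero x).symm
  · exact C.freeOperad.subsingleton_plus_zero C.subsingleton_free_zero hp

/-- The free operad as the truncation of its unital extension. -/
noncomputable def toTargetTrunc : GradedOperad.Hom C.freeOperad C.target.gradedTrunc where
  map l p := LinearMap.codRestrict (M := C.freeOperad.obj l p) (zeroWhen k (l = 0))
    (C.freeOperad.inPlus : _ →ₗ[k] C.freeOperad.plus.obj l p) (fun x h => by
      subst h
      rw [(C.subsingleton_free_zero p).elim x 0]
      exact map_zero C.freeOperad.inPlus)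
  map_act σ x := rfl
  map_ident := rfl
  map_comp hn hr i x y := Subtype.ext (GradedOperad.pc_inPlus hn hr i x _ y).symm

/-- The projection of the truncation of the unital extension onto the free operad. -/
noncomputable def fromTargetTrunc : GradedOperad.Hom C.target.gradedTrunc C.freeOperad where
  map l p := C.freeOperad.fromPlus.comp (Submodule.subtype (zeroWhen k (l = 0)))
  map_act σ x := rfl
  map_ident := rfl
  map_comp {l m n p q r} hn hr i x y := by
    by_cases h : m = 0
    · subst h
      rw [(C.target.subsingleton_gradedTrunc_zero q).elim y 0]
      simp only [map_zero]
    · exact GradedOperad.fromPlus_pc_of_pos hn hr i h (_, _) _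

/-- The inclusion of the generators in the truncation of the extension. -/
noncomputable def inclGen : SigmaModule.Hom (C.M.sum C.E) C.target.gradedTrunc.toSigmaModule where
  map l p := (C.toTargetTrunc.map l p).comp ((GradedOperad.freeGen (C.M.sum C.E)).map l p)
  map_act {l p} σ x := (congrArg (C.toTargetTrunc.map l p)
    ((GradedOperad.freeGen (C.M.sum C.E)).map_act σ x)).trans (C.toTargetTrunc.map_act σ _)

theorem inclGen_val {l : ℕ} {p : ℤ} (x : C.M.obj l p) (e : C.E.obj l p) :
    (C.inclGen.map l p (x, e)).1 = C.freeOperad.inPlus (C.gen x e) := rfl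

theorem isFree_target : GradedOperad.IsFree (C.M.sum C.E) C.target.gradedTrunc C.inclGen := by
  refine (GradedOperad.isFree_free _).of_iso _ C.toTargetTrunc C.fromTargetTrunc
    (fun l p x => ?_) (fun l p x => rfl) (fun l p x => rfl)
  by_cases h : l = 0
  · subst h
    exact (C.target.subsingleton_gradedTrunc_zero p).elim _ _
  · exact Subtype.ext (C.freeOperad.inPlus_fromPlus (Or.inl h) x.1)

/-- The operad `target` is a unitary principal extension of `Q`. -/
noncomputable def extension : UnitaryPrincipalExtension C.ι u m where
  one_le := C.one_le
  isUnitary_source := C.isUnitary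
  isUnitary_target := C.isUnitary_target
  M := C.M
  M_trivial := C.M_trivial
  inclM := C.inclM
  free_source := C.free
  E := C.E
  E_homogeneous := C.E_homogeneous
  incl := C.inclGen
  free_target := C.isFree_target
  incl_M l p x := by
    by_cases h : l = 0
    · subst h
      exact ((C.inclGen.map 0 p (x, 0)).2 rfl).trans (((congrArg (C.ι.map 0 p)
        ((C.inclM.map 0 p x).2 rfl)).trans (map_zero (C.ι.map 0 p))).symm)
    · refine (C.inclGen_val x 0).trans ?_
      rw [← C.inclTrunc_gen]
      exact (C.inclPlus_mk h _).symm
  dE p := C.dE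
  dE_act p σ e := C.dE_act σ e
  dE_cocycle p e := C.dE_cocycle e
  d_incl p e := by
    change C.freeOperad.inPlus (C.fd (C.gen 0 e)) = C.inclPlus (C.dE e)
    rw [C.fd_gen, map_zero, map_zero, zero_add, C.inclPlus_of_pos (by omega)]
  δ i p := C.δ i
  δ_dE i p e := C.δ_dE i e
  restriction_incl i p e := by
    change C.freeOperad.pc _ _ i (C.gen 0 e, C.rδ i (C.gen 0 e)) (C.inclPlus u)
      = C.inclPlus (C.δ i e)
    rw [C.inclPlus_unit, GradedOperad.pc_plusUnit, C.rδ_gen, map_zero]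
    refine (SigmaModule.tr_self _ _).trans ?_
    exact (congrArg (· + _) ((congrArg C.inclPlus (map_zero (Q.res u i))).trans
      (map_zero C.inclPlus))).trans (zero_add _)

end CellData

end DGOperad

namespace DGOperad

variable {k : Type u} [Field k]

namespace CellData

variable {Q : DGOperad k} {u : Q.obj 0 0} {m : ℕ} (C : CellData Q u m)

/-! ### Extension of morphisms to the new generators -/

/-- The data that extend a morphism `ρ : Q ⟶ R` to the operad with the generators `E` attached: the
images `f` of these generators, which have prescribed differentials and restrictions. -/
structure Extension {R : DGOperad k} (ρ : Q ⟶ R) where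
  f : ∀ {l : ℕ} {p : ℤ}, C.E.obj l p →ₗ[k] R.obj l p
  f_act : ∀ {l : ℕ} {p : ℤ} (σ : Equiv.Perm (Fin l)) (e : C.E.obj l p),
    f (C.E.act σ e) = R.act σ (f e)
  d_f : ∀ {l : ℕ} {p : ℤ} (e : C.E.obj l p), R.d l p (f e) = ρ.map l (p + 1) (C.dE e)
  res_f : ∀ {l : ℕ} {p : ℤ} (s : Fin l) (e : C.E.obj l p),
    R.res (ρ.map 0 0 u) s (f e) = ρ.map (l - 1) p (C.δ s e)

namespace Extension

variable {C} {R : DGOperad k} {ρ : Q ⟶ R} (X : C.Extension ρ)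

/-- The morphism `ρ` on the truncation of `Q`. -/
def _root_.DGOperad.truncHom (ρ : Q ⟶ R) : GradedOperad.Hom Q.gradedTrunc R.toGradedOperad where
  map l p := (ρ.map l p).comp (Submodule.subtype _)
  map_act σ x := ρ.map_act σ x.1
  map_ident := ρ.map_ident
  map_comp hn hr i x y := ρ.map_comp hn hr i x.1 y.1

/-- The images of the generators. -/
noncomputable def genMap : SigmaModule.Hom (C.M.sum C.E) R.toSigmaModule where
  map l p := ((truncHom ρ).map l p).comp ((C.inclM.map l p).comp (LinearMap.fst k _ _))
    + X.f.comp (LinearMap.snd k _ _)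
  map_act {l p} σ x := by
    change (truncHom ρ).map l p (C.inclM.map l p (C.M.act σ x.1)) + X.f (C.E.act σ x.2)
      = R.act σ ((truncHom ρ).map l p (C.inclM.map l p x.1) + X.f x.2)
    rw [C.inclM.map_act, (truncHom ρ).map_act, X.f_act, map_add]

/-- The extension to the free operad. -/
noncomputable def free : GradedOperad.Hom C.freeOperad R.toGradedOperad :=
  (GradedOperad.isFree_free _).lift X.genMap

theorem free_gen {l : ℕ} {p : ℤ} (x : C.M.obj l p) (e : C.E.obj l p) :
    X.free.map l p (C.gen x e) = ρ.map l p (C.inclM.map l p x).1 + X.f e :=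
  (GradedOperad.isFree_free (C.M.sum C.E)).lift_gen X.genMap
    (show (C.M.sum C.E).obj l p from (x, e))

theorem free_inclTrunc {l : ℕ} {p : ℤ} (x : Q.gradedTrunc.obj l p) :
    X.free.map l p (C.inclTrunc.map l p x) = ρ.map l p x.1 := by
  have h : X.free.comp C.inclTrunc = truncHom ρ := C.free.hom_ext fun l p x => by
    change X.free.map l p (C.inclTrunc.map l p (C.inclM.map l p x)) = _
    rw [C.inclTrunc_gen, X.free_gen, map_zero, add_zero]
    rfl
  exact congrArg (fun f : GradedOperad.Hom Q.gradedTrunc R.toGradedOperad => f.map l p x) h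

/-- The extension to the free operad with a unit. -/
noncomputable def ext {l : ℕ} {p : ℤ} : C.freeOperad.plus.obj l p →ₗ[k] R.obj l p :=
  (X.free.map l p).comp C.freeOperad.fromPlus
    + (LinearMap.toSpanSingleton k _ (R.tr (ρ.map 0 0 u))).comp C.freeOperad.coef

theorem ext_apply {l : ℕ} {p : ℤ} (x : C.freeOperad.plus.obj l p) :
    X.ext x = X.free.map l p (C.freeOperad.fromPlus x)
      + C.freeOperad.coef x • R.tr (ρ.map 0 0 u) := rfl

theorem ext_of_ne {l : ℕ} {p : ℤ} (h : l ≠ 0 ∨ p ≠ 0) (x : C.freeOperad.plus.obj l p) :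
    X.ext x = X.free.map l p (C.freeOperad.fromPlus x) := by
  rw [ext_apply, C.freeOperad.coef_eq_zero h, zero_smul, add_zero]

theorem ext_inPlus {l : ℕ} {p : ℤ} (x : C.freeOperad.obj l p) :
    X.ext (C.freeOperad.inPlus x) = X.free.map l p x := by
  rw [ext_apply, SigmaModule.fromPlus_inPlus, SigmaModule.coef_inPlus, zero_smul, add_zero]

theorem ext_plusUnit : X.ext C.freeOperad.plusUnit = ρ.map 0 0 u := by
  rw [ext_apply, SigmaModule.fromPlus_plusUnit, map_zero, zero_add, SigmaModule.coef_plusUnit,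
    one_smul, SigmaModule.tr_self]

theorem ext_inclPlus {l : ℕ} {p : ℤ} (x : Q.obj l p) : X.ext (C.inclPlus x) = ρ.map l p x := by
  by_cases h : l = 0
  · subst h
    by_cases hp : p = 0
    · subst hp
      rw [← smul_coefUnit C.isUnitary x, map_smul, map_smul, map_smul, C.inclPlus_unit,
        X.ext_plusUnit]
    · rw [(C.isUnitary.2 p hp).elim x 0, map_zero, map_zero, map_zero]
  · rw [C.inclPlus_of_pos h, X.ext_inPlus, X.free_inclTrunc, Q.toTrunc_val h]

theorem ext_act {l : ℕ} {p : ℤ} (σ : Equiv.Perm (Fin l)) (x : C.freeOperad.plus.obj l p) :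
    X.ext (C.freeOperad.plus.act σ x) = R.act σ (X.ext x) := by
  by_cases h : l = 0
  · subst h
    rw [Subsingleton.elim σ 1, R.act_one, SigmaModule.act_one]
  · rw [X.ext_of_ne (Or.inl h), X.ext_of_ne (Or.inl h), SigmaModule.fromPlus_act, X.free.map_act]

theorem ext_pc {l m n : ℕ} {p q r : ℤ} (hn : l + m = n + 1) (hr : p + q = r) (i : Fin l)
    (x : C.freeOperad.obj l p) (ξ : C.freeOperad.plus.obj (l - 1) p)
    (y : C.freeOperad.plus.obj m q)
    (hξ : X.ext ξ = R.res (ρ.map 0 0 u) i (X.free.map l p x)) :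
    X.ext (C.freeOperad.pc hn hr i (x, ξ) y) = R.comp hn hr i (X.free.map l p x) (X.ext y) := by
  rw [GradedOperad.pc_apply, map_add, X.ext_inPlus, X.free.map_comp, X.ext_apply y, map_add,
    map_smul, map_smul]
  congr 1
  by_cases h : m ≠ 0 ∨ q ≠ 0
  · rw [C.freeOperad.coef_eq_zero h, zero_smul, zero_smul]
  · obtain ⟨rfl, rfl⟩ : m = 0 ∧ q = 0 := by tauto
    obtain rfl : p = r := by omega
    obtain rfl : n = l - 1 := by omega
    rw [SigmaModule.tr_self, SigmaModule.tr_self, hξ]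
    rfl

/-- The extension commutes with the restriction operations. -/
theorem ext_rδ {l : ℕ} {p : ℤ} (s : Fin l) (x : C.freeOperad.obj l p) :
    X.ext (C.rδ s x) = R.res (ρ.map 0 0 u) s (X.free.map l p x) := by
  let S : ∀ l p, Submodule k (C.freeOperad.obj l p) := fun l p =>
    { carrier := {x | ∀ s : Fin l, X.ext (C.rδ s x) = R.res (ρ.map 0 0 u) s (X.free.map l p x)}
      add_mem' := fun hx hy s => by simp only [map_add, hx s, hy s]
      zero_mem' := fun s => by simp only [map_zero]
      smul_mem' := fun c x hx s => by simp only [map_smul, hx s] }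
  refine (GradedOperad.isFree_free (C.M.sum C.E)).induction (S := S) ?_ ?_ ?_ ?_ x s
  · intro l p x s
    have hs := s.2
    change X.ext (C.rδ s (C.gen x.1 x.2))
      = R.res (ρ.map 0 0 u) s (X.free.map l p (C.gen x.1 x.2))
    rw [C.rδ_gen, X.free_gen, map_add, map_add, X.ext_inclPlus, X.ext_inclPlus, X.res_f]
    congr 1
    exact ρ.map_comp _ _ s _ u
  · intro s
    obtain rfl := Subsingleton.elim s 0
    rw [C.rδ_ident, X.ext_plusUnit, X.free.map_ident]
    exact (R.ident_comp _ _ 0 _).symm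
  · intro l p σ x hx s
    have hs := s.2
    rw [C.rδ_act (by omega), X.ext_act, hx, X.free.map_act, R.res_act _ (by omega)]
  · intro l m n p q r hn hr i x y hx hy s
    have hi := i.2
    have hs := s.2
    rw [C.rδ_comp, X.free.map_comp]
    rcases eq_outerPos_or_innerPos hn i s with ⟨⟨o, ho⟩, hso⟩ | ⟨t, hst⟩
    · have hso : s.1 = if o.1 < i.1 then o.1 else o.1 + m - 1 := congrArg Fin.val hso
      have hoi : o.1 ≠ i.1 := fun h => ho (Fin.ext h)
      have ho2 := o.2
      have hi'2 : (if i.1 < o.1 then i.1 else i.1 - 1) < l - 1 := by split_ifs <;> omega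
      rw [GradedOperad.compRestr_outer hn hr i _ _ _ _ s o ho ⟨_, hi'2⟩ hso rfl (by omega),
        R.res_comp_outer _ hn hr i _ _ s o ho ⟨_, hi'2⟩ hso rfl (by omega), X.ext_inPlus,
        X.free.map_comp, ← hx, X.ext_of_ne (Or.inl (by omega))]
    · have hst : s.1 = i.1 + t.1 := congrArg Fin.val hst
      rw [GradedOperad.compRestr_inner hn hr i _ _ _ _ s t hst (by omega),
        R.res_comp_inner _ hn hr i _ _ s t hst (by omega), X.ext_pc _ _ _ _ _ _ (hx i), hy]

/-- The extension commutes with the differentials. -/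
theorem free_fd {l : ℕ} {p : ℤ} (x : C.freeOperad.obj l p) :
    X.free.map l (p + 1) (C.fd x) = R.d l p (X.free.map l p x) := by
  let S : ∀ l p, Submodule k (C.freeOperad.obj l p) := fun l p =>
    LinearMap.eqLocus ((X.free.map l (p + 1)).comp C.fd) ((R.d l p).comp (X.free.map l p))
  refine (GradedOperad.isFree_free (C.M.sum C.E)).induction (S := S) ?_ ?_ ?_ ?_ x
  · intro l p x
    by_cases h : l = 0
    · subst h
      rw [(C.subsingleton_sum_zero p).elim x 0, map_zero]
      exact Submodule.zero_mem _
    change X.free.map l (p + 1) (C.fd (C.gen x.1 x.2)) = R.d l p (X.free.map l p (C.gen x.1 x.2))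
    rw [C.fd_gen, X.free_inclTrunc, X.free_gen, map_add, X.d_f, ← ρ.map_d, ← map_add]
    exact congrArg (fun a => ρ.map l (p + 1) (Q.d l p (C.inclM.map l p x.1).1 + a))
      (Q.toTrunc_val h _)
  · change X.free.map 1 _ (C.fd C.freeOperad.ident) = R.d 1 0 (X.free.map 1 0 C.freeOperad.ident)
    rw [C.fd_ident, map_zero, X.free.map_ident]
    exact R.differential.d_ident.symm
  · intro l p σ x hx
    change X.free.map l (p + 1) (C.fd x) = R.d l p (X.free.map l p x) at hx
    change X.free.map l (p + 1) (C.fd _) = R.d l p (X.free.map l p _)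
    rw [C.fd_act, X.free.map_act, X.free.map_act, hx, R.d_act]
  · intro l m n p q r hn hr i x y hx hy
    change X.free.map l (p + 1) (C.fd x) = R.d l p (X.free.map l p x) at hx
    change X.free.map m (q + 1) (C.fd y) = R.d m q (X.free.map m q y) at hy
    change X.free.map n (r + 1) (C.fd _) = R.d n r (X.free.map n r _)
    rw [C.fd_comp, X.free.map_comp, R.d_comp, map_add, map_zsmul_unit, X.free.map_comp,
      X.free.map_comp, hx, hy]

theorem d_ext {l : ℕ} {p : ℤ} (x : C.freeOperad.plus.obj l p) :
    R.d l p (X.ext x) = R.d l p (X.free.map l p (C.freeOperad.fromPlus x)) := by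
  rw [X.ext_apply, map_add, map_smul]
  by_cases h : l ≠ 0 ∨ p ≠ 0
  · rw [C.freeOperad.coef_eq_zero h, zero_smul, add_zero]
  · obtain ⟨rfl, rfl⟩ : l = 0 ∧ p = 0 := by tauto
    rw [SigmaModule.tr_self, ← ρ.map_d, C.isUnitary.d_eq_zero, map_zero, smul_zero, add_zero]

/-- The morphism on the operad with the new generators attached. -/
noncomputable def hom : C.target ⟶ R :=
  show Hom C.target R from
  { map := fun _ _ => X.ext
    map_act := fun σ x => X.ext_act σ x
    map_ident := (X.ext_inPlus _).trans X.free.map_ident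
    map_comp := fun {l m n p q r} hn hr i x y => by
      have hi := i.2
      refine (X.ext_pc hn hr i _ _ y (X.ext_rδ i (C.freeOperad.fromPlus x))).trans ?_
      exact congrArg (fun a => R.comp hn hr i a (X.ext y)) (X.ext_of_ne (Or.inl (by omega)) x).symm
    map_d := fun x => (X.ext_inPlus _).trans ((X.free_fd _).trans (X.d_ext x).symm) }

theorem ι_hom : C.ι ≫ X.hom = ρ := by
  refine Hom.ext ?_
  funext l p
  exact LinearMap.ext fun x => X.ext_inclPlus x

theorem hom_inclGen {l : ℕ} {p : ℤ} (e : C.E.obj l p) :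
    X.hom.map l p (C.inclGen.map l p (0, e)).1 = X.f e := by
  refine (X.ext_inPlus _).trans ?_
  rw [X.free_gen, map_zero]
  exact (congrArg (· + X.f e) (map_zero (ρ.map l p))).trans (zero_add _)

end Extension

end CellData

end DGOperad

namespace DGOperad

variable {k : Type u} [Field k]

/-! ### Cohomology in terms of elements -/

/-- The morphism `f` induces an isomorphism in cohomology in arity `l`, in terms of cocycles: it is
injective and surjective on cohomology classes. -/
def IsQuisAt {P Q : DGOperad k} (f : P ⟶ Q) (l : ℕ) : Prop :=
  (∀ (p : ℤ) (x : P.obj l (p + 1)), P.d l (p + 1) x = 0 →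
    (∃ w, Q.d l p w = f.map l (p + 1) x) → ∃ v, P.d l p v = x) ∧
  ∀ (p : ℤ) (y : Q.obj l (p + 1)), Q.d l (p + 1) y = 0 →
    ∃ x w, P.d l (p + 1) x = 0 ∧ y = f.map l (p + 1) x + Q.d l p w

/-- Over a field, a linear map whose values are in the range of `g` lifts along `g`. -/
theorem exists_lift_of_range {A B C : Type*} [AddCommGroup A] [AddCommGroup B] [AddCommGroup C]
    [Module k A] [Module k B] [Module k C] (f : A →ₗ[k] C) (g : B →ₗ[k] C)
    (h : ∀ a, ∃ b, g b = f a) : ∃ s : A →ₗ[k] B, ∀ a, g (s a) = f a := by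
  obtain ⟨s, hs⟩ := Module.projective_lifting_property g.rangeRestrict
    (f.codRestrict (LinearMap.range g) h) g.surjective_rangeRestrict
  exact ⟨s, fun a => congrArg Subtype.val (LinearMap.congr_fun hs a)⟩

theorem complex_d_apply (P : DGOperad k) (l : ℕ) (p : ℤ) (x : P.obj l p) :
    ((P.complex l).d p (p + 1)).hom x = P.d l p x := by
  have h : (P.complex l).d p (p + 1) = ModuleCat.ofHom (P.d l p) :=
    CochainComplex.of_d (fun p => ModuleCat.of k (P.obj l p)) (fun p => ModuleCat.ofHom (P.d l p)) p
  rw [h]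
  rfl

theorem isQuis_of_isQuisAt {P Q : DGOperad k} {f : P ⟶ Q} (h : ∀ l, IsQuisAt f l) : IsQuis f := by
  intro l
  rw [quasiIso_iff]
  intro j
  obtain ⟨p, rfl⟩ : ∃ p : ℤ, j = p + 1 := ⟨j - 1, by omega⟩
  rw [quasiIsoAt_iff_isIso_homologyMap]
  have hi : (ComplexShape.up ℤ).prev (p + 1) = p := by simp
  have hk : (ComplexShape.up ℤ).next (p + 1) = p + 1 + 1 := by simp
  have : Mono (HomologicalComplex.homologyMap (complexMap f l) (p + 1)) := by
    rw [HomologicalComplex.mono_homologyMap_iff_up_to_refinements _ p (p + 1) (p + 1 + 1) hi hk]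
    intro A x hx y hy
    obtain ⟨s, hs⟩ := exists_lift_of_range x.hom (P.d l p) (fun a => by
      refine (h l).1 p _ ?_ ⟨y.hom a, ?_⟩
      · have e := congrArg (fun g => g.hom a) hx
        exact (P.complex_d_apply l (p + 1) (x.hom a)).symm.trans e
      · have e := congrArg (fun g => g.hom a) hy
        exact (Q.complex_d_apply l p (y.hom a)).symm.trans e.symm)
    refine ⟨A, 𝟙 A, inferInstance, ModuleCat.ofHom s, ?_⟩
    ext a
    exact (hs a).symm.trans (P.complex_d_apply l p (s a)).symm
  have : Epi (HomologicalComplex.homologyMap (complexMap f l) (p + 1)) := by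
    rw [HomologicalComplex.epi_homologyMap_iff_up_to_refinements _ p (p + 1) (p + 1 + 1) hi hk]
    intro A y hy
    obtain ⟨s, hs⟩ := exists_lift_of_range y.hom
      (LinearMap.coprod ((f.map l (p + 1)).comp (LinearMap.ker (P.d l (p + 1))).subtype)
        (Q.d l p)) (fun a => by
      obtain ⟨x, w, hx, hy'⟩ := (h l).2 p (y.hom a) (by
        have e := congrArg (fun g => g.hom a) hy
        exact (Q.complex_d_apply l (p + 1) (y.hom a)).symm.trans e)
      exact ⟨(⟨x, hx⟩, w), hy'.symm⟩)
    refine ⟨A, 𝟙 A, inferInstance,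
      ModuleCat.ofHom ((LinearMap.ker (P.d l (p + 1))).subtype.comp ((LinearMap.fst k _ _).comp s)),
      ?_, ModuleCat.ofHom ((LinearMap.snd k _ _).comp s), ?_⟩
    · ext a
      exact (P.complex_d_apply l (p + 1) (s a).1.1).trans (s a).1.2
    · ext a
      exact (hs a).symm.trans (congrArg (f.map l (p + 1) (s a).1.1 + ·)
        (Q.complex_d_apply l p (s a).2).symm)
  exact isIso_of_mono_of_epi _

theorem exists_d_eq_of_isZero {P : DGOperad k} {l : ℕ} {p : ℤ}
    (h : IsZero ((P.complex l).homology (p + 1))) (x : P.obj l (p + 1))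
    (hx : P.d l (p + 1) x = 0) : ∃ v, P.d l p v = x := by
  rw [← HomologicalComplex.exactAt_iff_isZero_homology,
    HomologicalComplex.exactAt_iff' _ p (p + 1) (p + 1 + 1) (by simp) (by simp),
    ShortComplex.moduleCat_exact_iff] at h
  obtain ⟨v, hv⟩ := h x ((P.complex_d_apply l (p + 1) x).trans hx)
  exact ⟨v, (P.complex_d_apply l p v).symm.trans hv⟩

/-- If the cohomology in degree `p + 1` has dimension one, each cocycle which is not a boundary
spans it. -/
theorem exists_eq_smul_add_of_iso {P : DGOperad k} {l : ℕ} {p : ℤ}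
    (h : Nonempty ((P.complex l).homology (p + 1) ≅ ModuleCat.of k k)) (e : P.obj l (p + 1))
    (he : P.d l (p + 1) e = 0) (hne : ¬ ∃ v, P.d l p v = e) (x : P.obj l (p + 1))
    (hx : P.d l (p + 1) x = 0) : ∃ (c : k) (v : P.obj l p), x = c • e + P.d l p v := by
  obtain ⟨a⟩ := h
  let S := (P.complex l).sc' p (p + 1) (p + 1 + 1)
  let b : S.moduleCatLeftHomologyData.H ≅ ModuleCat.of k k := S.moduleCatHomologyIso.symm ≪≫
    ShortComplex.homologyMapIso ((P.complex l).isoSc' p (p + 1) (p + 1 + 1) (by simp)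
      (by simp)).symm ≪≫ a
  let Ψ : LinearMap.ker (P.d l (p + 1)) →ₗ[k] k :=
    b.hom.hom.comp ((Submodule.mkQ (LinearMap.range S.moduleCatToCycles)).comp
      (Submodule.inclusion (p := LinearMap.ker (P.d l (p + 1))) (p' := LinearMap.ker S.g.hom)
        (fun z hz => (P.complex_d_apply l (p + 1) z).trans hz)))
  have key : ∀ z, Ψ z = 0 → ∃ v, P.d l p v = z.1 := by
    intro z hz
    have h0 : (Submodule.mkQ (LinearMap.range S.moduleCatToCycles))
        ⟨z.1, (P.complex_d_apply l (p + 1) z.1).trans z.2⟩ = 0 :=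
      b.toLinearEquiv.map_eq_zero_iff.mp hz
    obtain ⟨v, hv⟩ := (Submodule.Quotient.mk_eq_zero _).mp h0
    exact ⟨v, (P.complex_d_apply l p v).symm.trans (congrArg Subtype.val hv)⟩
  have hΨ : Ψ ⟨e, he⟩ ≠ 0 := fun h => hne (key _ h)
  obtain ⟨v, hv⟩ := key (⟨x, hx⟩ - (Ψ ⟨x, hx⟩ / Ψ ⟨e, he⟩) • ⟨e, he⟩) (by
    rw [map_sub, map_smul, smul_eq_mul, div_mul_cancel₀ _ hΨ, sub_self])
  exact ⟨_, v, by rw [hv]; exact (add_sub_cancel _ x).symm⟩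

end DGOperad

namespace DGOperad

variable {k : Type u} [Field k]

/-! ### The arities of a principal extension up to that of the new generators -/

theorem ident_comp_tr (G : GradedOperad k) {l n : ℕ} {p q r : ℤ} (hn : 1 + l = n + 1)
    (hr : p + q = r) (i : Fin 1) (y : G.obj l q) :
    G.comp hn hr i (G.tr G.ident) y = if p = 0 then G.tr y else 0 := by
  obtain rfl : n = l := by omega
  by_cases h : p = 0
  · subst h
    obtain rfl : q = r := by omega
    rw [if_pos rfl, G.tr_self, G.tr_self, G.ident_comp]
  · rw [if_neg h, G.tr_of_ne (fun h' => h h'.2.symm), map_zero, LinearMap.zero_apply]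

theorem comp_ident_tr (G : GradedOperad k) {l n : ℕ} {p q r : ℤ} (hn : l + 1 = n + 1)
    (hr : p + q = r) (i : Fin l) (x : G.obj l p) :
    G.comp hn hr i x (G.tr G.ident) = if q = 0 then G.tr x else 0 := by
  obtain rfl : n = l := by omega
  by_cases h : q = 0
  · subst h
    obtain rfl : p = r := by omega
    rw [if_pos rfl, G.tr_self, G.tr_self, G.comp_ident]
  · rw [if_neg h, G.tr_of_ne (fun h' => h h'.2.symm), map_zero]

/-- An operad which is free, without generators in the arities `0` and `1`, is spanned by the
identity in arity `1`. -/
theorem exists_eq_smul_tr_ident {Q : DGOperad k} {M : SigmaModule k}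
    {i : SigmaModule.Hom M Q.gradedTrunc.toSigmaModule}
    (hM : ∀ l : ℕ, l ≤ 1 → ∀ p : ℤ, Subsingleton (M.obj l p))
    (h : GradedOperad.IsFree M Q.gradedTrunc i) {p : ℤ} (x : Q.obj 1 p) :
    ∃ c : k, x = c • Q.tr Q.ident := by
  let S : ∀ l p, Submodule k (Q.gradedTrunc.obj l p) := fun l p =>
    { carrier := {x | l = 1 → ∃ c : k, x.1 = c • Q.tr Q.ident}
      add_mem' := fun {x y} hx hy hl => by
        obtain ⟨c, hc⟩ := hx hl
        obtain ⟨c', hc'⟩ := hy hl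
        exact ⟨c + c', (congrArg₂ (· + ·) hc hc').trans (add_smul _ _ _).symm⟩
      zero_mem' := fun _ => ⟨0, (zero_smul k _).symm⟩
      smul_mem' := fun a x hx hl => by
        obtain ⟨c, hc⟩ := hx hl
        exact ⟨a * c, (congrArg (a • ·) hc).trans (mul_smul _ _ _).symm⟩ }
  have key := h.induction S (fun l p x hl => by
      rw [(hM l (by omega) p).elim x 0, map_zero]
      exact ⟨0, (zero_smul k _).symm⟩)
    (fun _ => ⟨1, by rw [one_smul, Q.tr_self]; rfl⟩)
    (fun {l p} σ x hx hl => by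
      subst hl
      rw [Subsingleton.elim σ 1, SigmaModule.act_one]
      exact hx rfl)
    (fun {l m n p q r} hn hr i x y hx hy hl => by
      have hi := i.2
      subst hl
      by_cases hm : m = 0
      · subst hm
        rw [(Q.subsingleton_gradedTrunc_zero q).elim y 0, map_zero]
        exact ⟨0, (zero_smul k _).symm⟩
      · obtain rfl : l = 1 := by omega
        obtain rfl : m = 1 := by omega
        obtain ⟨c, hc⟩ := hx rfl
        obtain ⟨c', hc'⟩ := hy rfl
        change ∃ c : k, Q.comp hn hr i x.1 y.1 = c • Q.tr Q.ident
        rw [hc, hc', map_smul, map_smul, LinearMap.smul_apply, ident_comp_tr]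
        by_cases hp : p = 0
        · subst hp
          obtain rfl : q = r := by omega
          exact ⟨c' * c, by rw [if_pos rfl, Q.tr_self, mul_smul]⟩
        · exact ⟨0, by rw [if_neg hp]; simp⟩)
    (Q.toTrunc x)
  obtain ⟨c, hc⟩ := key rfl
  exact ⟨c, by rw [← hc, Q.toTrunc_val one_ne_zero]⟩

namespace UnitaryPrincipalExtension

variable {P Q : DGOperad k} {ι : P ⟶ Q} {u : P.obj 0 0} {m : ℕ}
  (X : UnitaryPrincipalExtension ι u m)

/-- The morphism on truncations. -/
def _root_.DGOperad.Hom.trunc (f : P ⟶ Q) : GradedOperad.Hom P.gradedTrunc Q.gradedTrunc where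
  map l p := (f.map l p).restrict (fun x hx h => by rw [hx h, map_zero])
  map_act σ x := Subtype.ext (f.map_act σ x.1)
  map_ident := Subtype.ext f.map_ident
  map_comp hn hr i x y := Subtype.ext (f.map_comp hn hr i x.1 y.1)

theorem injective (X : UnitaryPrincipalExtension ι u m) {l : ℕ} {p : ℤ} :
    Function.Injective (ι.map l p) := by
  by_cases hl : l = 0
  · subst hl
    by_cases hp : p = 0
    · subst hp
      intro x y hxy
      rw [← smul_coefUnit X.isUnitary_source x, ← smul_coefUnit X.isUnitary_source y] at hxy ⊢
      rw [map_smul, map_smul] at hxy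
      rw [X.isUnitary_target.1.1 hxy]
    · intro x y _
      exact (X.isUnitary_source.2 p hp).elim _ _
  · let r : GradedOperad.Hom Q.gradedTrunc P.gradedTrunc := X.free_target.lift
      { map := fun l p => (X.inclM.map l p).comp (LinearMap.fst k _ _)
        map_act := fun σ x => X.inclM.map_act σ x.1 }
    have h : r.comp (Hom.trunc ι) = GradedOperad.Hom.id _ := X.free_source.hom_ext fun l p x => by
      change r.map l p ((Hom.trunc ι).map l p (X.inclM.map l p x)) = X.inclM.map l p x
      have e : (Hom.trunc ι).map l p (X.inclM.map l p x)
          = X.incl.map l p (show (X.M.sum X.E).obj l p from (x, 0)) :=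
        Subtype.ext (X.incl_M l p x).symm
      rw [e]
      exact X.free_target.lift_gen _ _
    have e : ∀ x : P.obj l p, r.map l p (Q.toTrunc (ι.map l p x)) = P.toTrunc x := fun x => by
      have h' := congrArg (fun f : GradedOperad.Hom P.gradedTrunc P.gradedTrunc =>
        f.map l p (P.toTrunc x)) h
      refine Eq.trans (congrArg _ (Subtype.ext ?_)) h'
      rw [Q.toTrunc_val hl]
      exact congrArg (ι.map l p) (P.toTrunc_val hl x).symm
    intro x y hxy
    have h' := congrArg Subtype.val ((e x).symm.trans ((by rw [hxy] : _ = _).trans (e y)))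
    rwa [P.toTrunc_val hl, P.toTrunc_val hl] at h'

/-- Up to the arity of the new generators `E`, the extension is spanned by `P` and `E`. -/
theorem exists_eq_map_add {l : ℕ} (hl : l ≤ m + 1) {p : ℤ} (y : Q.obj l p) :
    ∃ (x : P.obj l p) (e : X.E.obj l p), y = ι.map l p x + (X.incl.map l p (0, e)).1 := by
  have hone := X.one_le
  by_cases h0 : l = 0
  · subst h0
    by_cases hp : p = 0
    · subst hp
      refine ⟨coefUnit X.isUnitary_target y • u, 0, ?_⟩
      rw [map_smul, smul_coefUnit X.isUnitary_target y]
      exact ((congrArg (y + ·) ((X.incl.map 0 0 (0, 0)).2 rfl)).trans (add_zero y)).symm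
    · exact ⟨0, 0, (X.isUnitary_target.2 p hp).elim _ _⟩
  have hM : ∀ l : ℕ, l ≤ 1 → ∀ p : ℤ, Subsingleton ((X.M.sum X.E).obj l p) := fun l hl p => by
    have := X.M_trivial l hl p
    have := X.E_homogeneous l (by omega) p
    exact inferInstanceAs (Subsingleton (X.M.obj l p × X.E.obj l p))
  let S : ∀ l p, Submodule k (Q.gradedTrunc.obj l p) := fun l p =>
    { carrier := {y | l ≤ m + 1 → ∃ (x : P.gradedTrunc.obj l p) (e : X.E.obj l p),
        y = (Hom.trunc ι).map l p x + X.incl.map l p (show (X.M.sum X.E).obj l p from (0, e))}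
      add_mem' := fun {y y'} hy hy' hl => by
        obtain ⟨x, e, rfl⟩ := hy hl
        obtain ⟨x', e', rfl⟩ := hy' hl
        refine ⟨x + x', e + e', ?_⟩
        rw [map_add, add_add_add_comm, ← map_add (X.incl.map l p)]
        congr 2
        exact Prod.ext (add_zero 0) rfl
      zero_mem' := fun _ => ⟨0, 0, by
        rw [map_zero, zero_add]
        exact (map_zero (X.incl.map l p)).symm⟩
      smul_mem' := fun a y hy hl => by
        obtain ⟨x, e, rfl⟩ := hy hl
        refine ⟨a • x, a • e, ?_⟩
        rw [map_smul, smul_add, ← map_smul (X.incl.map l p)]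
        congr 2
        exact Prod.ext (smul_zero a) rfl }
  have key := X.free_target.induction S (fun l p x hl => by
      refine ⟨X.inclM.map l p x.1, x.2, ?_⟩
      have e : (Hom.trunc ι).map l p (X.inclM.map l p x.1)
          = X.incl.map l p (show (X.M.sum X.E).obj l p from (x.1, 0)) :=
        Subtype.ext (X.incl_M l p x.1).symm
      rw [e, ← map_add]
      congr 1
      exact Prod.ext (add_zero _).symm (zero_add _).symm)
    (fun _ => ⟨P.gradedTrunc.ident, 0, by
      rw [(Hom.trunc ι).map_ident]
      exact ((congrArg (Q.gradedTrunc.ident + ·) (map_zero (X.incl.map 1 0))).trans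
        (add_zero _)).symm⟩)
    (fun {l p} σ y hy hl => by
      obtain ⟨x, e, rfl⟩ := hy hl
      refine ⟨P.gradedTrunc.act σ x, X.E.act σ e, ?_⟩
      rw [map_add, (Hom.trunc ι).map_act, ← X.incl.map_act]
      congr 2
      exact Prod.ext (map_zero (X.M.act σ)) rfl)
    (fun {l l' n p q r} hn hr i y y' hy hy' hl => by
      have hi := i.2
      by_cases hl'0 : l' = 0
      · subst hl'0
        rw [(Q.subsingleton_gradedTrunc_zero q).elim y' 0, map_zero]
        exact Submodule.zero_mem (S n r) hl
      by_cases hl'1 : l' = 1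
      · subst hl'1
        obtain rfl : l = n := by omega
        obtain ⟨c, hc⟩ := exists_eq_smul_tr_ident hM X.free_target y'.1
        by_cases hq : q = 0
        · subst hq
          obtain rfl : p = r := by omega
          have e : Q.gradedTrunc.comp hn hr i y y' = c • y := Subtype.ext (by
            change Q.comp hn hr i y.1 y'.1 = c • y.1
            rw [hc, map_smul, comp_ident_tr, if_pos rfl, Q.tr_self])
          rw [e]
          exact Submodule.smul_mem (S l p) c hy hl
        · have e : Q.gradedTrunc.comp hn hr i y y' = 0 := Subtype.ext (by
            change Q.comp hn hr i y.1 y'.1 = 0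
            rw [hc, map_smul, comp_ident_tr, if_neg hq, smul_zero])
          rw [e]
          exact Submodule.zero_mem (S l r) hl
      by_cases hl1 : l = 1
      · subst hl1
        obtain rfl : l' = n := by omega
        obtain ⟨c, hc⟩ := exists_eq_smul_tr_ident hM X.free_target y.1
        by_cases hp : p = 0
        · subst hp
          obtain rfl : q = r := by omega
          have e : Q.gradedTrunc.comp hn hr i y y' = c • y' := Subtype.ext (by
            change Q.comp hn hr i y.1 y'.1 = c • y'.1
            rw [hc, map_smul, LinearMap.smul_apply, ident_comp_tr, if_pos rfl, Q.tr_self])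
          rw [e]
          exact Submodule.smul_mem (S l' q) c hy' hl
        · have e : Q.gradedTrunc.comp hn hr i y y' = 0 := Subtype.ext (by
            change Q.comp hn hr i y.1 y'.1 = 0
            rw [hc, map_smul, LinearMap.smul_apply, ident_comp_tr, if_neg hp, smul_zero])
          rw [e]
          exact Submodule.zero_mem (S l' r) hl
      · obtain ⟨x, e, rfl⟩ := hy (by omega)
        obtain ⟨x', e', rfl⟩ := hy' (by omega)
        obtain rfl := (X.E_homogeneous l (by omega) p).elim e 0
        obtain rfl := (X.E_homogeneous l' (by omega) q).elim e' 0
        refine ⟨P.gradedTrunc.comp hn hr i x x', 0, ?_⟩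
        have h0 : ∀ (l : ℕ) (p : ℤ), X.incl.map l p
            (show (X.M.sum X.E).obj l p from (0, 0)) = 0 := fun l p => map_zero (X.incl.map l p)
        rw [h0, h0, h0, add_zero, add_zero, add_zero, (Hom.trunc ι).map_comp])
    (Q.toTrunc y)
  obtain ⟨x, e, h⟩ := key hl
  have h' := congrArg Subtype.val h
  rw [Q.toTrunc_val h0] at h'
  exact ⟨x.1, e, h'⟩

/-- The extension does not change the parts of arity smaller than that of the new generators. -/
theorem surjective (X : UnitaryPrincipalExtension ι u m) {l : ℕ} (hl : l ≤ m) {p : ℤ} :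
    Function.Surjective (ι.map l p) := by
  intro y
  obtain ⟨x, e, rfl⟩ := X.exists_eq_map_add (by omega) y
  obtain rfl := (X.E_homogeneous l (by omega) p).elim e 0
  refine ⟨x, ?_⟩
  have h0 : (X.incl.map l p (show (X.M.sum X.E).obj l p from (0, 0))).1 = 0 :=
    congrArg Subtype.val (map_zero (X.incl.map l p))
  exact ((congrArg (ι.map l p x + ·) h0).trans (add_zero _)).symm

end UnitaryPrincipalExtension

end DGOperad

/-! ### Equivariant projections -/

/-- Averaging over the symmetric group makes a projection onto a stable subspace equivariant. -/
theorem SigmaModule.exists_equivariant_projection {k : Type u} [Field k] [CharZero k]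
    (M : SigmaModule k) {l : ℕ} {p : ℤ} (B : Submodule k (M.obj l p))
    (hB : ∀ (σ : Equiv.Perm (Fin l)) (x : M.obj l p), x ∈ B → M.act σ x ∈ B) :
    ∃ π : M.obj l p →ₗ[k] M.obj l p, (∀ x, π x ∈ B) ∧ (∀ x ∈ B, π x = x) ∧
      ∀ (σ : Equiv.Perm (Fin l)) (x : M.obj l p), π (M.act σ x) = M.act σ (π x) := by
  obtain ⟨g, hg⟩ := LinearMap.exists_leftInverse_of_injective B.subtype B.ker_subtype
  have hg' : ∀ x ∈ B, ((g x : B) : M.obj l p) = x := fun x hx =>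
    congrArg Subtype.val (LinearMap.congr_fun hg ⟨x, hx⟩)
  let S : M.obj l p →ₗ[k] M.obj l p :=
    ∑ σ : Equiv.Perm (Fin l), (M.act σ⁻¹).comp (B.subtype.comp (g.comp (M.act σ)))
  have hS : ∀ x, S x = ∑ σ : Equiv.Perm (Fin l), M.act σ⁻¹ (g (M.act σ x)).1 := fun x => by
    rw [LinearMap.sum_apply]
    rfl
  have hN : (Fintype.card (Equiv.Perm (Fin l)) : k) ≠ 0 :=
    Nat.cast_ne_zero.mpr Fintype.card_ne_zero
  refine ⟨(Fintype.card (Equiv.Perm (Fin l)) : k)⁻¹ • S, fun x => ?_, fun x hx => ?_,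
    fun τ x => ?_⟩
  · rw [LinearMap.smul_apply, hS]
    exact B.smul_mem _ (B.sum_mem fun σ _ => hB _ _ (g _).2)
  · rw [LinearMap.smul_apply, hS]
    have h : ∀ σ ∈ (Finset.univ : Finset (Equiv.Perm (Fin l))),
        M.act σ⁻¹ (g (M.act σ x)).1 = x := fun σ _ => by
      rw [hg' _ (hB σ x hx), ← M.act_mul, mul_inv_cancel, M.act_one]
    rw [Finset.sum_congr rfl h, Finset.sum_const, Finset.card_univ, ← Nat.cast_smul_eq_nsmul k,
      smul_smul, inv_mul_cancel₀ hN, one_smul]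
  · rw [LinearMap.smul_apply, LinearMap.smul_apply, map_smul, hS, hS, map_sum]
    congr 1
    refine Fintype.sum_equiv (Equiv.mulLeft τ) _ _ fun σ => ?_
    rw [Equiv.coe_mulLeft, ← M.act_mul, ← M.act_mul, mul_inv_rev, mul_assoc, inv_mul_cancel,
      mul_one]

namespace DGOperad

variable {k : Type u} [Field k]

/-! ### The generators of a principal extension that makes a morphism a quasi-isomorphism -/

/-- The boundaries of `P(l)ᵖ`. The degrees `p - 1 + 1` and `p` are identified by
`SigmaModule.tr`. -/
def boundaries (P : DGOperad k) (l : ℕ) (p : ℤ) : Submodule k (P.obj l p) :=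
  LinearMap.range (P.tr.comp (P.d l (p - 1)))

theorem mem_boundaries {P : DGOperad k} {l : ℕ} {p : ℤ} {x : P.obj l (p + 1)} :
    x ∈ P.boundaries l (p + 1) ↔ ∃ w, P.d l p w = x := by
  have key : ∀ r, r = p → ((∃ w, P.tr (P.d l r w) = x) ↔ ∃ w, P.d l p w = x) := by
    rintro r rfl
    simp only [SigmaModule.tr_self]
  exact key (p + 1 - 1) (by omega)

theorem d_eq_zero_of_mem_boundaries {P : DGOperad k} {l : ℕ} {p : ℤ} {x : P.obj l p}
    (hx : x ∈ P.boundaries l p) : P.d l p x = 0 := by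
  obtain ⟨r, rfl⟩ : ∃ r, p = r + 1 := ⟨p - 1, by omega⟩
  obtain ⟨w, rfl⟩ := mem_boundaries.mp hx
  exact P.d_d w

theorem act_mem_boundaries {P : DGOperad k} {l : ℕ} {p : ℤ} {x : P.obj l p}
    (σ : Equiv.Perm (Fin l)) (hx : x ∈ P.boundaries l p) : P.act σ x ∈ P.boundaries l p := by
  obtain ⟨r, rfl⟩ : ∃ r, p = r + 1 := ⟨p - 1, by omega⟩
  obtain ⟨w, rfl⟩ := mem_boundaries.mp hx
  exact mem_boundaries.mpr ⟨P.act σ w, P.d_act σ w⟩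

theorem d_res {P : DGOperad k} {v : P.obj 0 0} (hv : P.d 0 0 v = 0) {l : ℕ} {p : ℤ} (s : Fin l)
    (x : P.obj l p) : P.d (l - 1) p (P.res v s x) = P.res v s (P.d l p x) := by
  have hs := s.2
  rw [P.res_apply v s (by omega), P.res_apply v s (by omega), P.d_comp, hv, map_zero,
    smul_zero, add_zero]

theorem res_mem_boundaries {P : DGOperad k} {v : P.obj 0 0} (hv : P.d 0 0 v = 0) {l : ℕ} {p : ℤ}
    (s : Fin l) {x : P.obj l p} (hx : x ∈ P.boundaries l p) :
    P.res v s x ∈ P.boundaries (l - 1) p := by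
  obtain ⟨r, rfl⟩ : ∃ r, p = r + 1 := ⟨p - 1, by omega⟩
  obtain ⟨w, rfl⟩ := mem_boundaries.mp hx
  exact mem_boundaries.mpr ⟨P.res v s w, d_res hv s w⟩

theorem map_res {P Q : DGOperad k} (f : P ⟶ Q) (u : P.obj 0 0) {l : ℕ} {p : ℤ} (s : Fin l)
    (x : P.obj l p) :
    f.map (l - 1) p (P.res u s x) = Q.res (f.map 0 0 u) s (f.map l p x) :=
  f.map_comp _ _ s x u

section cells

variable {Q P : DGOperad k} (ρ : Q ⟶ P) (u : Q.obj 0 0)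

/-- The graded `Σ`-module of triples `(q, z, y)`, where `q` is a candidate for the differential of
a new generator, `z` for its image in `P`, and `y` for the family of its restrictions. -/
noncomputable def tripleModule : SigmaModule k where
  obj l p := Q.obj l (p + 1) × P.obj l p × (Fin l → Q.obj (l - 1) p)
  act {l p} σ := (Q.act σ).prodMap ((P.act σ).prodMap (LinearMap.pi fun s =>
    (Q.act (delPerm (by have := s.2; omega) σ s)).comp (LinearMap.proj (σ s))))
  act_one x := Prod.ext (Q.act_one _) (Prod.ext (P.act_one _) (funext fun s => by
    change Q.act (delPerm _ 1 s) (x.2.2 s) = x.2.2 s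
    rw [delPerm_one, Q.act_one]))
  act_mul σ τ x := Prod.ext (Q.act_mul _ _ _) (Prod.ext (P.act_mul _ _ _) (funext fun s => by
    change Q.act (delPerm _ (σ * τ) s) (x.2.2 (σ (τ s)))
      = Q.act (delPerm _ τ s) (Q.act (delPerm _ σ (τ s)) (x.2.2 (σ (τ s))))
    rw [delPerm_mul, Q.act_mul]))

/-- The triples `(q, z, y)` that satisfy the relations between the differential, the image and the
restrictions of a new generator: `d q = 0`, `ρ q = d z`, `d y_s = δ_s q`, `ρ y_s = δ_s z`, and the
compatibility of the `y_s` with iterated restrictions. -/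
def cellCocycles (l : ℕ) (p : ℤ) : Submodule k ((tripleModule (Q := Q) (P := P)).obj l p) where
  carrier := {t | Q.d l (p + 1) t.1 = 0 ∧ ρ.map l (p + 1) t.1 = P.d l p t.2.1 ∧
    (∀ s, Q.d (l - 1) p (t.2.2 s) = Q.res u s t.1) ∧
    (∀ s, ρ.map (l - 1) p (t.2.2 s) = P.res (ρ.map 0 0 u) s t.2.1) ∧
    ∀ (i j : Fin l) (i' j' : Fin (l - 1)), i < j → i'.1 = i.1 → j'.1 + 1 = j.1 →
      Q.res u i' (t.2.2 j) = Q.res u j' (t.2.2 i)}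
  add_mem' := by
    rintro t t' ⟨h1, h2, h3, h4, h5⟩ ⟨h1', h2', h3', h4', h5'⟩
    refine ⟨?_, ?_, fun s => ?_, fun s => ?_, fun i j i' j' h h' h'' => ?_⟩
    · exact (map_add _ _ _).trans (by rw [h1, h1', add_zero])
    · exact (map_add _ _ _).trans (by rw [h2, h2', ← map_add]; rfl)
    · exact (map_add _ _ _).trans (by rw [h3, h3', ← map_add]; rfl)
    · exact (map_add _ _ _).trans (by rw [h4, h4', ← map_add]; rfl)
    · exact (map_add _ _ _).trans
          (by rw [h5 i j i' j' h h' h'', h5' i j i' j' h h' h'', ← map_add]; rfl)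
  zero_mem' := by
    refine ⟨map_zero _, (map_zero _).trans (map_zero _).symm,
      fun s => (map_zero _).trans (map_zero _).symm, fun s => (map_zero _).trans (map_zero _).symm,
      fun i j i' j' _ _ _ => (map_zero _).trans (map_zero _).symm⟩
  smul_mem' := by
    rintro c t ⟨h1, h2, h3, h4, h5⟩
    refine ⟨?_, ?_, fun s => ?_, fun s => ?_, fun i j i' j' h h' h'' => ?_⟩
    · exact (map_smul _ _ _).trans (by rw [h1, smul_zero])
    · exact (map_smul _ _ _).trans (by rw [h2, ← map_smul]; rfl)
    · exact (map_smul _ _ _).trans (by rw [h3, ← map_smul]; rfl)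
    · exact (map_smul _ _ _).trans (by rw [h4, ← map_smul]; rfl)
    · exact (map_smul _ _ _).trans (by rw [h5 i j i' j' h h' h'', ← map_smul]; rfl)

theorem act_mem_cellCocycles {l : ℕ} {p : ℤ} (σ : Equiv.Perm (Fin l))
    {t : (tripleModule (Q := Q) (P := P)).obj l p} (ht : t ∈ cellCocycles ρ u l p) :
    tripleModule.act σ t ∈ cellCocycles ρ u l p := by
  obtain ⟨h1, h2, h3, h4, h5⟩ := ht
  refine ⟨?_, ?_, fun s => ?_, fun s => ?_, fun i j i' j' hij hi' hj' => ?_⟩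
  · change Q.d l (p + 1) (Q.act σ t.1) = 0
    rw [Q.d_act, h1, map_zero]
  · change ρ.map l (p + 1) (Q.act σ t.1) = P.d l p (P.act σ t.2.1)
    rw [ρ.map_act, h2, P.d_act]
  · have hs := s.2
    change Q.d (l - 1) p (Q.act (delPerm (by omega) σ s) (t.2.2 (σ s))) = Q.res u s (Q.act σ t.1)
    rw [Q.d_act, h3, Q.res_act u (by omega)]
  · have hs := s.2
    change ρ.map (l - 1) p (Q.act (delPerm (by omega) σ s) (t.2.2 (σ s)))
      = P.res (ρ.map 0 0 u) s (P.act σ t.2.1)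
    rw [ρ.map_act, h4, P.res_act _ (by omega)]
  · have hij' : i.1 < j.1 := hij
    have hj2 := j.2
    have hne : i ≠ j := fun h => by rw [h] at hij'; omega
    have hσ : (σ i).1 ≠ (σ j).1 := fun h => hne (σ.injective (Fin.ext h))
    have g1 : l = l - 1 + 1 := by omega
    have g2 : l - 1 = l - 1 - 1 + 1 := by omega
    have d1 := delPerm_val g1 σ j i hne i' (by split_ifs <;> omega)
    have d2 := delPerm_val g1 σ i j hne.symm j' (by split_ifs <;> omega)
    have hdel : delPerm g2 (delPerm g1 σ j) i' = delPerm g2 (delPerm g1 σ i) j' :=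
      delPerm_blockPerm_outer (m := 0) g1 g1 g2 g2 j i hne j' i' (by split_ifs <;> omega)
        (by split_ifs <;> omega) σ 1
    change Q.res u i' (Q.act (delPerm g1 σ j) (t.2.2 (σ j)))
      = Q.res u j' (Q.act (delPerm g1 σ i) (t.2.2 (σ i)))
    rw [Q.res_act u g2, Q.res_act u g2, hdel]
    congr 1
    rcases Nat.lt_or_gt_of_ne hσ with h | h
    · rw [if_pos h] at d1
      rw [if_neg (by omega)] at d2
      exact h5 (σ i) (σ j) _ _ h d1 (by omega)
    · rw [if_neg (by omega)] at d1
      rw [if_pos h] at d2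
      exact (h5 (σ j) (σ i) _ _ h d2 (by omega)).symm

/-- The boundaries of the mapping cone of `ρ` in arity `l`: the pairs `(d a, ρ a + b)`, where `b` is
a boundary. -/
def coneBoundaries (l : ℕ) (p : ℤ) : Submodule k (Q.obj l (p + 1) × P.obj l p) where
  carrier := {t | ∃ a : Q.obj l p, Q.d l p a = t.1 ∧ t.2 - ρ.map l p a ∈ P.boundaries l p}
  add_mem' := by
    rintro t t' ⟨a, h, h'⟩ ⟨b, g, g'⟩
    refine ⟨a + b, by rw [map_add, h, g]; rfl, ?_⟩
    rw [map_add]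
    have e := Submodule.add_mem _ h' g'
    rwa [sub_add_sub_comm] at e
  zero_mem' := ⟨0, map_zero _, by rw [map_zero]; simp⟩
  smul_mem' := by
    rintro c t ⟨a, h, h'⟩
    refine ⟨c • a, by rw [map_smul, h]; rfl, ?_⟩
    rw [map_smul]
    have e := Submodule.smul_mem _ c h'
    rwa [smul_sub] at e

theorem act_mem_coneBoundaries {l : ℕ} {p : ℤ} (σ : Equiv.Perm (Fin l)) {q : Q.obj l (p + 1)}
    {z : P.obj l p} (h : (q, z) ∈ coneBoundaries ρ l p) :
    (Q.act σ q, P.act σ z) ∈ coneBoundaries ρ l p := by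
  obtain ⟨a, h1, h2⟩ := h
  refine ⟨Q.act σ a, (Q.d_act σ a).trans (congrArg (Q.act σ) h1), ?_⟩
  rw [ρ.map_act]
  have e := act_mem_boundaries σ h2
  rwa [map_sub] at e

/-- The pair `(q, z)` of a triple `(q, z, y)`. -/
noncomputable def tripleToCone {l : ℕ} {p : ℤ} :
    (tripleModule (Q := Q) (P := P)).obj l p →ₗ[k] Q.obj l (p + 1) × P.obj l p :=
  LinearMap.prod (LinearMap.fst k _ _) ((LinearMap.fst k _ _).comp (LinearMap.snd k _ _))

/-- The triples in `cellCocycles` whose class in the cohomology of the cone of `ρ` is trivial. -/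
noncomputable def cellBoundaries (l : ℕ) (p : ℤ) :
    Submodule k ((tripleModule (Q := Q) (P := P)).obj l p) :=
  cellCocycles ρ u l p ⊓ (coneBoundaries ρ l p).comap tripleToCone

theorem act_mem_cellBoundaries {l : ℕ} {p : ℤ} (σ : Equiv.Perm (Fin l))
    {t : (tripleModule (Q := Q) (P := P)).obj l p} (ht : t ∈ cellBoundaries ρ u l p) :
    tripleModule.act σ t ∈ cellBoundaries ρ u l p :=
  ⟨act_mem_cellCocycles ρ u σ ht.1, act_mem_coneBoundaries ρ σ ht.2⟩

variable [CharZero k]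

/-- An equivariant projection onto `cellBoundaries`. -/
noncomputable def cellProj (l : ℕ) (p : ℤ) : (tripleModule (Q := Q) (P := P)).obj l p →ₗ[k]
    (tripleModule (Q := Q) (P := P)).obj l p :=
  (tripleModule.exists_equivariant_projection (cellBoundaries ρ u l p)
    (fun σ _ => act_mem_cellBoundaries ρ u σ)).choose

theorem cellProj_mem {l : ℕ} {p : ℤ} (t : (tripleModule (Q := Q) (P := P)).obj l p) :
    cellProj ρ u l p t ∈ cellBoundaries ρ u l p :=
  (tripleModule.exists_equivariant_projection (cellBoundaries ρ u l p)
    (fun σ _ => act_mem_cellBoundaries ρ u σ)).choose_spec.1 t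

theorem cellProj_eq {l : ℕ} {p : ℤ} {t : (tripleModule (Q := Q) (P := P)).obj l p}
    (h : t ∈ cellBoundaries ρ u l p) : cellProj ρ u l p t = t :=
  (tripleModule.exists_equivariant_projection (cellBoundaries ρ u l p)
    (fun σ _ => act_mem_cellBoundaries ρ u σ)).choose_spec.2.1 t h

theorem cellProj_act {l : ℕ} {p : ℤ} (σ : Equiv.Perm (Fin l))
    (t : (tripleModule (Q := Q) (P := P)).obj l p) :
    cellProj ρ u l p (tripleModule.act σ t) = tripleModule.act σ (cellProj ρ u l p t) :=
  (tripleModule.exists_equivariant_projection (cellBoundaries ρ u l p)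
    (fun σ _ => act_mem_cellBoundaries ρ u σ)).choose_spec.2.2 σ t

/-- The new generators in arity `m + 1`: an equivariant complement of `cellBoundaries` in
`cellCocycles`. -/
noncomputable def cells (m : ℕ) : SigmaModule k where
  obj l p := (cellCocycles ρ u l p ⊓ LinearMap.ker (cellProj ρ u l p) ⊓
    zeroWhen k (l ≠ m + 1) : Submodule k ((tripleModule (Q := Q) (P := P)).obj l p))
  act σ := (tripleModule.act σ).restrict (fun t ht =>
    ⟨⟨act_mem_cellCocycles ρ u σ ht.1.1, by
      have h : cellProj ρ u _ _ t = 0 := ht.1.2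
      change cellProj ρ u _ _ (tripleModule.act σ t) = 0
      rw [cellProj_act, h, map_zero]⟩,
    fun hl => by rw [ht.2 hl, map_zero]⟩)
  act_one t := Subtype.ext (tripleModule.act_one t.1)
  act_mul σ τ t := Subtype.ext (tripleModule.act_mul σ τ t.1)

variable {m : ℕ} {ρ u}

/-- The principal extension data given by `cells`. -/
noncomputable def cellData (hm : 1 ≤ m) (hu : Q.IsUnitary u) {M : SigmaModule k}
    (hM : ∀ l : ℕ, l ≤ 1 → ∀ p : ℤ, Subsingleton (M.obj l p))
    {i : SigmaModule.Hom M Q.gradedTrunc.toSigmaModule}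
    (hi : GradedOperad.IsFree M Q.gradedTrunc i) : CellData Q u m where
  one_le := hm
  isUnitary := hu
  M := M
  M_trivial := hM
  inclM := i
  free := hi
  E := cells ρ u m
  E_homogeneous l hl p := ⟨fun x y => Subtype.ext ((x.2.2 hl).trans (y.2.2 hl).symm)⟩
  dE := (LinearMap.fst k _ _).comp (Submodule.subtype _)
  dE_act _ _ := rfl
  dE_cocycle e := e.2.1.1.1
  δ s := (LinearMap.proj s).comp
    ((LinearMap.snd k _ _).comp ((LinearMap.snd k _ _).comp (Submodule.subtype _)))
  δ_act _ _ _ _ := rfl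
  δ_δ i j i' j' h h' h'' e := e.2.1.1.2.2.2.2 i j i' j' h h' h''
  δ_dE s e := e.2.1.1.2.2.1 s

/-- The extension of `ρ` to the new generators. -/
noncomputable def cellExtension (hm : 1 ≤ m) (hu : Q.IsUnitary u) {M : SigmaModule k}
    (hM : ∀ l : ℕ, l ≤ 1 → ∀ p : ℤ, Subsingleton (M.obj l p))
    {i : SigmaModule.Hom M Q.gradedTrunc.toSigmaModule}
    (hi : GradedOperad.IsFree M Q.gradedTrunc i) :
    (cellData (ρ := ρ) hm hu hM hi).Extension ρ where
  f := (LinearMap.fst k _ _).comp ((LinearMap.snd k _ _).comp (Submodule.subtype _))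
  f_act _ _ := rfl
  d_f e := e.2.1.1.2.1.symm
  res_f s e := (e.2.1.1.2.2.2.1 s).symm

end cells

end DGOperad

namespace DGOperad

variable {k : Type u} [Field k]

/-! ### The extension is a quasi-isomorphism in one more arity -/

section cells

variable {Q P : DGOperad k} {ρ : Q ⟶ P} {u : Q.obj 0 0}

/-- The property that each cocycle `(q, z)` of the mapping cone of `ρ` in arity `l` is, up to a
boundary, part of a triple in `cellCocycles`. -/
def ConeLifting (ρ : Q ⟶ P) (u : Q.obj 0 0) (l : ℕ) : Prop :=
  ∀ (p : ℤ) (q : Q.obj l (p + 1)) (z : P.obj l p), Q.d l (p + 1) q = 0 →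
    ρ.map l (p + 1) q = P.d l p z → ∃ t ∈ cellCocycles ρ u l p,
      (q - t.1, z - t.2.1) ∈ coneBoundaries ρ l p

variable [CharZero k] {m : ℕ}

/-- Each cohomology class of the mapping cone of `ρ` in arity `m + 1` is represented by a new
generator. -/
theorem exists_cell (h : ConeLifting ρ u (m + 1)) {p : ℤ} {q : Q.obj (m + 1) (p + 1)}
    {z : P.obj (m + 1) p} (hq : Q.d (m + 1) (p + 1) q = 0)
    (hz : ρ.map (m + 1) (p + 1) q = P.d (m + 1) p z) :
    ∃ e : (cells ρ u m).obj (m + 1) p,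
      (q - e.1.1, z - e.1.2.1) ∈ coneBoundaries ρ (m + 1) p := by
  obtain ⟨t, ht, htb⟩ := h p q z hq hz
  have hπ := cellProj_mem ρ u t
  refine ⟨⟨t - cellProj ρ u _ _ t, ⟨Submodule.sub_mem _ ht hπ.1, ?_⟩, fun h => absurd rfl h⟩, ?_⟩
  · change cellProj ρ u _ _ (t - cellProj ρ u _ _ t) = 0
    rw [map_sub, cellProj_eq ρ u hπ, sub_self]
  · have e := Submodule.add_mem _ htb hπ.2
    refine (congrArg (· ∈ coneBoundaries ρ (m + 1) p) (Prod.ext ?_ ?_)).mp e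
    · exact sub_add_eq_add_sub _ _ _ |>.trans (sub_sub_eq_add_sub q t.1 _).symm
    · exact sub_add_eq_add_sub _ _ _ |>.trans (sub_sub_eq_add_sub z t.2.1 _).symm

/-- A new generator with trivial cohomology class in the mapping cone of `ρ` vanishes. -/
theorem cell_eq_zero {p : ℤ} (e : (cells ρ u m).obj (m + 1) p)
    (h : (e.1.1, e.1.2.1) ∈ coneBoundaries ρ (m + 1) p) : e = 0 := by
  refine Subtype.ext ?_
  have h' : cellProj ρ u _ _ e.1 = 0 := e.2.1.2
  rw [cellProj_eq ρ u ⟨e.2.1.1, h⟩] at h'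
  exact h'

variable (hm : 1 ≤ m) (hu : Q.IsUnitary u) {M : SigmaModule k}
    (hM : ∀ l : ℕ, l ≤ 1 → ∀ p : ℤ, Subsingleton (M.obj l p))
    {i : SigmaModule.Hom M Q.gradedTrunc.toSigmaModule}
    (hi : GradedOperad.IsFree M Q.gradedTrunc i)

/-- The elements of arity `m + 1` of the extension are the sums `a + e` with `a` in `Q` and `e` a
generator, so that its mapping cone over `P` is the cone of `ρ` with its cohomology killed by the
generators. -/
theorem isQuisAt_cellExtension (h : ConeLifting ρ u (m + 1)) :
    IsQuisAt (cellExtension (ρ := ρ) hm hu hM hi).hom (m + 1) := by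
  let C := cellData (ρ := ρ) hm hu hM hi
  let X := cellExtension (ρ := ρ) hm hu hM hi
  have hι : ∀ {l p} (x : Q.obj l p), X.hom.map l p (C.ι.map l p x) = ρ.map l p x :=
    fun {l p} x => congrArg (fun f : Q ⟶ P => f.map l p x) X.ι_hom
  obtain ⟨J, hf, hd, hJ⟩ : ∃ J : ∀ p, (cells ρ u m).obj (m + 1) p →ₗ[k] C.target.obj (m + 1) p,
      (∀ p e, X.hom.map (m + 1) p (J p e) = e.1.2.1) ∧
      (∀ p e, C.target.d (m + 1) p (J p e) = C.ι.map (m + 1) (p + 1) e.1.1) ∧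
      ∀ p x, ∃ a e, x = C.ι.map (m + 1) p a + J p e :=
    ⟨fun p => (Submodule.subtype _).comp ((C.inclGen.map (m + 1) p).comp (LinearMap.inr k _ _)),
      fun p e => X.hom_inclGen e, fun p e => C.extension.d_incl p e,
      fun p x => C.extension.exists_eq_map_add le_rfl x⟩
  refine ⟨fun p x hx ⟨w, hw⟩ => ?_, fun p y hy => ?_⟩
  · obtain ⟨a, e, rfl⟩ := hJ _ x
    change C.target.d (m + 1) (p + 1) (C.ι.map (m + 1) (p + 1) a + J _ e) = 0 at hx
    change P.d (m + 1) p w = X.hom.map (m + 1) (p + 1) (C.ι.map (m + 1) (p + 1) a + J _ e) at hw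
    rw [map_add, ← C.ι.map_d, hd, ← map_add] at hx
    rw [map_add, hι, hf] at hw
    have hx' := C.extension.injective (hx.trans (map_zero _).symm)
    -- The pair `(d e, f e)` is the boundary of the element `-a` of the cone.
    have he : e = 0 := by
      refine cell_eq_zero e ⟨-a, ?_, ?_⟩
      · rw [map_neg]
        exact (eq_neg_of_add_eq_zero_right hx').symm
      · change e.1.2.1 - ρ.map _ _ (-a) ∈ _
        rw [map_neg, sub_neg_eq_add]
        exact mem_boundaries.mpr ⟨w, hw.trans (add_comm _ _)⟩
    subst he
    have h1 : Q.d (m + 1) (p + 1) a = 0 := by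
      rw [← hx']
      exact (add_zero _).symm
    have h2 : ρ.map (m + 1) (p + 1) a = P.d (m + 1) p w := by
      rw [hw]
      exact (add_zero _).symm
    -- The cocycle `(a, w)` of the cone is represented by a generator `e'`, and `d (q + e') = a`.
    obtain ⟨e', q, hq, -⟩ := exists_cell h h1 h2
    refine ⟨C.ι.map (m + 1) p q + J p e', ?_⟩
    change C.target.d (m + 1) p (C.ι.map (m + 1) p q + J p e') = _
    rw [map_add, ← C.ι.map_d, hd, ← map_add, hq, map_zero, add_zero]
    exact congrArg (C.ι.map (m + 1) (p + 1)) (sub_add_cancel _ _)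
  -- The cocycle `(0, y)` of the cone is represented by a generator `e`, and `q + e` maps to `y`.
  · obtain ⟨e, q, hq, b⟩ := exists_cell h (map_zero (Q.d (m + 1) (p + 1 + 1)))
      ((map_zero (ρ.map (m + 1) (p + 1 + 1))).trans hy.symm)
    obtain ⟨w, hw⟩ := mem_boundaries.mp b
    refine ⟨C.ι.map (m + 1) (p + 1) q + J (p + 1) e, w, ?_, ?_⟩
    · change C.target.d (m + 1) (p + 1) (C.ι.map (m + 1) (p + 1) q + J (p + 1) e) = 0
      rw [map_add, ← C.ι.map_d, hd, ← map_add, hq]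
      exact (congrArg (C.ι.map (m + 1) (p + 1 + 1)) (sub_add_cancel 0 e.1.1)).trans (map_zero _)
    · change y = X.hom.map (m + 1) (p + 1) (C.ι.map (m + 1) (p + 1) q + J (p + 1) e)
        + P.d (m + 1) p w
      rw [map_add, hι, hf, hw]
      change y = ρ.map _ _ q + e.1.2.1 + (y - e.1.2.1 - ρ.map _ _ q)
      abel

theorem isQuisAt_cellExtension_of_le {l : ℕ} (hl : l ≤ m) (h : IsQuisAt ρ l) :
    IsQuisAt (cellExtension (ρ := ρ) hm hu hM hi).hom l := by
  let C := cellData (ρ := ρ) hm hu hM hi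
  let X := cellExtension (ρ := ρ) hm hu hM hi
  have hι : ∀ {p} (x : Q.obj l p), X.hom.map l p (C.ι.map l p x) = ρ.map l p x :=
    fun {p} x => congrArg (fun f : Q ⟶ P => f.map l p x) X.ι_hom
  refine ⟨fun p x hx ⟨w, hw⟩ => ?_, fun p y hy => ?_⟩
  · obtain ⟨a, rfl⟩ := C.extension.surjective hl x
    change P.d l p w = X.hom.map l (p + 1) (C.ι.map l (p + 1) a) at hw
    rw [hι] at hw
    obtain ⟨v, rfl⟩ := h.1 p a (C.extension.injective
      ((C.ι.map_d a).trans (hx.trans (map_zero _).symm))) ⟨w, hw⟩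
    exact ⟨C.ι.map l p v, (C.ι.map_d v).symm⟩
  · obtain ⟨x, w, hx, rfl⟩ := h.2 p y hy
    refine ⟨C.ι.map l (p + 1) x, w, ?_, ?_⟩
    · refine (C.ι.map_d x).symm.trans ?_
      rw [hx, map_zero]
    · exact congrArg (· + P.d l p w) (hι x).symm

end cells

end DGOperad

/-! ### Elements with trivial restrictions -/

/-- Let `s_j` be sections of maps `δ_j`, as for the degeneracies and faces of a simplicial vector
space. If each `δ_j x` is a boundary, then `x` can be corrected by a boundary to an element on which
every `δ_j` vanishes. -/
theorem exists_forall_sub_eq_zero {k A A' : Type*} [Field k] [AddCommGroup A] [AddCommGroup A']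
    [Module k A] [Module k A'] {n : ℕ} (δ : Fin n → A →ₗ[k] A') (s : Fin n → A' →ₗ[k] A)
    (h₁ : ∀ j y, δ j (s j y) = y)
    (h₂ : ∀ i j, i < j → ∀ x, δ i x = 0 → δ i (s j (δ j x)) = 0)
    (B : Submodule k A) (B' : Submodule k A') (hs : ∀ j, ∀ y ∈ B', s j y ∈ B)
    (hδ : ∀ j, ∀ b ∈ B, δ j b ∈ B') (x : A) (hx : ∀ j, δ j x ∈ B') :
    ∃ b ∈ B, ∀ j, δ j (x - b) = 0 := by
  have key : ∀ N, N ≤ n → ∃ b ∈ B, ∀ j : Fin n, j.1 < N → δ j (x - b) = 0 := by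
    intro N
    induction N with
    | zero => exact fun _ => ⟨0, B.zero_mem, fun j hj => absurd hj (Nat.not_lt_zero _)⟩
    | succ N ih =>
      intro hN
      obtain ⟨b, hb, h⟩ := ih (by omega)
      let j₀ : Fin n := ⟨N, hN⟩
      -- The correction kills `δ_N` by `h₁` and does not affect the lower `δ_j` by `h₂`.
      refine ⟨b + s j₀ (δ j₀ (x - b)), B.add_mem hb (hs _ _ ?_), fun j hj => ?_⟩
      · rw [map_sub]
        exact B'.sub_mem (hx _) (hδ _ _ hb)
      · rw [← sub_sub, map_sub]
        rcases Nat.lt_succ_iff_lt_or_eq.mp hj with hj | hj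
        · rw [h j hj, h₂ j j₀ hj _ (h j hj), sub_zero]
        · obtain rfl : j = j₀ := Fin.ext hj
          rw [h₁, sub_self]
  obtain ⟨b, hb, h⟩ := key n le_rfl
  exact ⟨b, hb, fun j => h j j.2⟩

namespace GradedOperad

variable {k : Type u} [Field k] (G : GradedOperad k)

/-- The operations `x ↦ x ∘_j μ`, and `x ↦ μ ∘_0 x` for the last input, which are sections of the
restrictions if `μ` is a multiplication with a unit. -/
noncomputable def insertion (μ : G.obj 2 0) {l : ℕ} {p : ℤ} (j : Fin l) :
    G.obj (l - 1) p →ₗ[k] G.obj l p :=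
  if h : j.1 < l - 1 then
    (G.comp (by omega : l - 1 + 2 = l + 1) (add_zero p) ⟨j.1, h⟩).flip μ
  else G.comp (by have := j.2; omega : 2 + (l - 1) = l + 1) (zero_add p) 0 μ

variable {G} {u : G.obj 0 0} {μ : G.obj 2 0}

theorem insertion_of_lt {l : ℕ} {p : ℤ} {j : Fin l} (h : j.1 < l - 1) (hn : l - 1 + 2 = l + 1)
    (x : G.obj (l - 1) p) :
    G.insertion μ j x = G.comp hn (add_zero p) ⟨j.1, h⟩ x μ := by
  rw [insertion, dif_pos h]
  rfl

theorem insertion_of_not_lt {l : ℕ} {p : ℤ} {j : Fin l} (h : ¬ j.1 < l - 1)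
    (hn : 2 + (l - 1) = l + 1) (x : G.obj (l - 1) p) :
    G.insertion μ j x = G.comp hn (zero_add p) 0 μ x := by
  rw [insertion, dif_neg h]

theorem res_insertion (hμ : ∀ i : Fin 2, G.res u i μ = G.ident) {l : ℕ} {p : ℤ} (j : Fin l)
    (x : G.obj (l - 1) p) : G.res u j (G.insertion μ j x) = x := by
  have hj := j.2
  by_cases h : j.1 < l - 1
  · rw [insertion_of_lt h (by omega), G.res_comp_inner u _ _ _ _ _ j 0 rfl (by omega), hμ]
    exact G.comp_ident _ _ _ x
  · rw [insertion_of_not_lt h (by omega),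
      G.res_comp_outer u _ _ 0 _ _ j 1 (by decide) 0 (by
        change j.1 = if 1 < 0 then 1 else 1 + (l - 1) - 1
        rw [if_neg (by omega)]
        omega) rfl (by omega), hμ]
    exact G.ident_comp _ _ _ x

theorem res_insertion_of_lt {l : ℕ} {p : ℤ} (i j : Fin l) (hij : i < j) (x : G.obj (l - 1) p)
    (hx : ∀ i' : Fin (l - 1), i'.1 = i.1 → G.res u i' x = 0) :
    G.res u i (G.insertion μ j x) = 0 := by
  have hj := j.2
  have hij' : i.1 < j.1 := hij
  by_cases h : j.1 < l - 1
  · rw [insertion_of_lt h (by omega),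
      G.res_comp_outer u _ _ ⟨j.1, h⟩ _ _ i ⟨i.1, by omega⟩ (fun h' => by
        have := congrArg Fin.val h'
        simp only at this
        omega) ⟨j.1 - 1, by omega⟩ (by rw [if_pos hij']) (by
          simp only
          rw [if_neg (by omega)]) (by omega), hx _ rfl, map_zero, LinearMap.zero_apply]
  · rw [insertion_of_not_lt h (by omega),
      G.res_comp_inner u _ _ 0 _ _ i ⟨i.1, by omega⟩ (Nat.zero_add _).symm (by omega), hx _ rfl,
      map_zero]

end GradedOperad

namespace DGOperad

variable {k : Type u} [Field k]

theorem map_insertion {P Q : DGOperad k} (f : P ⟶ Q) (μ : P.obj 2 0) {l : ℕ} {p : ℤ} (j : Fin l)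
    (x : P.obj (l - 1) p) :
    f.map l p (P.insertion μ j x) = Q.insertion (f.map 2 0 μ) j (f.map (l - 1) p x) := by
  have hj := j.2
  by_cases h : j.1 < l - 1
  · rw [GradedOperad.insertion_of_lt h (by omega), GradedOperad.insertion_of_lt h (by omega),
      f.map_comp]
  · rw [GradedOperad.insertion_of_not_lt h (by omega),
      GradedOperad.insertion_of_not_lt h (by omega), f.map_comp]

theorem d_insertion {P : DGOperad k} {μ : P.obj 2 0} (hμ : P.d 2 0 μ = 0) {l : ℕ} {p : ℤ}
    (j : Fin l) (x : P.obj (l - 1) p) :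
    P.d l p (P.insertion μ j x) = P.insertion μ j (P.d (l - 1) p x) := by
  have hj := j.2
  by_cases h : j.1 < l - 1
  · rw [GradedOperad.insertion_of_lt h (by omega), GradedOperad.insertion_of_lt h (by omega),
      P.d_comp, hμ, map_zero, smul_zero, add_zero]
  · rw [GradedOperad.insertion_of_not_lt h (by omega),
      GradedOperad.insertion_of_not_lt h (by omega), P.d_comp, hμ, map_zero, LinearMap.zero_apply,
      zero_add, Int.negOnePow_zero, one_smul]

theorem insertion_mem_boundaries {P : DGOperad k} {μ : P.obj 2 0} (hμ : P.d 2 0 μ = 0) {l : ℕ}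
    {p : ℤ} (j : Fin l) {x : P.obj (l - 1) p} (hx : x ∈ P.boundaries (l - 1) p) :
    P.insertion μ j x ∈ P.boundaries l p := by
  obtain ⟨r, rfl⟩ : ∃ r, p = r + 1 := ⟨p - 1, by omega⟩
  obtain ⟨w, rfl⟩ := mem_boundaries.mp hx
  exact mem_boundaries.mpr ⟨P.insertion μ j w, d_insertion hμ j w⟩

/-- The vanishing of the lower restrictions of `x` is inherited by the insertion of a restriction of
`x`. -/
theorem _root_.GradedOperad.res_insertion_res {G : GradedOperad k} {u : G.obj 0 0} {μ : G.obj 2 0}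
    {l : ℕ} {p : ℤ} (i j : Fin l) (hij : i < j) (x : G.obj l p) (hx : G.res u i x = 0) :
    G.res u i (G.insertion μ j (G.res u j x)) = 0 :=
  GradedOperad.res_insertion_of_lt i j hij _ fun i' hi' => by
    have hij' : i.1 < j.1 := hij
    have hj := j.2
    rw [G.res_res u i j i' ⟨j.1 - 1, by omega⟩ hij hi' (by simp only; omega), hx, map_zero]

section lifting

variable {Q P : DGOperad k} {ρ : Q ⟶ P} {u : Q.obj 0 0}

/-- The mapping cone of a quasi-isomorphism is acyclic. -/
theorem IsQuisAt.mem_coneBoundaries {l : ℕ} (h : IsQuisAt ρ l) {p : ℤ} {q : Q.obj l (p + 1)}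
    {z : P.obj l p} (hq : Q.d l (p + 1) q = 0) (hz : ρ.map l (p + 1) q = P.d l p z) :
    (q, z) ∈ coneBoundaries ρ l p := by
  obtain ⟨a, rfl⟩ := h.1 p q hq ⟨z, hz.symm⟩
  obtain ⟨r, rfl⟩ : ∃ r, p = r + 1 := ⟨p - 1, by omega⟩
  obtain ⟨x, w, hx, hw⟩ := h.2 r (z - ρ.map l (r + 1) a) (by rw [map_sub, ← hz, ρ.map_d, sub_self])
  refine ⟨a + x, by rw [map_add, hx, add_zero], mem_boundaries.mpr ⟨w, ?_⟩⟩
  rw [map_add, ← sub_sub]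
  change _ = z - ρ.map l (r + 1) a - _
  rw [hw, add_sub_cancel_left]

/-- If `ρ` is a quasi-isomorphism in arity `l - 1`, each cocycle of its mapping cone in arity `l` is
cohomologous to one with trivial restrictions. -/
theorem coneLifting_of_multiplication {l : ℕ} (h : IsQuisAt ρ (l - 1)) (hu : Q.d 0 0 u = 0)
    {μ : Q.obj 2 0} (hμ : Q.d 2 0 μ = 0) (hμu : ∀ i, Q.res u i μ = Q.ident) :
    ConeLifting ρ u l := by
  have hv : P.d 0 0 (ρ.map 0 0 u) = 0 := by rw [← ρ.map_d, hu, map_zero]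
  have hν : P.d 2 0 (ρ.map 2 0 μ) = 0 := by rw [← ρ.map_d, hμ, map_zero]
  have hνu : ∀ i, P.res (ρ.map 0 0 u) i (ρ.map 2 0 μ) = P.ident := fun i => by
    rw [← map_res ρ u i, hμu]
    exact ρ.map_ident
  intro p q z hq hz
  obtain ⟨⟨q', z'⟩, ⟨a, ha, hb⟩, h0⟩ := exists_forall_sub_eq_zero
    (fun j : Fin l => (Q.res u j (p := p + 1)).prodMap (P.res (ρ.map 0 0 u) j (p := p)))
    (fun j => (Q.insertion μ j).prodMap (P.insertion (ρ.map 2 0 μ) j))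
    (fun j y => Prod.ext (GradedOperad.res_insertion hμu j y.1)
      (GradedOperad.res_insertion hνu j y.2))
    (fun i j hij x hx => Prod.ext
      (GradedOperad.res_insertion_res i j hij x.1 (congrArg Prod.fst hx))
      (GradedOperad.res_insertion_res i j hij x.2 (congrArg Prod.snd hx)))
    (coneBoundaries ρ l p) (coneBoundaries ρ (l - 1) p)
    (by
      rintro j ⟨y, y'⟩ ⟨a, ha, hb⟩
      refine ⟨Q.insertion μ j a, (d_insertion hμ j a).trans (congrArg _ ha), ?_⟩
      rw [map_insertion]
      have e := insertion_mem_boundaries hν j hb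
      rwa [map_sub] at e)
    (by
      rintro j ⟨y, y'⟩ ⟨a, ha, hb⟩
      refine ⟨Q.res u j a, (d_res hu j a).trans (congrArg _ ha), ?_⟩
      rw [map_res]
      have e := res_mem_boundaries hv j hb
      rwa [map_sub] at e)
    (q, z) (fun j => h.mem_coneBoundaries (by
      change Q.d (l - 1) (p + 1) (Q.res u j q) = 0
      rw [d_res hu, hq, map_zero]) (by
      change ρ.map (l - 1) (p + 1) (Q.res u j q) = P.d (l - 1) p (P.res (ρ.map 0 0 u) j z)
      rw [map_res, hz, d_res hv]))
  change Q.d l p a = q' at ha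
  subst ha
  -- The corrected pair has trivial restrictions, and the family `y = 0` completes it to a triple.
  refine ⟨(q - Q.d l p a, z - z', 0), ⟨?_, ?_, fun s => ?_, fun s => ?_, ?_⟩, a, ?_, ?_⟩
  · change Q.d l (p + 1) (q - Q.d l p a) = 0
    rw [map_sub, hq, Q.d_d, sub_zero]
  · change ρ.map l (p + 1) (q - Q.d l p a) = P.d l p (z - z')
    have hb' := d_eq_zero_of_mem_boundaries hb
    rw [map_sub, sub_eq_zero] at hb'
    rw [map_sub, map_sub, hz, ρ.map_d]
    congr 1
    exact hb'.symm
  · exact (map_zero _).trans (congrArg Prod.fst (h0 s)).symm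
  · exact (map_zero _).trans (congrArg Prod.snd (h0 s)).symm
  · intro i j i' j' _ _ _
    exact (map_zero _).trans (map_zero _).symm
  · exact (sub_sub_cancel q _).symm
  · change z - (z - z') - ρ.map l p a ∈ _
    rw [sub_sub_cancel]
    exact hb

end lifting

end DGOperad

namespace DGOperad

variable {k : Type u} [Field k]

section lifting

variable {Q P : DGOperad k} {ρ : Q ⟶ P} {u : Q.obj 0 0}

theorem IsUnitary.ne_zero (hu : Q.IsUnitary u) {c : k} (h : c • u = 0) : c = 0 :=
  hu.1.1 (h.trans (zero_smul k u).symm)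

theorem d_tr_ident (G : DGOperad k) (p : ℤ) : G.d 1 p (G.tr G.ident) = 0 := by
  by_cases hp : p = 0
  · subst hp
    rw [G.tr_self]
    exact G.differential.d_ident
  · rw [G.tr_of_ne (fun h => hp h.2.symm), map_zero]

theorem map_tr_ident {G H : DGOperad k} (f : G ⟶ H) (p : ℤ) :
    f.map 1 p (G.tr G.ident) = H.tr H.ident := by
  by_cases hp : p = 0
  · subst hp
    rw [G.tr_self, H.tr_self, f.map_ident]
  · rw [G.tr_of_ne (fun h => hp h.2.symm), H.tr_of_ne (fun h => hp h.2.symm), map_zero]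

/-- The image of the unit is not a boundary. -/
theorem IsQuisAt.eq_zero_of_smul_unit_mem (h : IsQuisAt ρ 0) (hu : Q.IsUnitary u) {c : k}
    (hc : c • ρ.map 0 0 u ∈ P.boundaries 0 0) : c = 0 := by
  obtain ⟨w, hw⟩ := (mem_boundaries (p := -1)).mp hc
  obtain ⟨v, hv⟩ := h.1 (-1) (c • u) (hu.d_eq_zero _) ⟨w, hw.trans (map_smul _ _ _).symm⟩
  refine hu.ne_zero (hv.symm.trans ?_)
  rw [(hu.2 (-1) (by decide)).elim v 0, map_zero]

/-- The identity of `P` is not a boundary. -/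
theorem IsQuisAt.eq_zero_of_smul_ident_mem (h : IsQuisAt ρ 1) (hu : Q.IsUnitary u)
    (hQ : ∀ (p : ℤ) (x : Q.obj 1 p), ∃ c : k, x = c • Q.tr Q.ident) {c : k}
    (hc : c • P.ident ∈ P.boundaries 1 0) : c = 0 := by
  obtain ⟨w, hw⟩ := (mem_boundaries (p := -1)).mp hc
  obtain ⟨v, hv⟩ := h.1 (-1) (c • Q.ident) ((map_smul _ _ _).trans
    ((congrArg (c • ·) Q.differential.d_ident).trans (smul_zero c)))
    ⟨w, hw.trans ((congrArg (c • ·) ρ.map_ident.symm).trans (map_smul _ _ _).symm)⟩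
  obtain ⟨a, rfl⟩ := hQ _ v
  rw [map_smul, d_tr_ident, smul_zero] at hv
  have e := congrArg (fun x : Q.obj 1 0 =>
    Q.comp (show 1 + 0 = 0 + 1 from rfl) (add_zero 0) 0 x u) hv
  simp only [map_smul, LinearMap.smul_apply] at e
  refine hu.ne_zero (Eq.trans ?_ (e.symm.trans ?_))
  · exact (congrArg (c • ·) (Q.ident_comp (m := 0) (q := 0) rfl rfl 0 u)).symm
  · exact LinearMap.map_zero₂ _ _

variable {v : P.obj 0 0} {μ : P.obj 2 0}

/-- A unital multiplication on `P` lifts to a strictly unital one on `Q`, since the restrictions of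
a lift are multiples of the identity. -/
theorem exists_multiplication (h1 : IsQuisAt ρ 1) (h2 : IsQuisAt ρ 2) (hu : Q.IsUnitary u)
    (hQ : ∀ (p : ℤ) (x : Q.obj 1 p), ∃ c : k, x = c • Q.tr Q.ident)
    (hv : ρ.map 0 0 u = v) (hμ : P.d 2 0 μ = 0) (hμv : ∀ i, P.res v i μ = P.ident) :
    ∃ ν : Q.obj 2 0, Q.d 2 0 ν = 0 ∧ ∀ i, Q.res u i ν = Q.ident := by
  subst hv
  have hv : P.d 0 0 (ρ.map 0 0 u) = 0 := by rw [← ρ.map_d, hu.d_eq_zero, map_zero]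
  obtain ⟨x, w, hx, hxw⟩ := h2.2 (-1) (show P.obj 2 (-1 + 1) from μ) hμ
  refine ⟨x, hx, fun i => ?_⟩
  obtain ⟨c, hc⟩ := hQ 0 (Q.res u i (show Q.obj 2 0 from x))
  rw [Q.tr_self] at hc
  have e : (1 - c) • P.ident = P.res (ρ.map 0 0 u) i (P.d 2 (-1) w) := by
    have h := congrArg (P.res (ρ.map 0 0 u) i) hxw
    rw [map_add, ← map_res] at h
    rw [sub_smul, one_smul, sub_eq_iff_eq_add']
    refine (hμv i).symm.trans (h.trans ?_)
    refine congrArg (· + _) ((congrArg (ρ.map 1 0) hc).trans ((map_smul _ _ _).trans ?_))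
    rw [ρ.map_ident]
  have hc1 : 1 - c = 0 := h1.eq_zero_of_smul_ident_mem hu hQ (by
    rw [e]
    exact (mem_boundaries (p := -1)).mpr ⟨_, d_res hv i w⟩)
  rw [sub_eq_zero] at hc1
  rw [← hc1, one_smul] at hc
  exact hc

/-- If `Q(2) = 0`, as for `Q = I₊`, each cocycle of `P(2)` is, up to a boundary, one whose
restrictions are equal multiples of the identity, and these lift to `Q`. -/
theorem coneLifting_two (h0 : IsQuisAt ρ 0) (h1 : IsQuisAt ρ 1) (hu : Q.IsUnitary u)
    (hQ : ∀ (p : ℤ) (x : Q.obj 1 p), ∃ c : k, x = c • Q.tr Q.ident)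
    (hQ2 : ∀ p, Subsingleton (Q.obj 2 p))
    (hv : ρ.map 0 0 u = v) (hμ : P.d 2 0 μ = 0) (hμv : ∀ i, P.res v i μ = P.ident) :
    ConeLifting ρ u 2 := by
  subst hv
  have hv : P.d 0 0 (ρ.map 0 0 u) = 0 := by rw [← ρ.map_d, hu.d_eq_zero, map_zero]
  intro p q z hq hz
  obtain rfl := (hQ2 _).elim q 0
  rw [map_zero] at hz
  have hc : ∀ i : Fin 2, ∃ c : k,
      P.res (ρ.map 0 0 u) i z - c • (P.tr P.ident : P.obj 1 p) ∈ P.boundaries 1 p := by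
    intro i
    have hi : P.d 1 p (P.res (ρ.map 0 0 u) i z) = 0 := by
      refine (d_res hv i z).trans ?_
      rw [← hz, map_zero]
    obtain ⟨r, rfl⟩ : ∃ r, p = r + 1 := ⟨p - 1, by omega⟩
    obtain ⟨x, w, hx, hxw⟩ := h1.2 r _ hi
    obtain ⟨c, rfl⟩ := hQ _ x
    refine ⟨c, mem_boundaries.mpr ⟨w, ?_⟩⟩
    rw [map_smul, map_tr_ident] at hxw
    exact (sub_eq_of_eq_add' hxw).symm
  -- The two multiples are equal, since further restriction to arity `0` gives `c i • u`, the double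
  -- restrictions agree, and `u` is not a boundary.
  obtain ⟨c, hc⟩ : ∃ c : k, ∀ i : Fin 2,
      P.res (ρ.map 0 0 u) i z - c • (P.tr P.ident : P.obj 1 p) ∈ P.boundaries 1 p := by
    choose c hc using hc
    by_cases hp : p = 0
    · subst hp
      refine ⟨c 0, fun i => ?_⟩
      have e : c 1 = c 0 := by
        have e0 := res_mem_boundaries hv (0 : Fin 1) (hc 0)
        have e1 := res_mem_boundaries hv (0 : Fin 1) (hc 1)
        have e2 := P.res_res (ρ.map 0 0 u) (0 : Fin 2) 1 0 0 (by decide) rfl rfl z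
        have e3 : P.res (ρ.map 0 0 u) (0 : Fin 1) P.ident = ρ.map 0 0 u :=
          P.ident_comp (m := 0) (q := 0) rfl rfl 0 _
        rw [P.tr_self, map_sub, map_smul, e3] at e0 e1
        have e4 := Submodule.sub_mem _ e0 e1
        have e5 : (c 1 - c 0) • ρ.map 0 0 u ∈ P.boundaries 0 0 := by
          convert e4 using 1
          rw [sub_smul]
          change _ = P.res (ρ.map 0 0 u) (0 : Fin 1) (P.res (ρ.map 0 0 u) 0 z) - _
            - (P.res (ρ.map 0 0 u) (0 : Fin 1) (P.res (ρ.map 0 0 u) 1 z) - _)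
          rw [show P.res (ρ.map 0 0 u) (0 : Fin 1) (P.res (ρ.map 0 0 u) 1 z)
            = P.res (ρ.map 0 0 u) (0 : Fin 1) (P.res (ρ.map 0 0 u) 0 z) from e2]
          abel
        exact sub_eq_zero.mp (h0.eq_zero_of_smul_unit_mem hu e5)
      fin_cases i
      · exact hc 0
      · exact e ▸ hc 1
    · refine ⟨0, fun i => ?_⟩
      have e := hc i
      rwa [P.tr_of_ne (fun h => hp h.2.symm), smul_zero] at e ⊢
  have hμp : ∀ i : Fin 2, P.res (ρ.map 0 0 u) i (P.tr μ : P.obj 2 p)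
      = (P.tr P.ident : P.obj 1 p) := by
    intro i
    by_cases hp : p = 0
    · subst hp
      rw [P.tr_self, P.tr_self, hμv]
    · rw [P.tr_of_ne (fun h => hp h.2.symm), P.tr_of_ne (fun h => hp h.2.symm), map_zero]
  -- The restrictions of `z - c μ` are boundaries.
  obtain ⟨b, hb, h⟩ := exists_forall_sub_eq_zero
    (fun j : Fin 2 => (P.res (ρ.map 0 0 u) j (p := p)))
    (fun j => P.insertion μ j) (fun j y => GradedOperad.res_insertion hμv j y)
    (fun i j hij x hx => GradedOperad.res_insertion_res i j hij x hx)
    (P.boundaries 2 p) (P.boundaries 1 p) (fun j y hy => insertion_mem_boundaries hμ j hy)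
    (fun j y hy => res_mem_boundaries hv j hy) (z - c • P.tr μ) (fun j => by
      rw [map_sub, map_smul, hμp]
      exact hc j)
  have hres : ∀ j : Fin 2, P.res (ρ.map 0 0 u) j (z - b) = c • (P.tr P.ident : P.obj 1 p) := by
    intro j
    have e := h j
    rw [sub_right_comm, map_sub, map_smul, hμp, sub_eq_zero] at e
    exact e
  refine ⟨(0, z - b, fun _ => c • (Q.tr Q.ident : Q.obj 1 p)),
    ⟨map_zero _, ?_, fun s => ?_, fun s => ?_, fun i j i' j' _ _ _ => ?_⟩, 0, ?_, ?_⟩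
  · change ρ.map 2 (p + 1) 0 = P.d 2 p (z - b)
    rw [map_zero, map_sub, ← hz, d_eq_zero_of_mem_boundaries hb, sub_zero]
  · change Q.d 1 p (c • Q.tr Q.ident) = Q.res u s 0
    rw [map_smul, d_tr_ident, smul_zero, map_zero]
  · change ρ.map 1 p (c • Q.tr Q.ident) = P.res (ρ.map 0 0 u) s (z - b)
    rw [map_smul, map_tr_ident, hres]
  · have e : i' = j' := Fin.ext (by have := i'.2; have := j'.2; omega)
    rw [e]
  · exact (map_zero _).trans (sub_zero _).symm
  · change z - (z - b) - ρ.map 2 p 0 ∈ _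
    rw [sub_sub_cancel, map_zero, sub_zero]
    exact hb

end lifting

end DGOperad

/-! ### The initial unitary operad -/

section

variable {k : Type u} [Field k]

namespace InitPlus

/-- The sum of the coefficients of an element of `I₊`. -/
noncomputable def augmentation {l : ℕ} {p : ℤ} : (InitPlus k).obj l p →ₗ[k] k :=
  (Finsupp.linearCombination k (fun _ => (1 : k))).comp (Submodule.subtype (zeroWhen k (p ≠ 0)))

/-- The basis of `I₊`, transported to an operad `R` along an element `v` of arity `0`: the identity
in arity `1`, the element `v` in arity `0`, and zero elsewhere. -/
def basisImage (R : GradedOperad k) (v : R.obj 0 0) (l : ℕ) (p : ℤ) : R.obj l p :=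
  R.tr R.ident + R.tr v

variable (R : GradedOperad k) (v : R.obj 0 0)

theorem basisImage_one : basisImage R v 1 0 = R.ident := by
  rw [basisImage, R.tr_self, R.tr_of_ne (by simp), add_zero]

theorem basisImage_zero : basisImage R v 0 0 = v := by
  rw [basisImage, R.tr_self, R.tr_of_ne (by simp), zero_add]

theorem augmentation_ident : augmentation (InitPlus k).ident = 1 := by
  change Finsupp.linearCombination k (fun _ => (1 : k)) (Finsupp.single _ 1) = 1
  simp

theorem augmentation_unit : augmentation (InitPlus.unit k) = 1 := by
  exact (Finsupp.linearCombination_single k (1 : k) _).trans (mul_one 1)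

theorem augmentation_comp {l m n : ℕ} {p q r : ℤ} (hn : l + m = n + 1) (hr : p + q = r) (i : Fin l)
    (x : (InitPlus k).obj l p) (y : (InitPlus k).obj m q) :
    augmentation ((InitPlus k).comp hn hr i x y) = augmentation x * augmentation y := by
  change Finsupp.linearCombination k (fun _ => (1 : k)) (bilinExt k (initSet.comp hn i) x.1 y.1)
    = Finsupp.linearCombination k (fun _ => (1 : k)) x.1
      * Finsupp.linearCombination k (fun _ => (1 : k)) y.1
  generalize x.1 = f
  generalize y.1 = g
  induction f using Finsupp.induction_linear with
  | zero => simp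
  | add f f' hf hf' => simp only [map_add, LinearMap.add_apply, hf, hf', add_mul]
  | single a s =>
    induction g using Finsupp.induction_linear with
    | zero => simp
    | add g g' hg hg' => simp only [map_add, hg, hg', mul_add]
    | single b t =>
      rw [bilinExt_single, Finsupp.linearCombination_single, Finsupp.linearCombination_single,
        Finsupp.linearCombination_single, smul_eq_mul, smul_eq_mul, smul_eq_mul, mul_one, mul_one,
        mul_one]

theorem eq_zero_of_not {l : ℕ} {p : ℤ} (h : ¬ (l ≤ 1 ∧ p = 0)) (x : (InitPlus k).obj l p) :
    x = 0 := by
  by_cases hp : p = 0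
  · refine Subtype.ext (Finsupp.ext fun a => ?_)
    exact absurd ⟨a.down, hp⟩ h
  · exact Subtype.ext (x.2 hp)

theorem augmentation_injective {l : ℕ} {p : ℤ} :
    Function.Injective (augmentation : (InitPlus k).obj l p →ₗ[k] k) := by
  rw [injective_iff_map_eq_zero]
  intro x hx
  by_cases h : l ≤ 1 ∧ p = 0
  · refine Subtype.ext ?_
    have e : x.1 = Finsupp.single (show initSet.obj l from ⟨h.1⟩) (x.1 ⟨h.1⟩) :=
      Finsupp.ext fun a => by
        rw [show a = ⟨h.1⟩ from rfl, Finsupp.single_eq_same]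
    change Finsupp.linearCombination k (fun _ => (1 : k)) x.1 = 0 at hx
    rw [e] at hx ⊢
    rw [Finsupp.linearCombination_single, smul_eq_mul, mul_one] at hx
    rw [hx, Finsupp.single_zero]
    rfl
  · exact eq_zero_of_not h x

theorem eq_smul {l : ℕ} {p : ℤ} (x : (InitPlus k).obj l p) :
    x = augmentation x • basisImage (InitPlus k).toGradedOperad (InitPlus.unit k) l p := by
  by_cases h : l ≤ 1 ∧ p = 0
  · obtain ⟨hl, rfl⟩ := h
    apply augmentation_injective
    rw [map_smul]
    rcases Nat.le_one_iff_eq_zero_or_eq_one.mp hl with rfl | rfl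
    · rw [basisImage_zero, augmentation_unit, smul_eq_mul, mul_one]
    · rw [basisImage_one, augmentation_ident, smul_eq_mul, mul_one]
  · exact (eq_zero_of_not h _).trans (eq_zero_of_not h _).symm

/-- The morphism of graded operads from `I₊` that sends the unit to `v`. -/
noncomputable def gradedDesc : GradedOperad.Hom (InitPlus k).toGradedOperad R where
  map l p := (LinearMap.toSpanSingleton k _ (basisImage R v l p)).comp augmentation
  map_act {l p} σ x := by
    change augmentation ((InitPlus k).act σ x) • basisImage R v l p
      = R.act σ (augmentation x • basisImage R v l p)
    by_cases h : l ≤ 1 ∧ p = 0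
    · have : Subsingleton (Equiv.Perm (Fin l)) := by
        rcases Nat.le_one_iff_eq_zero_or_eq_one.mp h.1 with rfl | rfl <;> infer_instance
      rw [Subsingleton.elim σ 1, R.act_one, SigmaModule.act_one]
    · rw [eq_zero_of_not h x, map_zero, map_zero, zero_smul, map_zero]
  map_ident := by
    change augmentation (InitPlus k).ident • basisImage R v 1 0 = R.ident
    rw [augmentation_ident, basisImage_one, one_smul]
  map_comp {l m n p q r} hn hr i x y := by
    have hi := i.2
    change augmentation ((InitPlus k).comp hn hr i x y) • basisImage R v n r
      = R.comp hn hr i (augmentation x • basisImage R v l p) (augmentation y • basisImage R v m q)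
    rw [augmentation_comp]
    by_cases h : l ≤ 1 ∧ p = 0
    · obtain ⟨hl, rfl⟩ := h
      obtain rfl : l = 1 := by omega
      obtain rfl : n = m := by omega
      obtain rfl : q = r := by omega
      rw [basisImage_one, map_smul, map_smul, LinearMap.smul_apply, R.ident_comp, smul_smul,
        mul_comm]
    · rw [eq_zero_of_not h x, map_zero, zero_mul, zero_smul, zero_smul, map_zero,
        LinearMap.zero_apply]

/-- The morphism of dg operads from `I₊` that sends the unit to the cocycle `v`. -/
noncomputable def desc (P : DGOperad k) (v : P.obj 0 0) (hv : P.d 0 0 v = 0) : InitPlus k ⟶ P :=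
  show DGOperad.Hom (InitPlus k) P from
  { gradedDesc P.toGradedOperad v with
    map_d := fun {l p} x => by
      change augmentation (0 : (InitPlus k).obj l (p + 1)) • basisImage P.toGradedOperad v l (p + 1)
        = P.d l p (augmentation x • basisImage P.toGradedOperad v l p)
      rw [map_zero, zero_smul, map_smul]
      by_cases h : l ≤ 1 ∧ p = 0
      · obtain ⟨hl, rfl⟩ := h
        rcases Nat.le_one_iff_eq_zero_or_eq_one.mp hl with rfl | rfl
        · rw [basisImage_zero, hv, smul_zero]
        · rw [basisImage_one]
          exact ((congrArg _ P.differential.d_ident).trans (smul_zero _)).symm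
      · rw [eq_zero_of_not h x, map_zero, zero_smul] }

theorem desc_apply (P : DGOperad k) (v : P.obj 0 0) (hv : P.d 0 0 v = 0) {l : ℕ} {p : ℤ}
    (x : (InitPlus k).obj l p) :
    (desc P v hv).map l p x = augmentation x • basisImage P.toGradedOperad v l p := rfl

theorem desc_unit (P : DGOperad k) (v : P.obj 0 0) (hv : P.d 0 0 v = 0) :
    (desc P v hv).map 0 0 (InitPlus.unit k) = v := by
  rw [desc_apply, augmentation_unit, basisImage_zero, one_smul]

theorem isUnitary : (InitPlus k).IsUnitary (InitPlus.unit k) := by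
  refine ⟨⟨fun a b h => ?_, fun x => ⟨augmentation x, ?_⟩⟩, fun p hp => ⟨fun x y => ?_⟩⟩
  · have e := congrArg augmentation (show a • InitPlus.unit k = b • InitPlus.unit k from h)
    rwa [map_smul, map_smul, augmentation_unit, smul_eq_mul, smul_eq_mul, mul_one, mul_one] at e
  · have e := eq_smul x
    rw [basisImage_zero] at e
    exact e.symm
  · exact (eq_zero_of_not (fun h => hp h.2) x).trans (eq_zero_of_not (fun h => hp h.2) y).symm

end InitPlus

/-- The zero graded `Σ`-module. -/
def SigmaModule.zero (k : Type u) [Field k] : SigmaModule k where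
  obj _ _ := PUnit
  act _ := LinearMap.id
  act_one _ := rfl
  act_mul _ _ _ := rfl

/-- The map from the zero graded `Σ`-module. -/
def SigmaModule.fromZero (N : SigmaModule k) : SigmaModule.Hom (SigmaModule.zero k) N where
  map _ _ := 0
  map_act _ _ := (map_zero _).symm

/-- The truncation of `I₊` is the initial graded operad. -/
theorem InitPlus.isFree : GradedOperad.IsFree (SigmaModule.zero k) (InitPlus k).gradedTrunc
    (SigmaModule.fromZero _) := by
  intro R f
  refine ⟨(InitPlus.gradedDesc R 0).comp (DGOperad.truncHom (𝟙 (InitPlus k))), fun l p x => ?_,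
    fun ψ _ => ?_⟩
  · exact (map_zero _).trans (map_zero (f.map l p)).symm
  · ext l p x
    change ψ.map l p x = augmentation x.1 • basisImage R 0 l p
    by_cases hl : l = 0
    · subst hl
      rw [((InitPlus k).subsingleton_gradedTrunc_zero p).elim x 0, map_zero]
      exact ((congrArg (· • _) (map_zero augmentation)).trans (zero_smul k _)).symm
    by_cases h : l ≤ 1 ∧ p = 0
    · obtain ⟨hl, rfl⟩ := h
      obtain rfl : l = 1 := by omega
      have e : x = augmentation x.1 • (InitPlus k).gradedTrunc.ident := Subtype.ext (by
        have e := eq_smul x.1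
        rwa [basisImage_one] at e)
      rw [basisImage_one]
      exact (congrArg _ e).trans ((map_smul _ _ _).trans (congrArg _ ψ.map_ident))
    · have e : x = 0 := Subtype.ext (eq_zero_of_not h x.1)
      rw [e, map_zero]
      exact ((congrArg (· • _) (map_zero augmentation)).trans (zero_smul k _)).symm

end

namespace DGOperad

variable {k : Type u} [Field k]

/-! ### The sequence of approximations -/

/-- A multiplication `μ` on `P` with a strict unit `v`. -/
structure UnitalMultiplication (P : DGOperad k) where
  v : P.obj 0 0
  d_v : P.d 0 0 v = 0
  μ : P.obj 2 0
  d_μ : P.d 2 0 μ = 0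
  res_μ : ∀ i, P.res v i μ = P.ident

/-- The multiplication given by a morphism from the unitary associative operad. -/
noncomputable def UnitalMultiplication.ofAssPlus {P : DGOperad k} (φ : AssPlus k ⟶ P) :
    UnitalMultiplication P where
  v := φ.map 0 0 (AssPlus.unit k)
  d_v := (φ.map_d _).symm.trans (map_zero _)
  μ := φ.map 2 0 ⟨Finsupp.single (1 : Equiv.Perm (Fin 2)) 1, fun h => absurd rfl h⟩
  d_μ := (φ.map_d _).symm.trans (map_zero _)
  res_μ i := by
    refine (map_res φ (AssPlus.unit k) i _).symm.trans ?_
    refine Eq.trans (congrArg (φ.map 1 0) (Subtype.ext ?_)) φ.map_ident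
    change bilinExt k (assSet.comp (by omega : 2 + 0 = 1 + 1) i)
      (Finsupp.single (1 : Equiv.Perm (Fin 2)) 1) (Finsupp.single (1 : Equiv.Perm (Fin 0)) 1)
        = Finsupp.single (1 : Equiv.Perm (Fin 1)) 1
    refine (bilinExt_single k _ _ _ _ _).trans ?_
    rw [mul_one]
    congr 1
    exact Subsingleton.elim (α := Equiv.Perm (Fin 1)) _ _

theorem exists_not_boundary_of_iso {P : DGOperad k} {l : ℕ} {p : ℤ}
    (h : Nonempty ((P.complex l).homology (p + 1) ≅ ModuleCat.of k k)) :
    ∃ x : P.obj l (p + 1), P.d l (p + 1) x = 0 ∧ ¬ ∃ v, P.d l p v = x := by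
  by_contra! hcon
  have hex : (P.complex l).ExactAt (p + 1) := by
    rw [HomologicalComplex.exactAt_iff' _ p (p + 1) (p + 1 + 1) (by simp) (by simp),
      ShortComplex.moduleCat_exact_iff]
    intro x hx
    obtain ⟨v, hv⟩ := hcon x ((P.complex_d_apply l (p + 1) x).symm.trans hx)
    exact ⟨v, (P.complex_d_apply l p v).trans hv⟩
  rw [HomologicalComplex.exactAt_iff_isZero_homology] at hex
  obtain ⟨a⟩ := h
  have hk : IsZero (ModuleCat.of k k) := hex.of_iso a.symm
  have := ModuleCat.subsingleton_of_isZero hk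
  exact one_ne_zero (this.elim (1 : k) 0)

/-- If `d w` were the identity, then `d (w ∘ x) = x` for each cocycle `x` of `P(0)`, against
`HP(0) = k`. -/
theorem ident_not_boundary {P : DGOperad k} (h : P.CohomologyIsGround 0) :
    ¬ ∃ w, P.d 1 (-1) w = P.ident := by
  rintro ⟨w, hw⟩
  obtain ⟨x, hx, hne⟩ := exists_not_boundary_of_iso (p := -1) h.1
  refine hne ⟨P.comp (by omega : 1 + 0 = 0 + 1) (by omega : -1 + 0 = -1) 0 w
    (show P.obj 0 0 from x), ?_⟩
  rw [P.d_comp, hw]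
  have e : P.d 0 0 (show P.obj 0 0 from x) = 0 := hx
  rw [e, map_zero, smul_zero, add_zero]
  exact P.ident_comp (m := 0) (q := 0) rfl rfl 0 x

/-- If `d w = v`, then `d (μ ∘_0 w)` is the identity. -/
theorem UnitalMultiplication.unit_not_boundary {P : DGOperad k} (A : UnitalMultiplication P)
    (h : P.CohomologyIsGround 0) : ¬ ∃ w, P.d 0 (-1) w = A.v := by
  rintro ⟨w, hw⟩
  refine ident_not_boundary h ⟨P.comp (by omega : 2 + 0 = 1 + 1) (by omega : 0 + -1 = -1) 0 A.μ w,
    ?_⟩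
  rw [P.d_comp, hw, A.d_μ, map_zero, LinearMap.zero_apply, zero_add, Int.negOnePow_zero, one_smul]
  exact A.res_μ 0

/-- The morphism `I₊ ⟶ P` is a quasi-isomorphism in arity `l ≤ 1` if the image of the basis element
is a cocycle that is not a boundary. -/
theorem isQuisAt_desc_of_not_boundary {P : DGOperad k} {v : P.obj 0 0}
    {hv : P.d 0 0 v = 0} {l : ℕ} (hl : l ≤ 1) (h : P.CohomologyIsGround l)
    (hd : P.d l 0 (InitPlus.basisImage P.toGradedOperad v l 0) = 0)
    (hne : ¬ ∃ w, P.d l (-1) w = InitPlus.basisImage P.toGradedOperad v l 0) :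
    IsQuisAt (InitPlus.desc P v hv) l := by
  refine ⟨fun p x hx ⟨w, hw⟩ => ?_, fun p y hy => ?_⟩
  · by_cases hp : p = -1
    · subst hp
      rw [InitPlus.desc_apply] at hw
      by_cases ha : InitPlus.augmentation x = 0
      · refine ⟨0, ?_⟩
        rw [map_zero]
        exact (InitPlus.augmentation_injective (ha.trans (map_zero _).symm)).symm
      · refine absurd ⟨(InitPlus.augmentation x)⁻¹ • w, ?_⟩ hne
        rw [map_smul, hw, smul_smul, inv_mul_cancel₀ ha, one_smul]
        rfl
    · exact ⟨0, (map_zero _).trans (InitPlus.eq_zero_of_not (fun h => hp (by omega)) x).symm⟩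
  · by_cases hp : p = -1
    · subst hp
      obtain ⟨c, w, hcw⟩ := exists_eq_smul_add_of_iso (p := -1) h.1
        (InitPlus.basisImage P.toGradedOperad v l 0) hd hne y hy
      refine ⟨c • InitPlus.basisImage (InitPlus k).toGradedOperad (InitPlus.unit k) l 0, w,
        rfl, hcw.trans (congrArg (· + _) ?_)⟩
      rw [InitPlus.desc_apply]
      have e : InitPlus.augmentation
          (InitPlus.basisImage (InitPlus k).toGradedOperad (InitPlus.unit k) l 0) = 1 := by
        rcases Nat.le_one_iff_eq_zero_or_eq_one.mp hl with rfl | rfl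
        · rw [InitPlus.basisImage_zero, InitPlus.augmentation_unit]
        · rw [InitPlus.basisImage_one, InitPlus.augmentation_ident]
      have e' : InitPlus.augmentation
          (c • InitPlus.basisImage (InitPlus k).toGradedOperad (InitPlus.unit k) l 0) = c := by
        rw [map_smul, e, smul_eq_mul, mul_one]
      exact (congrArg (· • InitPlus.basisImage P.toGradedOperad v l 0) e').symm
    · obtain ⟨w, hw⟩ := exists_d_eq_of_isZero (h.2 (p + 1) (by omega)) y hy
      exact ⟨0, w, map_zero _, by rw [map_zero, zero_add, hw]⟩

theorem UnitalMultiplication.isQuisAt_desc_zero {P : DGOperad k} (A : UnitalMultiplication P)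
    (h : P.CohomologyIsGround 0) : IsQuisAt (InitPlus.desc P A.v A.d_v) 0 :=
  isQuisAt_desc_of_not_boundary (by omega) h (by rw [InitPlus.basisImage_zero, A.d_v])
    (by rw [InitPlus.basisImage_zero]; exact A.unit_not_boundary h)

theorem UnitalMultiplication.isQuisAt_desc_one {P : DGOperad k} (A : UnitalMultiplication P)
    (h0 : P.CohomologyIsGround 0) (h : P.CohomologyIsGround 1) :
    IsQuisAt (InitPlus.desc P A.v A.d_v) 1 :=
  isQuisAt_desc_of_not_boundary le_rfl h
    (by rw [InitPlus.basisImage_one]; exact P.differential.d_ident)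
    (by rw [InitPlus.basisImage_one]; exact ident_not_boundary h0)

/-- A stage of the construction of the minimal model: a unitary operad `Q = Γ₊₁(M)` with a morphism
to `P` which is a quasi-isomorphism up to arity `j + 1`, and such that the cocycles of its mapping
cone in arity `j + 2` lift to possible generators of an extension. -/
structure Approximation {P : DGOperad k} (A : UnitalMultiplication P) (j : ℕ) where
  Q : DGOperad k
  u : Q.obj 0 0
  isUnitary : Q.IsUnitary u
  M : SigmaModule k
  M_trivial : ∀ l : ℕ, l ≤ 1 → ∀ p : ℤ, Subsingleton (M.obj l p)
  inclM : SigmaModule.Hom M Q.gradedTrunc.toSigmaModule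
  free : GradedOperad.IsFree M Q.gradedTrunc inclM
  ρ : Q ⟶ P
  ρ_u : ρ.map 0 0 u = A.v
  quis : ∀ l ≤ j + 1, IsQuisAt ρ l
  lifting : ConeLifting ρ u (j + 2)

namespace Approximation

variable {P : DGOperad k} {A : UnitalMultiplication P}

/-- The initial stage `I₊`. -/
noncomputable def initial (A : UnitalMultiplication P) (h0 : P.CohomologyIsGround 0)
    (h1 : P.CohomologyIsGround 1) : Approximation A 0 where
  Q := InitPlus k
  u := InitPlus.unit k
  isUnitary := InitPlus.isUnitary
  M := SigmaModule.zero k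
  M_trivial _ _ _ := inferInstanceAs (Subsingleton PUnit)
  inclM := SigmaModule.fromZero _
  free := InitPlus.isFree
  ρ := InitPlus.desc P A.v A.d_v
  ρ_u := InitPlus.desc_unit P A.v A.d_v
  quis l hl := by
    rcases Nat.le_one_iff_eq_zero_or_eq_one.mp hl with rfl | rfl
    · exact A.isQuisAt_desc_zero h0
    · exact A.isQuisAt_desc_one h0 h1
  lifting := coneLifting_two (A.isQuisAt_desc_zero h0) (A.isQuisAt_desc_one h0 h1)
    InitPlus.isUnitary
    (fun _ x => exists_eq_smul_tr_ident (fun _ _ _ => inferInstanceAs (Subsingleton PUnit))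
      InitPlus.isFree x)
    (fun p => ⟨fun x y => (InitPlus.eq_zero_of_not (by omega) x).trans
      (InitPlus.eq_zero_of_not (by omega) y).symm⟩)
    (InitPlus.desc_unit P A.v A.d_v) A.d_μ A.res_μ

variable [CharZero k] {j : ℕ} (T : Approximation A j)

/-- The data of the principal extension to the next stage. -/
noncomputable def cellData : CellData T.Q T.u (j + 1) :=
  DGOperad.cellData (ρ := T.ρ) (by omega) T.isUnitary T.M_trivial T.free

/-- The morphism from the next stage to `P`. -/
noncomputable def nextMap : T.cellData.target ⟶ P :=
  (cellExtension (ρ := T.ρ) (by omega) T.isUnitary T.M_trivial T.free).hom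

theorem ι_nextMap : T.cellData.ι ≫ T.nextMap = T.ρ :=
  (cellExtension (ρ := T.ρ) (by omega) T.isUnitary T.M_trivial T.free).ι_hom

theorem isQuisAt_nextMap (l : ℕ) (hl : l ≤ j + 2) : IsQuisAt T.nextMap l := by
  rcases Nat.lt_succ_iff_lt_or_eq.mp (Nat.lt_succ_of_le hl) with h | rfl
  · exact isQuisAt_cellExtension_of_le _ _ _ _ (by omega) (T.quis l (by omega))
  · exact isQuisAt_cellExtension _ _ _ _ T.lifting

theorem nextMap_unit : T.nextMap.map 0 0 (T.cellData.ι.map 0 0 T.u) = A.v :=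
  (congrArg (fun f : T.Q ⟶ P => f.map 0 0 T.u) T.ι_nextMap).trans T.ρ_u

theorem next_M_trivial (l : ℕ) (hl : l ≤ 1) (p : ℤ) :
    Subsingleton ((T.cellData.M.sum T.cellData.E).obj l p) := by
  have := T.M_trivial l hl p
  have := T.cellData.E_homogeneous l (by omega) p
  exact inferInstanceAs (Subsingleton (T.M.obj l p × T.cellData.E.obj l p))

/-- The next stage. -/
noncomputable def next : Approximation A (j + 1) where
  Q := T.cellData.target
  u := T.cellData.ι.map 0 0 T.u
  isUnitary := T.cellData.isUnitary_target
  M := T.cellData.M.sum T.cellData.E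
  M_trivial := T.next_M_trivial
  inclM := T.cellData.inclGen
  free := T.cellData.isFree_target
  ρ := T.nextMap
  ρ_u := T.nextMap_unit
  quis := T.isQuisAt_nextMap
  lifting := by
    obtain ⟨ν, hν, hνu⟩ := exists_multiplication (T.isQuisAt_nextMap 1 (by omega))
      (T.isQuisAt_nextMap 2 (by omega)) T.cellData.isUnitary_target
      (fun _ x => exists_eq_smul_tr_ident T.next_M_trivial T.cellData.isFree_target x)
      T.nextMap_unit A.d_μ A.res_μ
    exact coneLifting_of_multiplication (T.isQuisAt_nextMap (j + 2) le_rfl)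
      (T.cellData.isUnitary_target.d_eq_zero _) hν hνu

end Approximation

/-- The stages of the construction. -/
noncomputable def approximation [CharZero k] {P : DGOperad k} (A : UnitalMultiplication P)
    (h0 : P.CohomologyIsGround 0) (h1 : P.CohomologyIsGround 1) :
    (j : ℕ) → Approximation A j
  | 0 => Approximation.initial A h0 h1
  | j + 1 => (approximation A h0 h1 j).next

end DGOperad

namespace DGOperad

variable {k : Type u} [Field k]

/-! ### Sequential colimits of dg operads -/

namespace SeqColimit

variable (F : ℕ ⥤ DGOperad k)

/-- The transition maps of a sequence of dg operads. -/
def trans (l : ℕ) (p : ℤ) (i j : ℕ) (h : i ≤ j) : (F.obj i).obj l p →ₗ[k] (F.obj j).obj l p :=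
  (F.map (homOfLE h)).map l p

/-- The parts of a fixed arity and degree of a sequence of dg operads form a directed system. -/
instance directedSystem (l : ℕ) (p : ℤ) :
    DirectedSystem (fun j => (F.obj j).obj l p) (fun i j h => trans F l p i j h) where
  map_self i x := by
    have h : F.map (homOfLE (le_refl i)) = 𝟙 _ := F.map_id i
    change (F.map (homOfLE (le_refl i))).map l p x = x
    rw [h]
    rfl
  map_map j i m hij hjm x := by
    have h : F.map (homOfLE (hij.trans hjm)) = F.map (homOfLE hij) ≫ F.map (homOfLE hjm) :=
      F.map_comp (homOfLE hij) (homOfLE hjm)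
    change _ = (F.map (homOfLE (hij.trans hjm))).map l p x
    rw [h]
    rfl

/-- The colimit in arity `l` and degree `p`. -/
abbrev Obj (l : ℕ) (p : ℤ) : Type u :=
  DirectLimit (fun j => (F.obj j).obj l p) (trans F l p)

variable {F} {l m n : ℕ} {p q r : ℤ}

/-- The map from a term of the sequence to the colimit. -/
def of (j : ℕ) : (F.obj j).obj l p →ₗ[k] Obj F l p where
  toFun x := Quotient.mk _ ⟨j, x⟩
  map_add' x y := by
    exact (DirectLimit.add_def (f := trans F l p) (G := fun j => (F.obj j).obj l p) j x y).symm
  map_smul' c x := by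
    exact (DirectLimit.smul_def (f := trans F l p) (G := fun j => (F.obj j).obj l p) j x c).symm

theorem of_trans {i j : ℕ} (h : i ≤ j) (x : (F.obj i).obj l p) :
    of j ((F.map (homOfLE h)).map l p x) = of i x :=
  by
  exact DirectLimit.mk_apply (F := fun j => (F.obj j).obj l p) (f := trans F l p) i j x h

theorem exists_of (z : Obj F l p) : ∃ j x, z = of j x := DirectLimit.exists_eq_mk _ z

theorem exists_of_of_le (N : ℕ) (z : Obj F l p) : ∃ j x, N ≤ j ∧ z = of j x := by
  obtain ⟨j, x, rfl⟩ := exists_of z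
  exact ⟨max N j, _, le_max_left _ _, (of_trans (le_max_right N j) x).symm⟩

theorem of_injective (h : ∀ i j (hij : i ≤ j), Function.Injective ((F.map (homOfLE hij)).map l p))
    (j : ℕ) : Function.Injective (of j : (F.obj j).obj l p →ₗ[k] Obj F l p) :=
  DirectLimit.mk_injective (trans F l p) h j

/-- The linear map on the colimit given by a compatible family of linear maps. -/
def desc {W : Type*} [AddCommGroup W] [Module k W] (g : ∀ j, (F.obj j).obj l p →ₗ[k] W)
    (hg : ∀ i j (h : i ≤ j) x, g i x = g j ((F.map (homOfLE h)).map l p x)) :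
    Obj F l p →ₗ[k] W where
  toFun := DirectLimit.lift (trans F l p) (fun j => g j) hg
  map_add' z w := by
    obtain ⟨j, x, y, rfl, rfl⟩ := DirectLimit.exists_eq_mk₂ _ z w
    exact (congrArg _ (map_add (of j) x y).symm).trans (map_add (g j) x y)
  map_smul' c z := by
    obtain ⟨j, x, rfl⟩ := exists_of z
    exact (congrArg _ (map_smul (of j) c x).symm).trans (map_smul (g j) c x)

/-- The composition in the colimit. -/
noncomputable def compFun (hn : l + m = n + 1) (hr : p + q = r) (i : Fin l) :
    Obj F l p → Obj F m q → Obj F n r :=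
  DirectLimit.map₂ (trans F l p) (trans F m q) (trans F n r)
    (fun j x y => (F.obj j).comp hn hr i x y)
    (fun _ _ h x y => (F.map (homOfLE h)).map_comp hn hr i x y)

theorem compFun_of (hn : l + m = n + 1) (hr : p + q = r) (i : Fin l) (j : ℕ)
    (x : (F.obj j).obj l p) (y : (F.obj j).obj m q) :
    compFun hn hr i (of j x) (of j y) = of j ((F.obj j).comp hn hr i x y) :=
  DirectLimit.map₂_def (trans F l p) (trans F m q) (trans F n r)
    (fun j x y => (F.obj j).comp hn hr i x y)
    (fun _ _ h x y => (F.map (homOfLE h)).map_comp hn hr i x y) j x y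

theorem exists_of₂ (z : Obj F l p) (w : Obj F m q) : ∃ j x y, z = of j x ∧ w = of j y := by
  obtain ⟨i, x, rfl⟩ := exists_of z
  obtain ⟨j, y, rfl⟩ := exists_of w
  exact ⟨max i j, _, _, (of_trans (le_max_left i j) x).symm, (of_trans (le_max_right i j) y).symm⟩

theorem exists_of₃ {a : ℕ} {b : ℤ} (z : Obj F l p) (w : Obj F m q) (v : Obj F a b) :
    ∃ j x y t, z = of j x ∧ w = of j y ∧ v = of j t := by
  obtain ⟨i, x, y, rfl, rfl⟩ := exists_of₂ z w
  obtain ⟨j, t, rfl⟩ := exists_of v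
  exact ⟨max i j, _, _, _, (of_trans (le_max_left i j) x).symm,
    (of_trans (le_max_left i j) y).symm, (of_trans (le_max_right i j) t).symm⟩

/-- The composition in the colimit, as a bilinear map. -/
noncomputable def comp (hn : l + m = n + 1) (hr : p + q = r) (i : Fin l) :
    Obj F l p →ₗ[k] Obj F m q →ₗ[k] Obj F n r :=
  LinearMap.mk₂ k (compFun hn hr i)
    (fun x y z => by
      obtain ⟨j, x, y, z, rfl, rfl, rfl⟩ := exists_of₃ x y z
      rw [← map_add, compFun_of, compFun_of, compFun_of, map_add, LinearMap.add_apply, map_add])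
    (fun c x y => by
      obtain ⟨j, x, y, rfl, rfl⟩ := exists_of₂ x y
      rw [← map_smul, compFun_of, compFun_of, map_smul, LinearMap.smul_apply, map_smul])
    (fun x y z => by
      obtain ⟨j, x, y, z, rfl, rfl, rfl⟩ := exists_of₃ x y z
      rw [← map_add, compFun_of, compFun_of, compFun_of, map_add, map_add])
    (fun c x y => by
      obtain ⟨j, x, y, rfl, rfl⟩ := exists_of₂ x y
      rw [← map_smul, compFun_of, compFun_of, map_smul, map_smul])

theorem comp_of (hn : l + m = n + 1) (hr : p + q = r) (i : Fin l) (j : ℕ)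
    (x : (F.obj j).obj l p) (y : (F.obj j).obj m q) :
    comp hn hr i (of j x) (of j y) = of j ((F.obj j).comp hn hr i x y) :=
  compFun_of hn hr i j x y

/-- The action of the symmetric groups on the colimit. -/
noncomputable def act (σ : Equiv.Perm (Fin l)) : Obj F l p →ₗ[k] Obj F l p :=
  desc (fun j => (of j).comp ((F.obj j).act σ)) (fun i j h x => by
    change of i _ = of j _
    rw [← (F.map (homOfLE h)).map_act, of_trans])

theorem act_of (σ : Equiv.Perm (Fin l)) (j : ℕ) (x : (F.obj j).obj l p) :
    act σ (of j x) = of j ((F.obj j).act σ x) := rfl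

/-- The differential of the colimit. -/
noncomputable def d (l : ℕ) (p : ℤ) : Obj F l p →ₗ[k] Obj F l (p + 1) :=
  desc (fun j => (of j).comp ((F.obj j).d l p)) (fun i j h x => by
    change of i _ = of j _
    rw [← (F.map (homOfLE h)).map_d, of_trans])

theorem d_of (j : ℕ) (x : (F.obj j).obj l p) : d l p (of j x) = of j ((F.obj j).d l p x) := rfl

variable (F)

theorem of_ident (j : ℕ) : of j (F.obj j).ident = of 0 (F.obj 0).ident := by
  rw [← of_trans (Nat.zero_le j), (F.map (homOfLE (Nat.zero_le j))).map_ident]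

/-- The colimit of a sequence of dg operads. -/
noncomputable def colimit : DGOperad k where
  obj := Obj F
  act := act
  act_one x := by
    obtain ⟨j, x, rfl⟩ := exists_of x
    rw [act_of, SigmaModule.act_one]
  act_mul σ τ x := by
    obtain ⟨j, x, rfl⟩ := exists_of x
    rw [act_of, act_of, act_of, SigmaModule.act_mul]
  ident := of 0 (F.obj 0).ident
  comp := comp
  ident_comp hn hr i y := by
    obtain ⟨j, y, rfl⟩ := exists_of y
    rw [← of_ident F j, comp_of, GradedOperad.ident_comp]
  comp_ident hn hr i x := by
    obtain ⟨j, x, rfl⟩ := exists_of x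
    rw [← of_ident F j, comp_of, GradedOperad.comp_ident]
  comp_assoc h₁ g₁ h₂ g₂ h₃ g₃ h₄ g₄ i j e he x y z := by
    obtain ⟨a, x, y, z, rfl, rfl, rfl⟩ := exists_of₃ x y z
    rw [comp_of, comp_of, comp_of, comp_of,
      (F.obj a).comp_assoc h₁ g₁ h₂ g₂ h₃ g₃ h₄ g₄ i j e he]
  comp_comm h₁ g₁ h₂ g₂ h₃ g₃ h₄ g₄ i j e e' hij he he' x y z := by
    obtain ⟨a, x, y, z, rfl, rfl, rfl⟩ := exists_of₃ x y z
    rw [comp_of, comp_of, comp_of, comp_of,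
      (F.obj a).comp_comm h₁ g₁ h₂ g₂ h₃ g₃ h₄ g₄ i j e e' hij he he', map_zsmul_unit]
  comp_act hn hr i σ τ x y := by
    obtain ⟨a, x, y, rfl, rfl⟩ := exists_of₂ x y
    rw [act_of, act_of, comp_of, comp_of, act_of, (F.obj a).comp_act]
  d := d
  d_d x := by
    obtain ⟨j, x, rfl⟩ := exists_of x
    rw [d_of, d_of, (F.obj j).d_d, map_zero]
  d_act σ x := by
    obtain ⟨j, x, rfl⟩ := exists_of x
    rw [act_of, d_of, d_of, act_of, (F.obj j).d_act]
  d_comp hn hr i x y := by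
    obtain ⟨a, x, y, rfl, rfl⟩ := exists_of₂ x y
    rw [comp_of, d_of, d_of, d_of, comp_of, comp_of, (F.obj a).d_comp, map_add, map_zsmul_unit]

/-- The map from a term of the sequence to the colimit, as a morphism of dg operads. -/
noncomputable def toColimit (j : ℕ) : F.obj j ⟶ colimit F :=
  show Hom (F.obj j) (colimit F) from
  { map := fun _ _ => of j
    map_act := fun _ _ => rfl
    map_ident := of_ident F j
    map_comp := fun hn hr i x y => (comp_of hn hr i j x y).symm
    map_d := fun _ => rfl }

/-- The colimit cocone. -/
noncomputable def cocone : Cocone F where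
  pt := colimit F
  ι :=
    { app := toColimit F
      naturality := fun i j f => by
        refine Hom.ext ?_
        funext l p
        refine LinearMap.ext fun x => ?_
        exact of_trans (leOfHom f) x }

/-- The morphism from the colimit given by a cocone. -/
noncomputable def descHom (c : Cocone F) : colimit F ⟶ c.pt :=
  have hc : ∀ (l : ℕ) (p : ℤ) (i j : ℕ) (h : i ≤ j) (x : (F.obj i).obj l p),
      (c.ι.app i).map l p x = (c.ι.app j).map l p ((F.map (homOfLE h)).map l p x) :=
    fun l p i j h x => congrArg (fun f : F.obj i ⟶ c.pt => f.map l p x) (c.w (homOfLE h)).symm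
  show Hom (colimit F) c.pt from
  { map := fun l p => desc (fun j => (c.ι.app j).map l p) (hc l p)
    map_act := fun σ x => by
      obtain ⟨j, x, rfl⟩ := exists_of x
      exact (c.ι.app j).map_act σ x
    map_ident := (c.ι.app 0).map_ident
    map_comp := fun hn hr i x y => by
      obtain ⟨j, x, y, rfl, rfl⟩ := exists_of₂ x y
      exact (congrArg _ (comp_of hn hr i j x y)).trans ((c.ι.app j).map_comp hn hr i x y)
    map_d := fun x => by
      obtain ⟨j, x, rfl⟩ := exists_of x
      exact (c.ι.app j).map_d x }

/-- The colimit cocone is a colimit. -/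
noncomputable def isColimit : IsColimit (cocone F) where
  desc := descHom F
  fac c j := rfl
  uniq c f h := by
    refine Hom.ext ?_
    funext l p
    refine LinearMap.ext fun x => ?_
    obtain ⟨j, x, rfl⟩ := exists_of x
    exact congrArg (fun g : F.obj j ⟶ c.pt => g.map l p x) (h j)

end SeqColimit

end DGOperad

namespace DGOperad

variable {k : Type u} [Field k]

/-! ### The minimal model -/

theorem IsGround.of_equiv {P Q : DGOperad k} {l : ℕ}
    (e : ∀ p : ℤ, Nonempty (P.obj l p ≃ₗ[k] Q.obj l p)) (h : P.IsGround l) : Q.IsGround l := by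
  refine ⟨?_, fun p hp => ?_⟩
  · obtain ⟨a⟩ := e 0
    obtain ⟨b⟩ := h.1
    exact ⟨a.symm.trans b⟩
  · obtain ⟨a⟩ := e p
    have := h.2 p hp
    exact a.symm.injective.subsingleton

theorem InitPlus.isGround {l : ℕ} (hl : l ≤ 1) : (InitPlus k).IsGround l := by
  refine ⟨⟨LinearEquiv.ofBijective InitPlus.augmentation
    ⟨InitPlus.augmentation_injective, fun c => ?_⟩⟩, fun p hp => ⟨fun x y => ?_⟩⟩
  · rcases Nat.le_one_iff_eq_zero_or_eq_one.mp hl with rfl | rfl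
    · exact ⟨c • InitPlus.unit k,
        by rw [map_smul, InitPlus.augmentation_unit, smul_eq_mul, mul_one]⟩
    · exact ⟨c • (InitPlus k).ident,
        by rw [map_smul, InitPlus.augmentation_ident, smul_eq_mul, mul_one]⟩
  · exact (InitPlus.eq_zero_of_not (fun h => hp h.2) x).trans
      (InitPlus.eq_zero_of_not (fun h => hp h.2) y).symm

theorem IsQuisAt.of_comp_bijective {P Q R : DGOperad k} {f : P ⟶ Q} {g : Q ⟶ R} {l : ℕ}
    (hf : ∀ p, Function.Bijective (f.map l p)) (h : IsQuisAt (f ≫ g) l) : IsQuisAt g l := by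
  refine ⟨fun p x hx hgx => ?_, fun p y hy => ?_⟩
  · obtain ⟨x, rfl⟩ := (hf (p + 1)).2 x
    rw [← f.map_d] at hx
    obtain ⟨w, rfl⟩ := h.1 p x ((hf _).1 (hx.trans (map_zero _).symm)) hgx
    exact ⟨f.map l p w, (f.map_d w).symm⟩
  · obtain ⟨x, w, hx, hxw⟩ := h.2 p y hy
    exact ⟨f.map l (p + 1) x, w, by rw [← f.map_d, hx, map_zero], hxw⟩

section Sequence

variable {X : ℕ → DGOperad k} {f : ∀ j, X j ⟶ X (j + 1)} {l : ℕ} {p : ℤ}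

/-- A property of morphisms which holds for the steps of a sequence from some index on, for the
identities and for composites, holds for the transition morphisms. -/
theorem ofSequence_map_induction {C : ∀ {P Q : DGOperad k}, (P ⟶ Q) → Prop}
    (hid : ∀ P : DGOperad k, C (𝟙 P))
    (hcomp : ∀ {P Q R : DGOperad k} (a : P ⟶ Q) (b : Q ⟶ R), C a → C b → C (a ≫ b))
    {N : ℕ} (hf : ∀ j, N ≤ j → C (f j)) {i j : ℕ} (hi : N ≤ i) (h : i ≤ j) :
    C ((Functor.ofSequence f).map (homOfLE h)) := by
  induction j, h using Nat.le_induction with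
  | base =>
    have e : (Functor.ofSequence f).map (homOfLE (le_refl i)) = 𝟙 (X i) :=
      (Functor.ofSequence f).map_id i
    rw [e]
    exact hid _
  | succ j h ih =>
    have e : (Functor.ofSequence f).map (homOfLE (h.trans (Nat.le_add_right j 1)))
        = (Functor.ofSequence f).map (homOfLE h) ≫ f j :=
      ((Functor.ofSequence f).map_comp (homOfLE h) (homOfLE (Nat.le_add_right j 1))).trans
        (congrArg (_ ≫ ·) (Functor.ofSequence_map_homOfLE_succ f j))
    exact e ▸ hcomp _ _ ih (hf j (hi.trans h))

theorem SeqColimit.bijective_of {N : ℕ} (hinj : ∀ j, Function.Injective ((f j).map l p))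
    (hsurj : ∀ j, N ≤ j → Function.Surjective ((f j).map l p)) :
    Function.Bijective
      (SeqColimit.of (F := Functor.ofSequence f) (l := l) (p := p) N) := by
  refine ⟨SeqColimit.of_injective (F := Functor.ofSequence f) (fun i j h => ?_) N, fun z => ?_⟩
  · exact ofSequence_map_induction (C := fun a => Function.Injective (a.map l p))
      (fun _ => Function.injective_id) (fun _ _ ha hb => hb.comp ha) (N := 0)
      (fun j _ => hinj j) (Nat.zero_le i) h
  · obtain ⟨j, x, hj, rfl⟩ := SeqColimit.exists_of_of_le N z
    obtain ⟨y, rfl⟩ := ofSequence_map_induction (C := fun a => Function.Surjective (a.map l p))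
      (fun _ => Function.surjective_id) (fun _ _ ha hb => hb.comp ha) hsurj le_rfl hj x
    exact ⟨y, (SeqColimit.of_trans (F := Functor.ofSequence f) hj y).symm⟩

end Sequence

section Model

variable [CharZero k] {P : DGOperad k} (A : UnitalMultiplication P) (h0 : P.CohomologyIsGround 0)
  (h1 : P.CohomologyIsGround 1)

/-- The principal extension from a stage of the minimal model to the next. -/
noncomputable def modelStep (j : ℕ) :
    (approximation A h0 h1 j).Q ⟶ (approximation A h0 h1 (j + 1)).Q :=
  (approximation A h0 h1 j).cellData.ι

/-- The steps of the sequence are principal extensions. -/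
noncomputable def modelExtension (j : ℕ) :
    UnitaryPrincipalExtension (modelStep A h0 h1 j) (approximation A h0 h1 j).u (j + 1) :=
  (approximation A h0 h1 j).cellData.extension

/-- The minimal model, the colimit of the stages. -/
noncomputable def model : DGOperad k :=
  SeqColimit.colimit (Functor.ofSequence (modelStep A h0 h1))

/-- The minimal model is a unitary Sullivan minimal operad. -/
noncomputable def modelSullivan : (model A h0 h1).UnitarySullivanMinimal where
  stage j := (approximation A h0 h1 j).Q
  step := modelStep A h0 h1
  initial := Iso.refl _
  unit j := (approximation A h0 h1 j).u
  unit_zero := rfl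
  unit_succ _ := rfl
  extension := modelExtension A h0 h1
  toColimit := (SeqColimit.cocone _).ι
  isColimit := SeqColimit.isColimit _

/-- The morphisms from the stages to `P`, as a cocone. -/
noncomputable def modelCocone : Cocone (Functor.ofSequence (modelStep A h0 h1)) where
  pt := P
  ι := NatTrans.ofSequence (fun j => (approximation A h0 h1 j).ρ) (fun j => by
    rw [Functor.ofSequence_map_homOfLE_succ]
    exact (approximation A h0 h1 j).ι_nextMap.trans (Category.comp_id _).symm)

/-- The quasi-isomorphism from the minimal model. -/
noncomputable def modelMap : model A h0 h1 ⟶ P :=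
  SeqColimit.descHom _ (modelCocone A h0 h1)

/-- In arity `l` the sequence of the stages is stationary from the stage `l - 1` on. -/
theorem bijective_toColimit {l j : ℕ} (h : l ≤ j + 1) (p : ℤ) :
    Function.Bijective
      ((SeqColimit.toColimit (Functor.ofSequence (modelStep A h0 h1)) j).map l p) :=
  SeqColimit.bijective_of (fun j => (modelExtension A h0 h1 j).injective)
    (fun i hi => (modelExtension A h0 h1 i).surjective (by omega))

theorem isQuis_modelMap : IsQuis (modelMap A h0 h1) :=
  isQuis_of_isQuisAt fun l => IsQuisAt.of_comp_bijective
    (bijective_toColimit A h0 h1 (Nat.le_succ l)) ((approximation A h0 h1 l).quis l (Nat.le_succ l))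

theorem isGround_model {l : ℕ} (hl : l ≤ 1) : (model A h0 h1).IsGround l :=
  IsGround.of_equiv (fun p => ⟨LinearEquiv.ofBijective _ (bijective_toColimit A h0 h1 hl p)⟩)
    (InitPlus.isGround hl)

end Model

end DGOperad

theorem theorem5p2 {k : Type u} [Field k] [CharZero k] (P : DGOperad k)
    (φ : AssPlus k ⟶ P) (h1 : P.CohomologyIsGround 1) (h0 : P.CohomologyIsGround 0) :
    ∃ (Pinf : DGOperad k) (T : Pinf.UnitarySullivanMinimal) (ρ : Pinf ⟶ P),
      DGOperad.IsQuis ρ ∧ ρ.map 0 0 T.one = φ.map 0 0 (AssPlus.unit k) ∧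
      Pinf.IsGround 0 ∧ Pinf.IsGround 1 := by
  let A := DGOperad.UnitalMultiplication.ofAssPlus φ
  exact ⟨DGOperad.model A h0 h1, DGOperad.modelSullivan A h0 h1, DGOperad.modelMap A h0 h1,
    DGOperad.isQuis_modelMap A h0 h1, (DGOperad.approximation A h0 h1 0).ρ_u,
    DGOperad.isGround_model A h0 h1 (Nat.zero_le 1), DGOperad.isGround_model A h0 h1 le_rfl⟩
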